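/- **Setting.** Let $n\ge 1$ and let $S=(v_1,\dots,v_m)$ be a finite list of vectors of $\mathbb Z^n$. Write $(\cdot,\cdot)$ for the standard scalar product and $|a|^2=(a,a)$. Two distinct points $a,b$ are joined by a *black edge* with marking $(h,k)$, $h\ne k$, oriented from $a$ to $b$, if $b-a=v_k-v_h$ and $|b|^2-|a|^2=|v_k|^2-|v_h|^2$; they are joined by a *red edge* with marking $(h,k)$, $h\neq k$, if $a+b=v_h+v_k$ and $|a|^2+|b|^2=|v_h|^2+|v_k|^2$. These edges define the geometric graph $\Gamma_S$, with vertex set $\mathbb Z^n$; the same rules define a graph $\Gamma_S^{\mathbb R}$ with vertex set $\mathbb R^n$. The *special component* is the one whose set of vertices is $\{v_1,\dots,v_m\}$. An *abstract marked graph* is a connected graph with a colour (black or red) on each edge and a marking $(i,j)$, $1\le i\ne j\le m$, on each oriented edge, the opposite orientation having the marking $(j,i)$. A *solution* of such a graph $G$ assigns to each vertex of $G$ a point of $\mathbb Z^n$ so that each edge of $G$ goes to a pair of points satisfying the two equations of an edge of $\Gamma_S$ with the same colour and marking. A *realization* of $G$ is a solution that is a graph isomorphism of $G$ with a connected component of $\Gamma_S$.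 **Theorem.** For each $n\ge 1$ there is a finite list of nonzero polynomials with integer coefficients (the resonances), depending only on $n$, each one in some number $p\le 2(n+1)$ of vector variables with $n$ coordinates each, such that the following holds for all $m$ and all *generic* lists $S=(v_1,\dots,v_m)$ in $\mathbb Z^n$, that is, lists such that no resonance in $p$ vector variables vanishes at $(v_{i_1},\dots,v_{i_p})$ for pairwise different indices $i_1,\dots,i_p$. 1. The vertices of every connected component of $\Gamma_S$ other than the special one are affinely independent; hence there are at most $n+1$ of them. The same is true for $\Gamma_S^{\mathbb R}$. 2. Only finitely many connected components of $\Gamma_S$ contain red edges. 3. The connected components of $\Gamma_S$ without red edges are divided into finitely many families. Each family is indexed by an abstract marked graph $G$ with only black edges and with $k+1$ vertices, $k\le n$ (so that a spanning tree of $G$ has $k$ edges): there are finitely many such $G$ such that each component without red edges is the image of a realization of exactly one of them. For each $G$ in this finite list, the family of $G$ depends on the elements of an $(n-k)$-dimensional sublattice, in the following sense. There are $x_0$, assigning a point $x_0(a)\in\mathbb Z^n$ to each vertex $a$ of $G$, and a sublattice $L\subset\mathbb Z^n$ of rank $n-k$ such that - the solutions of $G$ are exactly the translates $x_0+y$, $y\in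 L$; - for each component in the family of $G$ there is exactly one $y\in L$ such that $x_0+y$ is a realization of $G$ on this component; - for all $y\in L$ outside a finite union of cosets of sublattices of $L$ of rank $<n-k$, the translate $x_0+y$ is a realization of $G$ on a component of $\Gamma_S$. -/

import Mathlib

/-!
The geometric graph `Γ_S` of a list `S = (v₁, …, v_m)` of vectors, and abstract coloured marked
graphs together with their geometric realizations.
Vectors are functions `Fin n → R`, with the standard scalar product `dotProduct`.
-/

/-- `a` and `b` are joined by a black edge, oriented from `a` to `b`, with marking `(h, k)`, that is
`b - a = v_k - v_h` and `|b|² - |a|² = |v_k|² - |v_h|²`. -/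
def IsBlackEdge {R : Type*} [CommRing R] {n m : ℕ} (v : Fin m → Fin n → R) (h k : Fin m)
    (a b : Fin n → R) : Prop :=
  b - a = v k - v h ∧
    dotProduct b b - dotProduct a a = dotProduct (v k) (v k) - dotProduct (v h) (v h)

/-- `a` and `b` are joined by a red edge with marking `(h, k)`, that is
`a + b = v_h + v_k` and `|a|² + |b|² = |v_h|² + |v_k|²`. -/
def IsRedEdge {R : Type*} [CommRing R] {n m : ℕ} (v : Fin m → Fin n → R) (h k : Fin m)
    (a b : Fin n → R) : Prop :=
  a + b = v h + v k ∧
    dotProduct a a + dotProduct b b = dotProduct (v h) (v h) + dotProduct (v k) (v k)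

theorem IsBlackEdge.symm {R : Type*} [CommRing R] {n m : ℕ} {v : Fin m → Fin n → R}
    {h k : Fin m} {a b : Fin n → R} (H : IsBlackEdge v h k a b) : IsBlackEdge v k h b a := by
  refine ⟨?_, ?_⟩
  · have h1 := congrArg Neg.neg H.1
    simpa using h1
  · have h2 := congrArg Neg.neg H.2
    simpa using h2

theorem IsRedEdge.symm {R : Type*} [CommRing R] {n m : ℕ} {v : Fin m → Fin n → R}
    {h k : Fin m} {a b : Fin n → R} (H : IsRedEdge v h k a b) : IsRedEdge v h k b a :=
  ⟨(add_comm b a).trans H.1, (add_comm _ _).trans H.2⟩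

/-- The geometric graph `Γ_S` on all vectors with entries in `R`: the vertices are the points of
`Rⁿ` (for us `R = ℝ` or `R = ℤ`), the edges are the black and the red edges. -/
def geomGraph {R : Type*} [CommRing R] {n m : ℕ} (v : Fin m → Fin n → R) :
    SimpleGraph (Fin n → R) where
  Adj a b := a ≠ b ∧ ∃ h k : Fin m, h ≠ k ∧ (IsBlackEdge v h k a b ∨ IsRedEdge v h k a b)
  symm := ⟨by
    rintro a b ⟨hab, h, k, hhk, H⟩
    rcases H with H | H
    · exact ⟨hab.symm, k, h, hhk.symm, Or.inl H.symm⟩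
    · exact ⟨hab.symm, h, k, hhk, Or.inr H.symm⟩⟩
  loopless := ⟨fun _ H => H.1 rfl⟩

/-- The connected component `C` of `Γ_S` contains a red edge. -/
def HasRedEdge {R : Type*} [CommRing R] {n m : ℕ} (v : Fin m → Fin n → R)
    (C : (geomGraph v).ConnectedComponent) : Prop :=
  ∃ a ∈ C.supp, ∃ b ∈ C.supp, a ≠ b ∧ ∃ h k : Fin m, h ≠ k ∧ IsRedEdge v h k a b

/-- The list of vectors `v` is generic with respect to a finite list of polynomials (the
resonances), each one in `p` vector variables `y₁, …, y_p` with `n` coordinates each: no resonance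
vanishes at any list of `p` of the vectors of `v` with pairwise different indices. -/
def IsGeneric {n m : ℕ} (res : Finset (Σ p : ℕ, MvPolynomial (Fin p × Fin n) ℤ))
    (v : Fin m → Fin n → ℤ) : Prop :=
  ∀ P ∈ res, ∀ s : Fin P.1 ↪ Fin m,
    MvPolynomial.eval (fun q : Fin P.1 × Fin n => v (s q.1) q.2) P.2 ≠ 0

/-- The two colours of edges. -/
inductive EdgeColor : Type
  | black : EdgeColor
  | red : EdgeColor

/-- An abstract coloured marked graph: a connected graph with a colour on each edge and with a
marking `(i, j)`, `i ≠ j`, on each oriented edge, the opposite orientation having the exchanged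
marking. -/
structure MGraph (m : ℕ) (V : Type*) where
  /-- The underlying graph. -/
  graph : SimpleGraph V
  connected : graph.Connected
  /-- The colour of an edge. -/
  color : graph.Dart → EdgeColor
  color_symm : ∀ d, color d.symm = color d
  /-- The marking of an oriented edge. -/
  mark : graph.Dart → Fin m × Fin m
  mark_ne : ∀ d, (mark d).1 ≠ (mark d).2
  mark_symm : ∀ d, mark d.symm = (mark d).swap

/-- All edges of the abstract marked graph are black. -/
def MGraph.IsBlack {m : ℕ} {V : Type*} (G : MGraph m V) : Prop :=
  ∀ d, G.color d = EdgeColor.black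

/-- The assignment `x` of points to the vertices satisfies the equations encoded by `G`: each edge
of `G` goes to a pair of points that satisfies the equations of an edge of `Γ_S` with the same
colour and the same marking. -/
def MGraph.IsSolution {R : Type*} [CommRing R] {n m : ℕ} {V : Type*} (G : MGraph m V)
    (v : Fin m → Fin n → R) (x : V → Fin n → R) : Prop :=
  ∀ d : G.graph.Dart,
    (G.color d = EdgeColor.black →
      IsBlackEdge v (G.mark d).1 (G.mark d).2 (x d.fst) (x d.snd)) ∧
    (G.color d = EdgeColor.red →
      IsRedEdge v (G.mark d).1 (G.mark d).2 (x d.fst) (x d.snd))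

/-- `x` is a geometric realization of `G` on the component `C`: a graph isomorphism of `G` with the
connected component `C` of `Γ_S` that is compatible with the colours and the markings. -/
def MGraph.IsRealization {R : Type*} [CommRing R] {n m : ℕ} {V : Type*} (G : MGraph m V)
    (v : Fin m → Fin n → R) (C : (geomGraph v).ConnectedComponent) (x : V → Fin n → R) : Prop :=
  Function.Injective x ∧ Set.range x = C.supp ∧
    (∀ a b, G.graph.Adj a b ↔ (geomGraph v).Adj (x a) (x b)) ∧ G.IsSolution v x

/-! Fix a point x of a component. Walking along edges, every other point becomes a formal point Y:
an integral combination of x and the v_j, with coefficient ±1 at x and total mass 1, that satisfies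
the vertex equation |Y(V)|² = ∑ Y_t |V_t|², where V lists the values of the symbols. Grow a
connected affinely independent set of such points. If it stops before the component is exhausted,
one more neighbour gives a connected configuration of at most n + 2 points whose affine relation c
is unique up to scalars. Only finitely many such formal configurations exist, each in at most 2(n +
1) of the v_j, so it suffices to find for each one a nonzero polynomial that vanishes whenever the
configuration degenerates (`exists_resonance`).

If there were none, a diagonal sequence of counterexamples would give, in an ultrapower K of ℝ, a
degenerate configuration in which the coordinates of the v_j are algebraically independent over ℝ.
Then K has ℝ-derivations dual to these coordinates. Put H = ∑ σ_i c_i (Y_i Y_iᵀ - diag Y_i), where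
σ_i is the coefficient of x in Y_i. Differentiating the vertex equations shows that for each a the
vector (V_t a)_t lies in the kernel of H (`lagrangian_eq_zero`). Each possible rank of H is
excluded.

Rank 0: c annihilates the vertex equations formally. Combinatorics of the vectors ± e_a ± e_b
(`IsResonance.exists_sub_eq_single_two`) then gives two formal points with Y_i + Y_l = 2 e_j. Their
equations add up to |Y_i(V) - v_j|² = 0, so the component contains v_j.

Rank at least 2: by a dimension count, derivations that kill c move V along arbitrary vectors of ker
H. Hence all vertex forms vanish on ker H. Along an edge they combine to a product of two linear
forms, one of which must vanish on ker H, which is impossible (`finrank_range_lagrangian_le_one`).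

Rank 1: H is proportional to w wᵀ. Scaling w and taking standard parts gives real x ≠ 0 with x xᵀ a
real combination of the matrices Y_i Y_iᵀ - diag Y_i. So ∑_a (∑_t x_t V_t a)² = 0, and the symbols
satisfy a real linear relation (`exists_real_relation`), which one further differentiation refutes
(`false_of_real_relation`).

The rest is elementary. Points on red edges are bounded. The solutions of a black graph are its
translates by the lattice orthogonal to the differences of its vertices. A translate fails to be a
whole component only if a new edge appears, which forces it into finitely many smaller cosets. -/

/-! ### Vectors ± e_a ± e_b. -/

/-- A vector with exactly two nonzero coordinates `a`, `b`, both of them `±1`. -/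
def IsRootOn {J : Type*} (w : J → ℤ) (a b : J) : Prop :=
  a ≠ b ∧ (w a = 1 ∨ w a = -1) ∧ (w b = 1 ∨ w b = -1) ∧ ∀ j, j ≠ a → j ≠ b → w j = 0

/-- A vector of the form `± e_a ± e_b` with `a ≠ b`. -/
def IsRoot {J : Type*} (w : J → ℤ) : Prop := ∃ a b, IsRootOn w a b

theorem IsRootOn.neg {J : Type*} {w : J → ℤ} {a b : J} (h : IsRootOn w a b) :
    IsRootOn (-w) a b := by
  obtain ⟨h1, h2, h3, h4⟩ := h
  refine ⟨h1, ?_, ?_, fun j ha hb => by simp [h4 j ha hb]⟩ <;> simp only [Pi.neg_apply] <;> omega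

theorem IsRoot.neg {J : Type*} {w : J → ℤ} (h : IsRoot w) : IsRoot (-w) :=
  let ⟨a, b, h⟩ := h; ⟨a, b, h.neg⟩

theorem not_isRoot_zero {J : Type*} : ¬ IsRoot (0 : J → ℤ) := by
  rintro ⟨a, b, -, h, -⟩
  simp at h

theorem IsRoot.apply_mem {J : Type*} {w : J → ℤ} (h : IsRoot w) (j : J) :
    w j = 0 ∨ w j = 1 ∨ w j = -1 := by
  obtain ⟨a, b, -, ha, hb, h0⟩ := h
  by_cases h1 : j = a
  · subst h1; exact Or.inr ha
  by_cases h2 : j = b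
  · subst h2; exact Or.inr hb
  exact Or.inl (h0 j h1 h2)

theorem IsRoot.on_of_ne {J : Type*} {w : J → ℤ} (h : IsRoot w) {a b : J} (hab : a ≠ b)
    (ha : w a ≠ 0) (hb : w b ≠ 0) : IsRootOn w a b := by
  obtain ⟨c, d, hcd, hc, hd, h0⟩ := h
  have h1 : a = c ∨ a = d := by
    by_contra! hh
    exact ha (h0 a hh.1 hh.2)
  have h2 : b = c ∨ b = d := by
    by_contra! hh
    exact hb (h0 b hh.1 hh.2)
  rcases h1 with rfl | rfl <;> rcases h2 with rfl | rfl
  · exact absurd rfl hab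
  · exact ⟨hcd, hc, hd, h0⟩
  · exact ⟨hcd.symm, hd, hc, fun j h1 h2 => h0 j h2 h1⟩
  · exact absurd rfl hab

theorem IsRoot.exists_other {J : Type*} {w : J → ℤ} (h : IsRoot w) {a : J} (ha : w a ≠ 0) :
    ∃ b, IsRootOn w a b := by
  obtain ⟨c, d, hcd, hc, hd, h0⟩ := h
  by_cases h1 : a = c
  · exact ⟨d, by subst h1; exact ⟨hcd, hc, hd, h0⟩⟩
  · have h2 : a = d := by
      by_contra hh
      exact ha (h0 a h1 hh)
    exact ⟨c, by subst h2; exact ⟨hcd.symm, hd, hc, fun j h1 h2 => h0 j h2 h1⟩⟩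

theorem IsRoot.sum_support {J : Type*} [Fintype J] [DecidableEq J] {w : J → ℤ} (h : IsRoot w) :
    ∑ j, (if w j = 0 then 0 else 1) = (2 : ℕ) := by
  obtain ⟨a, b, hab, ha, hb, h0⟩ := h
  have hs : (Finset.univ.filter fun j => w j ≠ 0) = {a, b} := by
    ext j
    simp only [Finset.mem_filter, Finset.mem_univ, true_and, Finset.mem_insert,
      Finset.mem_singleton]
    constructor
    · intro hj
      by_contra! hh
      exact hj (h0 j hh.1 hh.2)
    · rintro (rfl | rfl) <;> omega
  have : ∑ j, (if w j = 0 then 0 else 1) = (Finset.univ.filter fun j => w j ≠ 0).card := by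
    rw [Finset.card_filter]
    exact Finset.sum_congr rfl fun j _ => by by_cases hj : w j = 0 <;> simp [hj]
  rw [this, hs, Finset.card_pair hab]

/-- Integer vectors of `ℓ¹`-norm `2`. -/
theorem isRoot_or_eq_single_of_sum_natAbs {J : Type*} [Fintype J] [DecidableEq J] {w : J → ℤ}
    (h : ∑ j, (w j).natAbs = 2) :
    IsRoot w ∨ ∃ j, w = Pi.single j 2 ∨ w = Pi.single j (-2) := by
  obtain ⟨a, ha⟩ : ∃ a, w a ≠ 0 := by
    by_contra! hh
    simp [hh] at h
  have hsplit := Finset.add_sum_erase Finset.univ (fun j => (w j).natAbs) (Finset.mem_univ a)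
  rw [h] at hsplit
  by_cases h2 : (w a).natAbs = 2
  · right
    have hz : ∑ j ∈ Finset.univ.erase a, (w j).natAbs = 0 := by omega
    have hz' : ∀ j, j ≠ a → w j = 0 := fun j hj =>
      Int.natAbs_eq_zero.1 (Finset.sum_eq_zero_iff.1 hz j (by simp [hj]))
    refine ⟨a, ?_⟩
    rcases (by omega : w a = 2 ∨ w a = -2) with h3 | h3
    · left
      ext j
      by_cases hj : j = a
      · subst hj; simp [h3]
      · simp [hj, hz' j hj]
    · right
      ext j
      by_cases hj : j = a
      · subst hj; simp [h3]
      · simp [hj, hz' j hj]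
  · left
    obtain ⟨b, hb, hb0⟩ : ∃ b ∈ Finset.univ.erase a, (w b).natAbs ≠ 0 := by
      by_contra! hh
      have := Finset.sum_eq_zero hh
      omega
    have hba : b ≠ a := Finset.ne_of_mem_erase hb
    have hsplit2 := Finset.add_sum_erase _ (fun j => (w j).natAbs) hb
    have hz : ∑ j ∈ (Finset.univ.erase a).erase b, (w j).natAbs = 0 := by omega
    refine ⟨a, b, hba.symm, by omega, by omega, fun j hja hjb => ?_⟩
    exact Int.natAbs_eq_zero.1 (Finset.sum_eq_zero_iff.1 hz j (by simp [hja, hjb]))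

/-- The graph of pairs of vectors that differ by a vector `± e_a ± e_b`. -/
def rootGraph {I J : Type*} (z : I → J → ℤ) : SimpleGraph I where
  Adj i j := IsRoot (z i - z j)
  symm := ⟨fun i j h => by simpa using h.neg⟩
  loopless := ⟨fun i h => by
    rw [sub_self] at h
    exact not_isRoot_zero h⟩

theorem SimpleGraph.Connected.exists_adj_mem_notMem {V : Type*} {G : SimpleGraph V}
    (hG : G.Connected) {S : Set V} {x t : V} (hx : x ∈ S) (ht : t ∉ S) :
    ∃ a ∈ S, ∃ b ∉ S, G.Adj a b := by
  obtain ⟨w⟩ := hG.preconnected x t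
  obtain ⟨d, -, h1, h2⟩ := w.exists_boundary_dart S hx ht
  exact ⟨_, h1, _, h2, d.adj⟩

/-! ### Combinatorics of relations that annihilate the quadratic equations. -/

/-- A linear relation `s` between integer vectors `z i` of total mass `σ i - 1`, `σ i = ±1`, which
also annihilates the quadratic equations of the corresponding vertices and which is the only
relation up to scalars. -/
structure IsResonance {K I J : Type*} [Field K] [Fintype I] [Fintype J] [DecidableEq J]
    (z : I → J → ℤ) (σ : I → ℤ) (s : I → K) : Prop where
  sign : ∀ i, σ i = 1 ∨ σ i = -1
  mass : ∀ i, ∑ j, z i j = σ i - 1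
  ne_zero : s ≠ 0
  sum : ∑ i, s i = 0
  sum_sign : ∑ i, s i * σ i = 0
  sum_mul : ∀ j, ∑ i, s i * z i j = 0
  diag : ∀ j l, ∑ i, s i * z i j * z i l = if j = l then ∑ i, s i * σ i * z i j else 0
  unique : ∀ c : I → K, ∑ i, c i = 0 → (∀ j, ∑ i, c i * z i j = 0) → ∃ θ, ∀ i, c i = θ * s i
  inj : Function.Injective z

namespace IsResonance

variable {K I J : Type*} [Field K] [Fintype I] [Fintype J]
  [DecidableEq J] {z : I → J → ℤ} {σ : I → ℤ} {s : I → K}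

/-- Write A_j for `∑ i, s i * σ i * z i j`. If A_j = 0 then by `diag` the family s_i z_i j is again
a relation, hence a multiple of s. -/
theorem apply_eq_of_coeff_eq_zero [CharZero K] (H : IsResonance z σ s) {j : J}
    (hj : ∑ i, s i * σ i * z i j = 0)
    {i l : I} (hi : s i ≠ 0) (hl : s l ≠ 0) : z i j = z l j := by
  obtain ⟨θ, hθ⟩ := H.unique (fun i => s i * z i j) (H.sum_mul j) (fun l => by
    rw [H.diag j l]
    split_ifs <;> simp [hj])
  have h1 : (z i j : K) = θ := mul_left_cancel₀ hi (by rw [hθ i, mul_comm])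
  have h2 : (z l j : K) = θ := mul_left_cancel₀ hl (by rw [hθ l, mul_comm])
  exact_mod_cast h1.trans h2.symm

/-- The bilinear form inverse to `∑ s i • z i ⊗ z i`. -/
def form (z : I → J → ℤ) (σ : I → ℤ) (s : I → K) (u w : J → K) : K :=
  ∑ j, u j * w j / ∑ i, s i * σ i * z i j

omit [DecidableEq J] in
theorem form_sub_right (u w w' : J → K) :
    form z σ s u (w - w') = form z σ s u w - form z σ s u w' := by
  simp [form, mul_sub, sub_div, Finset.sum_sub_distrib]

omit [DecidableEq J] in
theorem form_neg_left (u w : J → K) : form z σ s (-u) w = -form z σ s u w := by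
  simp [form, neg_div]

theorem sum_form (H : IsResonance z σ s) (u : J → K) :
    ∑ i, s i * form z σ s u (fun j => z i j) = 0 := by
  simp only [form, Finset.mul_sum]
  rw [Finset.sum_comm]
  refine Finset.sum_eq_zero fun j _ => ?_
  have : ∀ i, s i * (u j * z i j / ∑ i, s i * σ i * z i j)
      = (s i * z i j) * (u j / ∑ i, s i * σ i * z i j) := fun i => by ring
  simp only [this, ← Finset.sum_mul, H.sum_mul j, zero_mul]

/-- By `diag` the matrix ∑ s_i z_i z_iᵀ is diagonal with entries A_j, and `form` divides by them.
The hypothesis covers the coordinates where A_l = 0, on which division returns 0. -/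
theorem sum_form_mul (H : IsResonance z σ s) (u : J → K) (l : J)
    (hu : ∑ i, s i * σ i * z i l = 0 → u l = 0) :
    ∑ i, s i * form z σ s u (fun j => z i j) * z i l = u l := by
  simp only [form, Finset.mul_sum, Finset.sum_mul]
  rw [Finset.sum_comm]
  have : ∀ j i, s i * (u j * z i j / ∑ i, s i * σ i * z i j) * z i l
      = (s i * z i j * z i l) * (u j / ∑ i, s i * σ i * z i j) := fun j i => by ring
  simp only [this, ← Finset.sum_mul, H.diag]
  simp only [ite_mul, zero_mul, Finset.sum_ite_eq', Finset.mem_univ, if_true]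
  by_cases h : ∑ i, s i * σ i * z i l = 0
  · rw [h, hu h]; simp
  · field_simp

/-- Both s_i form(z_p - z_q, z_i) and δ_p - δ_q are coefficients of total mass 0 that represent z_p
- z_q, so they differ by a multiple of s. The next two lemmas compare values of this identity: away
from p and q the form equals the constant θ. -/
theorem form_sub_eq [DecidableEq I] [CharZero K] (H : IsResonance z σ s) {p q : I}
    (hp : s p ≠ 0) (hq : s q ≠ 0) :
    ∃ θ, ∀ i, s i * form z σ s (fun j => z p j - z q j) (fun j => z i j)
      = (if i = p then 1 else 0) - (if i = q then 1 else 0) + θ * s i := by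
  obtain ⟨θ, hθ⟩ := H.unique (fun i => s i * form z σ s (fun j => z p j - z q j) (fun j => z i j)
      - (if i = p then 1 else 0) + (if i = q then 1 else 0))
    (by simp [Finset.sum_add_distrib, Finset.sum_sub_distrib, H.sum_form])
    (fun l => by
      simp only [add_mul, sub_mul, Finset.sum_add_distrib, Finset.sum_sub_distrib]
      rw [H.sum_form_mul _ l fun h => by simp [H.apply_eq_of_coeff_eq_zero h hp hq]]
      simp)
  exact ⟨θ, fun i => by rw [← hθ i]; ring⟩

theorem form_eq_zero [DecidableEq I] [CharZero K] (H : IsResonance z σ s) {p q i l : I}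
    (hp : s p ≠ 0)
    (hq : s q ≠ 0) (hi : s i ≠ 0) (hl : s l ≠ 0) (hip : i ≠ p) (hiq : i ≠ q) (hlp : l ≠ p)
    (hlq : l ≠ q) :
    form z σ s (fun j => z p j - z q j) (fun j => z i j - z l j) = 0 := by
  obtain ⟨θ, hθ⟩ := H.form_sub_eq hp hq
  have h1 := hθ i
  have h2 := hθ l
  simp only [hip, hiq, hlp, hlq, if_false, sub_zero, zero_add] at h1 h2
  have h1' := mul_left_cancel₀ hi (h1.trans (mul_comm _ _))
  have h2' := mul_left_cancel₀ hl (h2.trans (mul_comm _ _))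
  have := form_sub_right (z := z) (σ := σ) (s := s) (fun j => (z p j - z q j : K))
    (fun j => z i j) (fun j => z l j)
  rw [h1', h2', sub_self] at this
  exact this

theorem form_eq_inv [DecidableEq I] [CharZero K] (H : IsResonance z σ s) {p q i : I} (hp : s p ≠ 0)
    (hq : s q ≠ 0) (hi : s i ≠ 0) (hip : i ≠ p) (hiq : i ≠ q) (hpq : p ≠ q) :
    form z σ s (fun j => z p j - z q j) (fun j => z i j - z q j) = (s q)⁻¹ := by
  obtain ⟨θ, hθ⟩ := H.form_sub_eq hp hq
  have h1 := hθ i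
  have h2 := hθ q
  simp only [hip, hiq, hpq.symm, if_false, if_true, sub_zero, zero_add] at h1 h2
  have h1' := mul_left_cancel₀ hi (h1.trans (mul_comm _ _))
  have := form_sub_right (z := z) (σ := σ) (s := s) (fun j => (z p j - z q j : K))
    (fun j => z i j) (fun j => z q j)
  have h3 : form z σ s (fun j => (z p j - z q j : K)) (fun j => z q j) = θ - (s q)⁻¹ := by
    field_simp
    linear_combination h2
  rw [h1', h3] at this
  rw [show (fun j => (z i j - z q j : K)) = (fun j => (z i j : K)) - fun j => (z q j : K) from rfl,
    this]
  ring

end IsResonance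

namespace IsResonance

variable {K I J : Type*} [Field K] [CharZero K] [Fintype I] [DecidableEq I] [Fintype J]
  [DecidableEq J] {z : I → J → ℤ} {σ : I → ℤ} {s : I → K}

omit [DecidableEq I] in
theorem sum_filter_sign [DecidableEq K] (H : IsResonance z σ s) (ε : ℤ) (hε : ε = 1 ∨ ε = -1) :
    ∑ i with s i ≠ 0 ∧ σ i = ε, s i = 0 := by
  have h1 : ∑ i with s i ≠ 0 ∧ σ i = ε, s i = ∑ i, if σ i = ε then s i else 0 := by
    rw [Finset.sum_filter]
    refine Finset.sum_congr rfl fun i _ => ?_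
    by_cases h : s i = 0 <;> simp [h]
  have h2 : ∀ i, (if σ i = ε then s i else 0) = (s i + ε * (s i * σ i)) / 2 := by
    intro i
    rcases H.sign i with h | h <;> rcases hε with rfl | rfl <;> simp [h]
  rw [h1]
  simp only [h2, ← Finset.sum_div, Finset.sum_add_distrib, ← Finset.mul_sum, H.sum, H.sum_sign]
  simp

omit [DecidableEq I] in
-- If only one sign occurred on the support, A_j would be ±∑ s_i z_i j = 0 for all j. All vertices
-- of the support would then coincide, leaving one point with s = 0.
theorem exists_sign (H : IsResonance z σ s) (ε : ℤ) (hε : ε = 1 ∨ ε = -1) :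
    ∃ i, s i ≠ 0 ∧ σ i = ε := by
  by_contra! hh
  have hσ : ∀ i, s i * σ i = -ε * s i := by
    intro i
    by_cases h : s i = 0
    · simp [h]
    · have := hh i h
      rcases H.sign i with h1 | h1 <;> rcases hε with rfl | rfl <;> simp_all
  have hA : ∀ j, ∑ i, s i * σ i * z i j = 0 := by
    intro j
    simp only [hσ, mul_assoc, ← Finset.mul_sum, H.sum_mul j, mul_zero]
  obtain ⟨p, hp⟩ : ∃ p, s p ≠ 0 := Function.ne_iff.1 H.ne_zero
  have : ∑ i, s i = s p := by
    refine Finset.sum_eq_single p (fun i _ hi => ?_) (by simp)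
    by_contra h
    exact hi (H.inj (funext fun j => H.apply_eq_of_coeff_eq_zero (hA j) h hp))
  exact hp (this ▸ H.sum)

omit [DecidableEq I] in
-- The coefficients of each sign add up to 0 separately, so a class cannot consist of one vertex.
theorem two_le_card_filter_sign [DecidableEq K] (H : IsResonance z σ s) (ε : ℤ)
    (hε : ε = 1 ∨ ε = -1) : 2 ≤ (Finset.univ.filter fun i => s i ≠ 0 ∧ σ i = ε).card := by
  obtain ⟨p, hp, hpε⟩ := H.exists_sign ε hε
  by_contra! hlt
  have hmem : p ∈ Finset.univ.filter fun i => s i ≠ 0 ∧ σ i = ε := by simp [hp, hpε]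
  have h1 : (Finset.univ.filter fun i => s i ≠ 0 ∧ σ i = ε).card = 1 := by
    have := Finset.card_pos.2 ⟨p, hmem⟩
    omega
  obtain ⟨r, hr⟩ := Finset.card_eq_one.1 h1
  have hsum := H.sum_filter_sign ε hε
  rw [hr, Finset.sum_singleton] at hsum
  rw [hr, Finset.mem_singleton] at hmem
  exact hp (hmem ▸ hsum)

theorem four_le_card [DecidableEq K] (H : IsResonance z σ s) :
    4 ≤ (Finset.univ.filter fun i => s i ≠ 0).card := by
  have h1 := H.two_le_card_filter_sign 1 (Or.inl rfl)
  have h2 := H.two_le_card_filter_sign (-1) (Or.inr rfl)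
  have hdisj : Disjoint (Finset.univ.filter fun i => s i ≠ 0 ∧ σ i = 1)
      (Finset.univ.filter fun i => s i ≠ 0 ∧ σ i = -1) := by
    rw [Finset.disjoint_left]
    intro i hi hi'
    simp only [Finset.mem_filter, Finset.mem_univ, true_and] at hi hi'
    omega
  have hle := Finset.card_le_card (Finset.union_subset
    (Finset.monotone_filter_right Finset.univ (fun i _ hi => hi.1) :
      (Finset.univ.filter fun i => s i ≠ 0 ∧ σ i = 1) ⊆ Finset.univ.filter fun i => s i ≠ 0)
    (Finset.monotone_filter_right Finset.univ (fun i _ hi => hi.1) :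
      (Finset.univ.filter fun i => s i ≠ 0 ∧ σ i = -1) ⊆ Finset.univ.filter fun i => s i ≠ 0))
  rw [Finset.card_union_of_disjoint hdisj] at hle
  omega

theorem exists_ne_three (H : IsResonance z σ s) (p q r : I) :
    ∃ i, s i ≠ 0 ∧ i ≠ p ∧ i ≠ q ∧ i ≠ r := by
  classical
  have h4 := H.four_le_card
  have h3 : ({p, q, r} : Finset I).card ≤ 3 := Finset.card_le_three
  obtain ⟨i, hi, hi'⟩ := Finset.exists_mem_notMem_of_card_lt_card (lt_of_le_of_lt h3 h4)
  simp only [Finset.mem_filter, Finset.mem_univ, true_and, Finset.mem_insert,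
    Finset.mem_singleton, not_or] at hi hi'
  exact ⟨i, hi, hi'.1, hi'.2.1, hi'.2.2⟩

/-- The functions 1, z_a, z_b, z_c on the support are linearly independent by `diag`, and s
annihilates all of them. On four points they would span everything and force s = 0. -/
theorem five_le_card [DecidableEq K] (H : IsResonance z σ s) {a b c : J} (hab : a ≠ b)
    (hac : a ≠ c) (hbc : b ≠ c) (ha : ∑ i, s i * σ i * z i a ≠ 0)
    (hb : ∑ i, s i * σ i * z i b ≠ 0) (hc : ∑ i, s i * σ i * z i c ≠ 0) :
    5 ≤ (Finset.univ.filter fun i => s i ≠ 0).card := by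
  by_contra! hlt
  have h4 := H.four_le_card
  have hcard : (Finset.univ.filter fun i => s i ≠ 0).card = 4 := by omega
  let C := {i // s i ≠ 0}
  have hsum : ∀ f : I → K, ∑ i : C, s i * f i = ∑ i, s i * f i := by
    intro f
    rw [← Finset.sum_subtype (p := fun i => s i ≠ 0) (Finset.univ.filter fun i => s i ≠ 0)
      (fun i => by simp) (fun i => s i * f i), Finset.sum_filter]
    refine Finset.sum_congr rfl fun i _ => ?_
    by_cases h : s i = 0 <;> simp [h]
  let w : Fin 4 → C → K := ![fun _ => 1, fun i => z i a, fun i => z i b, fun i => z i c]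
  have hpair : ∀ x y : J, ∑ i : C, s i * ((z i x : K) * z i y)
      = if x = y then ∑ i, s i * σ i * z i x else 0 := by
    intro x y
    rw [hsum fun i => (z i x : K) * z i y, ← H.diag x y]
    simp [mul_assoc]
  have hone : ∀ x : J, ∑ i : C, s i * (z i x : K) = 0 := fun x => by
    rw [hsum fun i => (z i x : K), H.sum_mul]
  have hind : LinearIndependent K w := by
    rw [Fintype.linearIndependent_iff]
    intro g hg
    have hg' : ∀ i : C, g 0 + g 1 * z i a + g 2 * z i b + g 3 * z i c = 0 := by
      intro i
      simpa [w, Fin.sum_univ_four] using congrFun hg i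
    have key : ∀ x : J, g 1 * (∑ i : C, s i * ((z i a : K) * z i x))
        + g 2 * (∑ i : C, s i * ((z i b : K) * z i x))
        + g 3 * (∑ i : C, s i * ((z i c : K) * z i x)) = 0 := by
      intro x
      have h0 : ∑ i : C, s i * (z i x : K)
          * (g 0 + g 1 * z i a + g 2 * z i b + g 3 * z i c) = 0 :=
        Finset.sum_eq_zero fun i _ => by rw [hg' i, mul_zero]
      have h1 : ∑ i : C, s i * (z i x : K) * (g 0 + g 1 * z i a + g 2 * z i b + g 3 * z i c)
          = g 0 * (∑ i : C, s i * (z i x : K)) + g 1 * (∑ i : C, s i * ((z i a : K) * z i x))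
          + g 2 * (∑ i : C, s i * ((z i b : K) * z i x))
          + g 3 * (∑ i : C, s i * ((z i c : K) * z i x)) := by
        simp only [Finset.mul_sum, ← Finset.sum_add_distrib]
        exact Finset.sum_congr rfl fun i _ => by ring
      rw [h0, hone] at h1
      linear_combination -h1
    have k1 : g 1 = 0 := by simpa [hpair, hab.symm, hac.symm, ha] using key a
    have k2 : g 2 = 0 := by simpa [hpair, hab, hbc.symm, hb] using key b
    have k3 : g 3 = 0 := by simpa [hpair, hac, hbc, hc] using key c
    have k0 : g 0 = 0 := by
      obtain ⟨p, hp⟩ : ∃ p, s p ≠ 0 := Function.ne_iff.1 H.ne_zero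
      simpa [k1, k2, k3] using hg' ⟨p, hp⟩
    intro i
    fin_cases i <;> assumption
  have hspan := hind.span_eq_top_of_card_eq_finrank (by
    rw [Module.finrank_fintype_fun_eq_card, Fintype.card_fin, ← hcard, Fintype.card_subtype])
  let φ : (C → K) →ₗ[K] K := ∑ i : C, (s i) • LinearMap.proj i
  have hφ : ∀ f, φ f = ∑ i : C, s i * f i := fun f => by simp [φ]
  have hφ0 : φ = 0 := by
    refine LinearMap.ext_on_range hspan fun i => ?_
    rw [hφ]
    fin_cases i
    · simpa [w] using (hsum fun _ => 1).trans (by simpa using H.sum)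
    · simpa [w] using hone a
    · simpa [w] using hone b
    · simpa [w] using hone c
  obtain ⟨p, hp⟩ : ∃ p, s p ≠ 0 := Function.ne_iff.1 H.ne_zero
  have := hφ (Pi.single ⟨p, hp⟩ 1)
  rw [hφ0] at this
  simp [Pi.single_apply] at this
  exact hp this.symm

theorem exists_ne_four (H : IsResonance z σ s) {a b c : J} (hab : a ≠ b)
    (hac : a ≠ c) (hbc : b ≠ c) (ha : ∑ i, s i * σ i * z i a ≠ 0)
    (hb : ∑ i, s i * σ i * z i b ≠ 0) (hc : ∑ i, s i * σ i * z i c ≠ 0) (p q r t : I) :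
    ∃ i, s i ≠ 0 ∧ i ≠ p ∧ i ≠ q ∧ i ≠ r ∧ i ≠ t := by
  classical
  have h5 := H.five_le_card hab hac hbc ha hb hc
  have h4 : ({p, q, r, t} : Finset I).card ≤ 4 := Finset.card_le_four
  obtain ⟨i, hi, hi'⟩ := Finset.exists_mem_notMem_of_card_lt_card (lt_of_le_of_lt h4 h5)
  simp only [Finset.mem_filter, Finset.mem_univ, true_and, Finset.mem_insert,
    Finset.mem_singleton, not_or] at hi hi'
  exact ⟨i, hi, hi'.1, hi'.2.1, hi'.2.2.1, hi'.2.2.2⟩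

end IsResonance

namespace IsResonance

variable {K I J : Type*} [Field K] [CharZero K] [Fintype I] [DecidableEq I] [Fintype J]
  [DecidableEq J] {z : I → J → ℤ} {σ : I → ℤ} {s : I → K}

omit [CharZero K] in
/-- Modulo the coordinates of the resonance, the vertices outside of its support are linearly
independent. -/
theorem linearIndependent_of_coeff_eq_zero (H : IsResonance z σ s) {f : ℕ}
    {u : Fin f → I} (hu : Function.Injective u) (hs : ∀ t, s (u t) = 0) {c : I} (hc : s c ≠ 0)
    {N : Finset J} (hN : ∀ j, ∑ i, s i * σ i * z i j = 0 → j ∉ N → ∀ t, z (u t) j = z c j) :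
    LinearIndependent K fun (t : Fin f) (j : N) => (z (u t) j - z c j : K) := by
  rw [Fintype.linearIndependent_iff]
  intro g hg
  let E : J → K := fun j => ∑ t, g t * (z (u t) j - z c j)
  have hE : ∀ j, ∑ i, s i * σ i * z i j = 0 → E j = 0 := by
    intro j hj
    by_cases hjN : j ∈ N
    · simpa using congrFun hg ⟨j, hjN⟩
    · exact Finset.sum_eq_zero fun t _ => by simp [hN j hj hjN t]
  -- A combination E that vanishes where A_j = 0 is also a combination of the vertices of the
  -- support, through `sum_form_mul`. The difference of the two representations is a multiple of s,
  -- which vanishes at u t.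
  obtain ⟨θ, hθ⟩ := H.unique
    (fun i => ∑ t, g t * ((if i = u t then 1 else 0) - if i = c then 1 else 0)
      - s i * form z σ s E fun j => z i j)
    (by
      rw [Finset.sum_sub_distrib, H.sum_form, sub_zero, Finset.sum_comm]
      refine Finset.sum_eq_zero fun t _ => ?_
      rw [← Finset.mul_sum, Finset.sum_sub_distrib]
      simp)
    (fun l => by
      simp only [sub_mul (∑ t, _)]
      rw [Finset.sum_sub_distrib, H.sum_form_mul E l (hE l)]
      simp only [Finset.sum_mul]
      rw [Finset.sum_comm, sub_eq_zero]
      refine Finset.sum_congr rfl fun t _ => ?_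
      simp only [mul_assoc, ← Finset.mul_sum, sub_mul, Finset.sum_sub_distrib]
      simp)
  intro t
  have h := hθ (u t)
  have hne : u t ≠ c := fun h => hc (h ▸ hs t)
  simp only [hs t, hne, if_false, sub_zero, zero_mul, mul_zero] at h
  simpa [hu.eq_iff] using h

/-- A path leaves the support and returns after f outer vertices. Its steps have total ℓ¹-norm 2(f +
1). A touched coordinate with A_j = 0 has total change 0, so it is touched at least twice; by linear
independence of the outer vertices there are at least f such coordinates. This leaves norm at most
2, and the norm is even and nonzero. -/
theorem isRoot_or_of_path (H : IsResonance z σ s) {f : ℕ} {w : ℕ → I}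
    (hinj : Set.InjOn w (Set.Iic (f + 1))) (h0 : s (w 0) ≠ 0) (h1 : s (w (f + 1)) ≠ 0)
    (hw : ∀ t, 1 ≤ t → t ≤ f → s (w t) = 0)
    (hadj : ∀ t, t ≤ f → IsRoot (z (w (t + 1)) - z (w t))) :
    IsRoot (z (w (f + 1)) - z (w 0)) ∨
      ∃ j, z (w (f + 1)) - z (w 0) = Pi.single j 2 ∨
        z (w (f + 1)) - z (w 0) = Pi.single j (-2) := by
  classical
  apply isRoot_or_eq_single_of_sum_natAbs
  set D := z (w (f + 1)) - z (w 0) with hD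
  let r : ℕ → J → ℤ := fun t => z (w (t + 1)) - z (w t)
  let d : J → ℕ := fun j => ∑ t ∈ Finset.range (f + 1), if r t j = 0 then 0 else 1
  have hDr : ∀ j, D j = ∑ t ∈ Finset.range (f + 1), r t j := by
    intro j
    have := Finset.sum_range_sub (fun t => z (w t) j) (f + 1)
    simpa [r, hD] using this.symm
  have hd : ∑ j, d j = 2 * (f + 1) := by
    rw [Finset.sum_comm, Finset.sum_congr rfl fun t ht =>
      (hadj t (by simpa [Nat.lt_succ_iff] using ht)).sum_support]
    simp [mul_comm]
  have hDd : ∀ j, (D j).natAbs ≤ d j := by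
    intro j
    rw [hDr]
    refine (Int.natAbs_sum_le _ _).trans (Finset.sum_le_sum fun t ht => ?_)
    have := (hadj t (by simpa [Nat.lt_succ_iff] using ht)).apply_mem j
    change r t j = 0 ∨ r t j = 1 ∨ r t j = -1 at this
    rcases this with h | h | h <;> simp [h]
  have hD0 : ∀ j, ∑ i, s i * σ i * z i j = 0 → D j = 0 := fun j hj => by
    simp [hD, H.apply_eq_of_coeff_eq_zero hj h1 h0]
  let N : Finset J := Finset.univ.filter fun j => ∑ i, s i * σ i * z i j = 0 ∧ d j ≠ 0
  have hNd : ∀ j ∈ N, 2 ≤ d j := by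
    intro j hj
    obtain ⟨hj0, hjd⟩ : _ ∧ _ := by simpa [N] using hj
    by_contra! hlt
    have hd1 : d j = 1 := by omega
    obtain ⟨t, ht, htne⟩ : ∃ t ∈ Finset.range (f + 1), r t j ≠ 0 := by
      by_contra! hh
      exact hjd (Finset.sum_eq_zero fun t ht => by simp [hh t ht])
    have hsplit := Finset.add_sum_erase (Finset.range (f + 1))
      (fun t => if r t j = 0 then 0 else 1) ht
    simp only [htne, if_false] at hsplit
    have hz : ∑ t ∈ (Finset.range (f + 1)).erase t, (if r t j = 0 then 0 else 1) = 0 := by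
      have : d j = _ := hsplit.symm
      omega
    have hz' := Finset.sum_eq_zero_iff.1 hz
    have := hDr j
    rw [hD0 j hj0, ← Finset.add_sum_erase _ _ ht, Finset.sum_eq_zero (fun x hx => by
      by_contra hne
      simpa [hne] using hz' x hx), add_zero] at this
    exact htne this.symm
  have hconst : ∀ j, d j = 0 → ∀ t, t ≤ f + 1 → z (w t) j = z (w 0) j := by
    intro j hj t
    induction t with
    | zero => simp
    | succ t ih =>
      intro ht
      have h2 : (if r t j = 0 then 0 else 1) = 0 :=
        Finset.sum_eq_zero_iff.1 hj t (by simp; omega)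
      have h3 : r t j = 0 := by
        by_contra hne
        simp [hne] at h2
      rw [← ih (by omega)]
      simpa [r, sub_eq_zero] using h3
  have hcard : f ≤ N.card := by
    have hli := H.linearIndependent_of_coeff_eq_zero (f := f) (u := fun t => w (t + 1)) (N := N)
      (fun a b hab => by
        have := hinj (by simp) (by simp) hab
        exact Fin.ext (by omega))
      (fun t => hw _ (by omega) (by omega)) h0
      (fun j hj hjN t => hconst j (by
        by_contra hne
        exact hjN (by
            simp only [N, Finset.mem_filter, Finset.mem_univ, true_and]
            exact ⟨hj, hne⟩)) _ (by omega))
    have := hli.fintype_card_le_finrank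
    simpa using this
  have hle : ∑ j, (D j).natAbs ≤ 2 := by
    have h2 : ∑ j ∈ N, 2 ≤ ∑ j ∈ N, d j := Finset.sum_le_sum hNd
    have h3 := Finset.sum_add_sum_compl N d
    have h4 := Finset.sum_add_sum_compl N fun j => (D j).natAbs
    have h5 : ∑ j ∈ N, (D j).natAbs = 0 := Finset.sum_eq_zero fun j hj => by
      rw [hD0 j (by simpa [N] using (Finset.mem_filter.1 hj).2.1), Int.natAbs_zero]
    have h6 : ∑ j ∈ Nᶜ, (D j).natAbs ≤ ∑ j ∈ Nᶜ, d j := Finset.sum_le_sum fun j _ => hDd j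
    simp only [Finset.sum_const, smul_eq_mul] at h2
    omega
  have heven : 2 ∣ ∑ j, (D j).natAbs := by
    have h2 : (2 : ℤ) ∣ ∑ j, D j := by
      have : ∑ j, D j = σ (w (f + 1)) - σ (w 0) := by
        simp only [hD, Pi.sub_apply, Finset.sum_sub_distrib, H.mass]
        ring
      rw [this]
      rcases H.sign (w (f + 1)) with h | h <;> rcases H.sign (w 0) with h' | h' <;>
        rw [h, h'] <;> norm_num
    have h3 : (2 : ℤ) ∣ ∑ j, (((D j).natAbs : ℤ) - D j) :=
      Finset.dvd_sum fun j _ => by omega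
    rw [Finset.sum_sub_distrib] at h3
    have h4 := (Int.dvd_add h3 h2)
    rw [sub_add_cancel] at h4
    exact_mod_cast h4
  have hne : ∑ j, (D j).natAbs ≠ 0 := by
    intro h
    have hz : D = 0 := funext fun j => Int.natAbs_eq_zero.1 (Finset.sum_eq_zero_iff.1 h j (by simp))
    have := hinj (by simp) (by simp) (H.inj (sub_eq_zero.1 hz))
    omega
  omega

/-- Cut a path at its first return to the support: the excursion is replaced by a single root, since
`h2` excludes ±2 e_j. -/
theorem rootGraph_connected (H : IsResonance z σ s) {G : SimpleGraph I} (hG : G.Connected)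
    (hroot : ∀ i l, G.Adj i l → IsRoot (z i - z l))
    (h2 : ∀ i l j, z i - z l ≠ Pi.single j 2) :
    (rootGraph fun i : {i // s i ≠ 0} => z i).Connected := by
  have key : ∀ (L : ℕ) (c c' : {i // s i ≠ 0}) (p : G.Walk c c'), p.IsPath → p.length = L →
      (rootGraph fun i : {i // s i ≠ 0} => z i).Reachable c c' := by
    intro L
    induction L using Nat.strong_induction_on with
    | _ L ih =>
      intro c c' p hp hL
      by_cases hL0 : L = 0
      · have : (c : I) = c' := p.eq_of_length_eq_zero (by omega)
        rw [Subtype.ext this]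
      classical
      have hex : ∃ t, 1 ≤ t ∧ s (p.getVert t) ≠ 0 :=
        ⟨p.length, by omega, by rw [p.getVert_length]; exact c'.2⟩
      let t := Nat.find hex
      obtain ⟨ht1, hts⟩ : 1 ≤ t ∧ s (p.getVert t) ≠ 0 := Nat.find_spec hex
      have htL : t ≤ p.length := Nat.find_min' hex
        ⟨by omega, by rw [p.getVert_length]; exact c'.2⟩
      obtain ⟨f, hf⟩ : ∃ f, t = f + 1 := ⟨t - 1, by omega⟩
      have hr := H.isRoot_or_of_path (f := f) (w := p.getVert)
        (fun a ha b hb hab => hp.getVert_injOn (by simp at ha ⊢; omega)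
          (by simp at hb ⊢; omega) hab)
        (by rw [p.getVert_zero]; exact c.2) (by rw [← hf]; exact hts)
        (fun a h1 h2 => by
          by_contra h
          exact Nat.find_min hex (m := a) (by change a < t; omega) ⟨h1, h⟩)
        (fun a ha => hroot _ _ (p.adj_getVert_succ (by omega)).symm)
      rw [← hf, p.getVert_zero] at hr
      have hadj : (rootGraph fun i : {i // s i ≠ 0} => z i).Adj c ⟨p.getVert t, hts⟩ := by
        rcases hr with hr | ⟨j, hr | hr⟩
        · exact (show (rootGraph fun i : {i // s i ≠ 0} => z i).Adj ⟨p.getVert t, hts⟩ c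
            from hr).symm
        · exact absurd hr (h2 _ _ _)
        · refine absurd ?_ (h2 c (p.getVert t) j)
          rw [← neg_sub, hr, ← Pi.single_neg, neg_neg]
      refine hadj.reachable.trans (ih (p.drop t).length ?_ _ _ (p.drop t) (hp.drop t) rfl)
      rw [p.drop_length]
      omega
  obtain ⟨p, hp⟩ : ∃ p, s p ≠ 0 := Function.ne_iff.1 H.ne_zero
  have : Nonempty {i // s i ≠ 0} := ⟨⟨p, hp⟩⟩
  refine ⟨fun c c' => ?_⟩
  obtain ⟨q, hq⟩ := (hG.preconnected c c').exists_isPath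
  exact key _ c c' q hq rfl

end IsResonance

namespace IsResonance

variable {K I J : Type*} [Field K] [CharZero K] [Fintype I] [DecidableEq I] [Fintype J]
  [DecidableEq J] {z : I → J → ℤ} {σ : I → ℤ} {s : I → K}

omit [DecidableEq I] in
theorem coeff_ne_zero_of_apply_ne (H : IsResonance z σ s) {p q : I} (hp : s p ≠ 0) (hq : s q ≠ 0)
    {a : J} (ha : (z p - z q) a ≠ 0) : ∑ i, s i * σ i * z i a ≠ 0 := fun h => by
  simp [H.apply_eq_of_coeff_eq_zero h hp hq] at ha

omit [CharZero K] [DecidableEq I] [DecidableEq J] in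
theorem form_of_isRootOn {r r' : J → ℤ} {a b : J} (hr : IsRootOn r a b) :
    form z σ s (fun j => (r j : K)) (fun j => r' j)
      = r a * r' a / (∑ i, s i * σ i * z i a) + r b * r' b / ∑ i, s i * σ i * z i b := by
  obtain ⟨hab, -, -, h0⟩ := hr
  rw [form, Finset.sum_eq_add a b hab]
  · intro j _ hj
    simp [h0 j hj.1 hj.2]
  · simp
  · simp

/-- Orthogonality of disjoint differences reads r_a r'_a / A_a + r_b r'_b / A_b = 0, so the two
terms vanish together. -/
theorem apply_ne_zero_iff_of_disjoint (H : IsResonance z σ s) {p q u w : I} (hp : s p ≠ 0)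
    (hq : s q ≠ 0) (hu : s u ≠ 0) (hw : s w ≠ 0) (hup : u ≠ p) (huq : u ≠ q) (hwp : w ≠ p)
    (hwq : w ≠ q) {a b : J} (hr : IsRootOn (z p - z q) a b) :
    (z u - z w) a ≠ 0 ↔ (z u - z w) b ≠ 0 := by
  have h := H.form_eq_zero hp hq hu hw hup huq hwp hwq
  have h' := form_of_isRootOn (z := z) (σ := σ) (s := s) (r' := z u - z w) hr
  simp only [Pi.sub_apply, Int.cast_sub] at h'
  rw [h] at h'
  obtain ⟨hab, ha, hb, h0⟩ := hr
  have hA := H.coeff_ne_zero_of_apply_ne hp hq (a := a) (by omega)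
  have hB := H.coeff_ne_zero_of_apply_ne hp hq (a := b) (by omega)
  have hra : (z p a - z q a : K) ≠ 0 := by
    have : (z p a - z q a : ℤ) ≠ 0 := by simp only [Pi.sub_apply] at ha; omega
    exact_mod_cast this
  have hrb : (z p b - z q b : K) ≠ 0 := by
    have : (z p b - z q b : ℤ) ≠ 0 := by simp only [Pi.sub_apply] at hb; omega
    exact_mod_cast this
  rw [not_iff_not]
  constructor
  · intro h1
    have h2 : (z u a - z w a : K) = 0 := by exact_mod_cast h1
    rw [h2, mul_zero, zero_div, zero_add, eq_comm, div_eq_zero_iff, mul_eq_zero] at h'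
    have h3 : (z u b - z w b : K) = 0 := by tauto
    exact_mod_cast h3
  · intro h1
    have h2 : (z u b - z w b : K) = 0 := by exact_mod_cast h1
    rw [h2, mul_zero, zero_div, add_zero, eq_comm, div_eq_zero_iff, mul_eq_zero] at h'
    have h3 : (z u a - z w a : K) = 0 := by tauto
    exact_mod_cast h3

/-- The form of two differences at q is 1 / s_q ≠ 0, so they share an index. If they shared both,
they would be equal (then u = p), differ by some ±2 e_j, or be opposite; in the last case a further
vertex gives 1 / s_q = -1 / s_q. -/
theorem apply_ne_zero_iff_of_adj (H : IsResonance z σ s)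
    (h2 : ∀ i l j, z i - z l ≠ Pi.single j 2) {p q u : I} (hp : s p ≠ 0)
    (hq : s q ≠ 0) (hu : s u ≠ 0) (hup : u ≠ p) (huq : u ≠ q) (hpq : p ≠ q)
    {a b : J} (hr : IsRootOn (z p - z q) a b) (hr' : IsRoot (z u - z q)) :
    (z u - z q) a ≠ 0 ↔ (z u - z q) b = 0 := by
  have h := H.form_eq_inv hp hq hu hup huq hpq
  have h' := form_of_isRootOn (z := z) (σ := σ) (s := s) (r' := z u - z q) hr
  simp only [Pi.sub_apply, Int.cast_sub] at h'
  rw [h] at h'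
  constructor
  · intro ha'
    by_contra hb'
    obtain ⟨-, hra', hrb', hr0'⟩ := hr'.on_of_ne hr.1 ha' hb'
    obtain ⟨hab, hra, hrb, hr0⟩ := hr
    have hext : ∀ ε : ℤ, ∀ w : J → ℤ, w a = (z u - z q) a - ε * (z p - z q) a →
        w b = (z u - z q) b - ε * (z p - z q) b → (∀ j, j ≠ a → j ≠ b → w j = 0) →
        z u - z q - ε • (z p - z q) = w := by
      intro ε w h1 h2 h3
      ext j
      by_cases hja : j = a
      · subst hja; simp [h1]
      by_cases hjb : j = b
      · subst hjb; simp [h2]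
      · have e1 := hr0 j hja hjb
        have e2 := hr0' j hja hjb
        simp only [Pi.sub_apply, Pi.smul_apply, smul_eq_mul] at e1 e2 ⊢
        rw [e1, e2, h3 j hja hjb]; simp
    by_cases c1 : (z u - z q) a = (z p - z q) a
    · by_cases c2 : (z u - z q) b = (z p - z q) b
      · have := hext 1 0 (by simp [c1]) (by simp [c2]) (by simp)
        refine hup (H.inj ?_)
        simpa [sub_eq_zero] using this
      · rcases hrb with h3 | h3 <;> rcases hrb' with h4 | h4
        · omega
        · have := hext 1 (Pi.single b (-2)) (by simp [hab, c1]) (by simp [h3, h4])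
            (fun j hj hj' => by simp [hj'])
          refine h2 p u b ?_
          rw [← neg_neg (Pi.single b 2 : J → ℤ), ← Pi.single_neg, ← this]
          simp
        · have := hext 1 (Pi.single b 2) (by simp [hab, c1]) (by simp [h3, h4])
            (fun j hj hj' => by simp [hj'])
          refine h2 u p b ?_
          rw [← this]
          simp
        · omega
    · by_cases c2 : (z u - z q) b = (z p - z q) b
      · rcases hra with h3 | h3 <;> rcases hra' with h4 | h4
        · omega
        · have := hext 1 (Pi.single a (-2)) (by simp [h3, h4]) (by simp [hab.symm, c2])
            (fun j hj hj' => by simp [hj])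
          refine h2 p u a ?_
          rw [← neg_neg (Pi.single a 2 : J → ℤ), ← Pi.single_neg, ← this]
          simp
        · have := hext 1 (Pi.single a 2) (by simp [h3, h4]) (by simp [hab.symm, c2])
            (fun j hj hj' => by simp [hj])
          refine h2 u p a ?_
          rw [← this]
          simp
        · omega
      · obtain ⟨l, hl, hlp, hlq, hlu⟩ := H.exists_ne_three p q u
        have k1 := H.form_eq_inv hp hq hl hlp hlq hpq
        have k2 := H.form_eq_inv hu hq hl hlu hlq huq
        have hneg : z u - z q = -(z p - z q) := by
          have := hext (-1) 0 (by simp only [Pi.zero_apply]; omega)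
            (by simp only [Pi.zero_apply]; omega) (by simp)
          have e : z u - z q + (z p - z q) = 0 := by
            rwa [neg_smul, one_smul, sub_neg_eq_add] at this
          exact eq_neg_of_add_eq_zero_left e
        have hneg' : (fun j => (z u j - z q j : K)) = -fun j => (z p j - z q j : K) := by
          ext j
          have := congrFun hneg j
          simp only [Pi.sub_apply, Pi.neg_apply] at this ⊢
          exact_mod_cast this
        rw [hneg', form_neg_left, k1] at k2
        have h3 : (s q)⁻¹ = 0 := by
          have h4 : 2 * (s q)⁻¹ = 0 := by linear_combination -k2
          simpa using h4
        exact hq (inv_eq_zero.1 h3)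
  · intro hb ha
    have h3 : (z u b - z q b : K) = 0 := by exact_mod_cast hb
    have h4 : (z u a - z q a : K) = 0 := by exact_mod_cast ha
    rw [h3, h4] at h'
    simp [hq] at h'

/-- A resonance on a connected set of vertices contains two vertices whose sum, up to signs, is
twice a coordinate vector. -/
theorem exists_sub_eq_single_two (H : IsResonance z σ s) {G : SimpleGraph I} (hG : G.Connected)
    (hroot : ∀ i l, G.Adj i l → IsRoot (z i - z l)) : ∃ i l j, z i - z l = Pi.single j 2 := by
  classical
  by_contra! h2
  have hC := H.rootGraph_connected hG hroot h2
  set R := rootGraph fun i : {i // s i ≠ 0} => z i with hR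
  have hRadj : ∀ i l, R.Adj i l ↔ IsRoot (z i - z l) := fun i l => Iff.rfl
  have hD : ∀ (p q u w : {i // s i ≠ 0}), u ≠ p → u ≠ q → w ≠ p → w ≠ q → ∀ {a b : J},
      IsRootOn (z p - z q) a b → ((z u - z w) a ≠ 0 ↔ (z u - z w) b ≠ 0) :=
    fun p q u w h1 h2 h3 h4 a b hr => H.apply_ne_zero_iff_of_disjoint p.2 q.2 u.2 w.2
      (Subtype.coe_ne_coe.2 h1) (Subtype.coe_ne_coe.2 h2) (Subtype.coe_ne_coe.2 h3)
      (Subtype.coe_ne_coe.2 h4) hr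
  have hA : ∀ (p q u : {i // s i ≠ 0}), u ≠ p → R.Adj u q → ∀ {a b : J},
      IsRootOn (z p - z q) a b → ((z u - z q) a ≠ 0 ↔ (z u - z q) b = 0) :=
    fun p q u h1 h3 a b hr => H.apply_ne_zero_iff_of_adj h2 p.2 q.2 u.2
      (Subtype.coe_ne_coe.2 h1) (Subtype.coe_ne_coe.2 h3.ne)
      (fun h => by rw [h, sub_self] at hr; exact not_isRoot_zero ⟨a, b, hr⟩) hr h3
  have hcoeff : ∀ (p q : {i // s i ≠ 0}) (a : J), (z p - z q) a ≠ 0 →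
      ∑ i, s i * σ i * z i a ≠ 0 := fun p q a => H.coeff_ne_zero_of_apply_ne p.2 q.2
  have hnt : Nontrivial {i // s i ≠ 0} := by
    obtain ⟨p, hp⟩ : ∃ p, s p ≠ 0 := Function.ne_iff.1 H.ne_zero
    obtain ⟨i, hi, hip, -⟩ := H.exists_ne_three p p p
    exact ⟨⟨i, hi⟩, ⟨p, hp⟩, fun h => hip (congrArg Subtype.val h)⟩
  -- A vertex p whose removal leaves the support connected.
  obtain ⟨p, hp⟩ := hC.exists_connected_induce_compl_singleton_of_finite_nontrivial
  obtain ⟨q, hpq⟩ := hC.preconnected.exists_adj_of_nontrivial p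
  obtain ⟨a, b, hab⟩ := (hRadj p q).1 hpq
  have hsymm : ∀ {i l : I} {a b : J}, IsRootOn (z i - z l) a b → IsRootOn (z l - z i) a b :=
    fun h => by simpa using h.neg
  have hnz : ∀ {w : J → ℤ} {a b : J}, IsRootOn w a b → w a ≠ 0 ∧ w b ≠ 0 := fun h => by
    obtain ⟨-, h1, h2, -⟩ := h; constructor <;> omega
  have hnzsymm : ∀ {i l : I} {x : J}, (z i - z l) x ≠ 0 → (z l - z i) x ≠ 0 := fun h => by
    simp only [Pi.sub_apply] at h ⊢; omega
  -- an index of the root of the edge `p q` occurs on an edge that avoids `p`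
  have hex : ∀ x : J, (z p - z q) x ≠ 0 → ∃ u w, u ≠ p ∧ w ≠ p ∧ R.Adj u w ∧ (z u - z w) x ≠ 0 := by
    intro x hx
    by_contra! hh
    have hq' : q ∈ ({p}ᶜ : Set {i // s i ≠ 0}) := hpq.ne'
    have hconst : ∀ i : {i // s i ≠ 0}, i ≠ p → z i x = z q x := by
      intro i hi
      by_contra hne
      obtain ⟨c, hc, d, hd, hcd⟩ := hp.exists_adj_mem_notMem
        (S := {i : ({p}ᶜ : Set {i // s i ≠ 0}) | z i.1 x = z q x}) (x := ⟨q, hq'⟩) (t := ⟨i, hi⟩)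
        rfl hne
      have := hh c.1 d.1 c.2 d.2 hcd
      simp only [Pi.sub_apply, Set.mem_ofPred_eq] at this hc hd
      exact hd (by omega)
    -- If the coordinate x were constant away from p, only the term at p would survive in this
    -- vanishing sum.
    have h0 : ∑ i, s i * (z i x - z q x : K) = 0 := by
      simp only [mul_sub, Finset.sum_sub_distrib, H.sum_mul, ← Finset.sum_mul, H.sum]
      simp
    rw [Finset.sum_eq_single (p : I)] at h0
    · have h1 : (z p x - z q x : K) = 0 := (mul_eq_zero.1 h0).resolve_left p.2
      exact hx (by exact_mod_cast h1)
    · intro i _ hi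
      by_cases hs : s i = 0
      · simp [hs]
      · have := hconst ⟨i, hs⟩ (fun h => hi (congrArg Subtype.val h))
        simp only at this
        simp [this]
    · simp
  -- no edge disjoint from `p q` carries the same root
  have caseA : ∀ u w : {i // s i ≠ 0}, R.Adj u w → u ≠ p → u ≠ q → w ≠ p → w ≠ q →
      (z u - z w) a = 0 := by
    intro u w huw hup huq hwp hwq
    by_contra ha
    have hb := (hD p q u w hup huq hwp hwq hab).1 ha
    have hf : IsRootOn (z u - z w) a b := ((hRadj u w).1 huw).on_of_ne hab.1 ha hb
    -- A further neighbour of one of the four vertices would carry exactly one of a, b by adjacency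
    -- to one edge, and both or none by disjointness from the other.
    have hclosed : ∀ x ∈ ({p, q, u, w} : Set {i // s i ≠ 0}), ∀ t ∉ ({p, q, u, w} : Set _),
        ¬ R.Adj t x := by
      intro x hx t ht htx
      simp only [Set.mem_insert_iff, Set.mem_singleton_iff, not_or] at hx ht
      obtain ⟨t1, t2, t3, t4⟩ := ht
      rcases hx with rfl | rfl | rfl | rfl
      · have e1 := hA q x t t2 htx (hsymm hab)
        have e2 := hD u w t x t3 t4 hup.symm hwp.symm hf
        tauto
      · have e1 := hA p x t t1 htx hab
        have e2 := hD u w t x t3 t4 huq.symm hwq.symm hf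
        tauto
      · have e1 := hA w x t t4 htx (hsymm hf)
        have e2 := hD p q t x t1 t2 hup huq hab
        tauto
      · have e1 := hA u x t t3 htx hf
        have e2 := hD p q t x t1 t2 hwp hwq hab
        tauto
    have hall : ∀ t, t ∈ ({p, q, u, w} : Set {i // s i ≠ 0}) := by
      intro t
      by_contra ht
      obtain ⟨x, hx, t', ht', hadj⟩ := hC.exists_adj_mem_notMem
        (S := {p, q, u, w}) (x := p) (by simp) ht
      exact hclosed x hx t' ht' hadj.symm
    -- The support is now {p, q, u, w}. An edge that leaves {p, q} uses a third index c, so there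
    -- must be a fifth vertex.
    obtain ⟨x, hx, y, hy, hxy⟩ := hC.exists_adj_mem_notMem (S := {p, q}) (x := p) (t := u)
      (by simp) (by simp [hup, huq])
    have hy' : y ≠ p ∧ y ≠ q := by simpa [not_or] using hy
    have hxor : (z y - z x) a ≠ 0 ↔ (z y - z x) b = 0 := by
      rcases hx with rfl | hx
      · exact hA q x y hy'.2 hxy.symm (hsymm hab)
      · rw [Set.mem_singleton_iff] at hx
        subst hx
        exact hA p x y hy'.1 hxy.symm hab
    obtain ⟨c, hca, hcb, hc⟩ : ∃ c, a ≠ c ∧ b ≠ c ∧ (z y - z x) c ≠ 0 := by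
      by_cases ha' : (z y - z x) a = 0
      · have hb' : (z y - z x) b ≠ 0 := by tauto
        obtain ⟨c, hc⟩ := ((hRadj y x).1 hxy.symm).exists_other hb'
        exact ⟨c, fun h => (hnz hc).2 (h ▸ ha'), hc.1, (hnz hc).2⟩
      · have hb' : (z y - z x) b = 0 := by tauto
        obtain ⟨c, hc⟩ := ((hRadj y x).1 hxy.symm).exists_other ha'
        exact ⟨c, hc.1, fun h => (hnz hc).2 (h ▸ hb'), (hnz hc).2⟩
    obtain ⟨t, hts, t1, t2, t3, t4⟩ := H.exists_ne_four hab.1 hca hcb (hcoeff p q a (hnz hab).1)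
      (hcoeff p q b (hnz hab).2) (hcoeff y x c hc) p q u w
    have := hall ⟨t, hts⟩
    simp only [Set.mem_insert_iff, Set.mem_singleton_iff, Subtype.ext_iff] at this
    tauto
  -- both indices therefore occur on edges at `q`
  have hq : ∀ x y : J, IsRootOn (z p - z q) x y →
      (∀ u w : {i // s i ≠ 0}, R.Adj u w → u ≠ p → u ≠ q → w ≠ p → w ≠ q → (z u - z w) x = 0) →
      ∃ u, u ≠ p ∧ R.Adj u q ∧ (z u - z q) x ≠ 0 := by
    intro x y hxy hno
    obtain ⟨u, w, hup, hwp, huw, hne⟩ := hex x (hnz hxy).1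
    by_cases huq : u = q
    · subst huq
      exact ⟨w, hwp, huw.symm, hnzsymm hne⟩
    by_cases hwq : w = q
    · subst hwq
      exact ⟨u, hup, huw, hne⟩
    · exact absurd (hno u w huw hup huq hwp hwq) hne
  have hba : IsRootOn (z p - z q) b a := ⟨hab.1.symm, hab.2.2.1, hab.2.1,
    fun j h1 h2 => hab.2.2.2 j h2 h1⟩
  obtain ⟨u, hup, huq, hua⟩ := hq a b hab caseA
  obtain ⟨w, hwp, hwq, hwb⟩ := hq b a hba (fun u w huw h1 h2 h3 h4 => by
    have := hD p q u w h1 h2 h3 h4 hab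
    have h5 := caseA u w huw h1 h2 h3 h4
    by_contra h6
    exact (this.2 h6) h5)
  have hub := (hA p q u hup huq hab).1 hua
  have hwa : (z w - z q) a = 0 := by
    by_contra h
    exact hwb ((hA p q w hwp hwq hab).1 h)
  have huw : u ≠ w := fun h => hua (h ▸ hwa)
  -- The edges at q from p, u, w carry the index pairs ab, ac, bc. A new neighbour of q would have
  -- to use exactly one index of each pair. A new neighbour of a leaf would use exactly one index of
  -- the leaf's pair, but both or none of each other pair. Both are impossible, while a fifth vertex
  -- exists.
  obtain ⟨c, hac⟩ := ((hRadj u q).1 huq).exists_other hua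
  have hbc : b ≠ c := fun h => (hnz hac).2 (h ▸ hub)
  have hwc : (z w - z q) c ≠ 0 := by
    by_contra h
    have := (hA u q w huw.symm hwq hac).2 h
    exact this hwa
  have hbc' : IsRootOn (z w - z q) b c := ((hRadj w q).1 hwq).on_of_ne hbc hwb hwc
  obtain ⟨t, hts, t1, t2, t3, t4⟩ := H.exists_ne_four hab.1 hac.1 hbc (hcoeff p q a (hnz hab).1)
    (hcoeff p q b (hnz hab).2) (hcoeff u q c (hnz hac).2) p q u w
  obtain ⟨x, hx, t', ht', hadj⟩ := hC.exists_adj_mem_notMem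
    (S := {p, q, u, w}) (x := p) (t := ⟨t, hts⟩) (by simp) (by
      simp only [Set.mem_insert_iff, Set.mem_singleton_iff, Subtype.ext_iff]
      tauto)
  simp only [Set.mem_insert_iff, Set.mem_singleton_iff, not_or] at hx ht'
  obtain ⟨t1, t2, t3, t4⟩ := ht'
  have hadj' := hadj.symm
  rcases hx with rfl | rfl | rfl | rfl
  · have e1 := hA q x t' t2 hadj' (hsymm hab)
    have e2 := hD u q t' x t3 t2 hup.symm hpq.ne hac
    have e3 := hD w q t' x t4 t2 hwp.symm hpq.ne hbc'
    tauto
  · have e1 := hA p x t' t1 hadj' hab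
    have e2 := hA u x t' t3 hadj' hac
    have e3 := hA w x t' t4 hadj' hbc'
    tauto
  · have e1 := hA q x t' t2 hadj' (hsymm hac)
    have e2 := hD p q t' x t1 t2 hup huq.ne hab
    have e3 := hD w q t' x t4 t2 huw huq.ne hbc'
    tauto
  · have e1 := hA q x t' t2 hadj' (hsymm hbc')
    have e2 := hD p q t' x t1 t2 hwp hwq.ne hab
    have e3 := hD u q t' x t3 t2 huw.symm hwq.ne hac
    tauto

end IsResonance

/-! ### Derivations dual to algebraically independent elements. -/

open MvPolynomial in
-- Complete v to a transcendence basis and prescribe the derivation on the polynomial ring. In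
-- characteristic 0 the field K is formally étale over this ring, so the derivation extends.
theorem exists_derivation_of_algebraicIndependent {k K ι : Type} [Field k] [CharZero k] [Field K]
    [Algebra k K] {v : ι → K} (hv : AlgebraicIndependent k v) (d : ι → K) :
    ∃ D : Derivation k K K, ∀ i, D (v i) = d i := by
  classical
  obtain ⟨t, hst, ht⟩ := exists_isTranscendenceBasis_superset (R := k) (s := Set.range v)
    hv.coe_range
  let f : MvPolynomial t k →ₐ[k] K := aeval (fun x : t => (x : K))
  have hf : Function.Injective f := ht.1
  let : Algebra (MvPolynomial t k) K := f.toRingHom.toAlgebra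
  have : IsScalarTower k (MvPolynomial t k) K :=
    IsScalarTower.of_algebraMap_eq' f.comp_algebraMap.symm
  have : FaithfulSMul (MvPolynomial t k) K := (faithfulSMul_iff_algebraMap_injective _ _).2 hf
  have halg : Algebra.IsAlgebraic (MvPolynomial t k) K := by
    have := ht.isAlgebraic
    constructor
    intro x
    have hx := this.1 x
    rw [← isAlgebraic_ringHom_iff_of_comp_eq (ht.1.aevalEquiv) (RingHom.id K) Function.injective_id
      (by
        ext p
        · simp only [RingHom.comp_apply]
          exact Eq.trans (by simp) (f.commutes p).symm
        · simp only [RingHom.comp_apply]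
          exact Eq.trans (by simp) (aeval_X (R := k) (fun x : t => (x : K)) p).symm)]
    exact hx
  let : Algebra (FractionRing (MvPolynomial t k)) K := FractionRing.liftAlgebra _ K
  have : Algebra.IsAlgebraic (FractionRing (MvPolynomial t k)) K :=
    (IsFractionRing.comap_isAlgebraic_iff (A := MvPolynomial t k)).1 halg
  have : CharZero (FractionRing (MvPolynomial t k)) :=
    charZero_of_injective_algebraMap (FaithfulSMul.algebraMap_injective k _)
  have : Algebra.FormallyEtale (FractionRing (MvPolynomial t k)) K :=
    Algebra.FormallyEtale.of_isSeparable _ _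
  have : Algebra.FormallyEtale (MvPolynomial t k) (FractionRing (MvPolynomial t k)) :=
    Algebra.FormallyEtale.of_isLocalization (nonZeroDivisors _)
  have : Algebra.FormallyEtale (MvPolynomial t k) K :=
    Algebra.FormallyEtale.comp _ (FractionRing (MvPolynomial t k)) _
  let d' : t → K := fun x => if h : ∃ i, v i = x then d h.choose else 0
  let D₀ : Derivation k (MvPolynomial t k) K := mkDerivation k d'
  let ℓ := (D₀.liftKaehlerDifferential.liftBaseChange K) ∘ₗ
    (KaehlerDifferential.tensorKaehlerEquivOfFormallyEtale k (MvPolynomial t k) K).symm.toLinearMap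
  refine ⟨ℓ.compDer (KaehlerDifferential.D k K), fun i => ?_⟩
  have hvi : v i = algebraMap (MvPolynomial t k) K (X ⟨v i, hst ⟨i, rfl⟩⟩) := by
    change _ = f _
    simp [f]
  have hd' : d' ⟨v i, hst ⟨i, rfl⟩⟩ = d i := by
    have h : ∃ j, v j = v i := ⟨i, rfl⟩
    simp only [d', dif_pos h]
    rw [hv.injective h.choose_spec]
  have : ℓ (KaehlerDifferential.D k K (v i)) = d i := by
    rw [hvi]
    simp only [ℓ, LinearMap.comp_apply, LinearEquiv.coe_coe,
      KaehlerDifferential.tensorKaehlerEquivOfFormallyEtale_symm_D_algebraMap]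
    rw [LinearMap.liftBaseChange_tmul, Derivation.liftKaehlerDifferential_comp_D]
    simp [D₀, mkDerivation_X, hd']
  exact this

/-! ### Formal points and their quadratic equations. -/

/-- The value of the formal point `∑ Y t • t` when the symbols take the values `u t`. -/
def formalEval {R ι : Type*} [CommRing R] [Fintype ι] (Y : ι → ℤ) (u : ι → R) : R :=
  ∑ t, Y t * u t

/-- The bilinear form of the equation `|∑ Y t • v t|² = ∑ Y t |v t|²`. -/
def vertexForm {R ι : Type*} [CommRing R] [Fintype ι] (Y : ι → ℤ) (u w : ι → R) : R :=
  formalEval Y u * formalEval Y w - ∑ t, Y t * (u t * w t)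

/-- The formal version of an edge of `Γ_S`. -/
def IsFormalEdge {J : Type*} [DecidableEq J] (h k : J) (Y Y' : Option J → ℤ) : Prop :=
  h ≠ k ∧ (Y' - Y = Pi.single (some k) 1 - Pi.single (some h) 1 ∨
    Y + Y' = Pi.single (some h) 1 + Pi.single (some k) 1)

section forms

variable {R ι : Type*} [CommRing R] [Fintype ι]

theorem formalEval_add_left (Y Y' : ι → ℤ) (u : ι → R) :
    formalEval (Y + Y') u = formalEval Y u + formalEval Y' u := by
  simp [formalEval, add_mul, Finset.sum_add_distrib]

theorem formalEval_sub_left (Y Y' : ι → ℤ) (u : ι → R) :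
    formalEval (Y - Y') u = formalEval Y u - formalEval Y' u := by
  simp [formalEval, sub_mul, Finset.sum_sub_distrib]

theorem formalEval_single [DecidableEq ι] (t : ι) (c : ℤ) (u : ι → R) :
    formalEval (Pi.single t c) u = c * u t := by
  rw [formalEval, Finset.sum_eq_single t]
  · simp
  · intro b _ hb; simp [hb]
  · simp

theorem formalEval_add (Y : ι → ℤ) (u w : ι → R) :
    formalEval Y (u + w) = formalEval Y u + formalEval Y w := by
  simp [formalEval, mul_add, Finset.sum_add_distrib]

theorem formalEval_map {S : Type*} [CommRing S] (f : R →+* S) (Y : ι → ℤ) (u : ι → R) :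
    formalEval Y (fun t => f (u t)) = f (formalEval Y u) := by
  simp [formalEval]

theorem vertexForm_map {S : Type*} [CommRing S] (f : R →+* S) (Y : ι → ℤ) (u w : ι → R) :
    vertexForm Y (fun t => f (u t)) (fun t => f (w t)) = f (vertexForm Y u w) := by
  simp [vertexForm, formalEval_map]

theorem vertexForm_comm (Y : ι → ℤ) (u w : ι → R) : vertexForm Y u w = vertexForm Y w u := by
  simp only [vertexForm]
  rw [mul_comm (formalEval Y u)]
  simp only [mul_comm (u _)]

theorem vertexForm_zero_right (Y : ι → ℤ) (u : ι → R) : vertexForm Y u 0 = 0 := by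
  simp [vertexForm, formalEval]

/-- The endomorphism of the equation of a vertex. -/
def vertexMap (R : Type*) [CommRing R] (Y : ι → ℤ) : (ι → R) →ₗ[R] (ι → R) where
  toFun u t := Y t * formalEval Y u - Y t * u t
  map_add' u w := by
    ext t
    simp only [formalEval_add, Pi.add_apply]
    ring
  map_smul' c u := by
    ext t
    have : formalEval Y (c • u) = c * formalEval Y u := by
      simp only [formalEval, Finset.mul_sum, Pi.smul_apply, smul_eq_mul]
      exact Finset.sum_congr rfl fun t _ => by ring
    simp only [this, Pi.smul_apply, smul_eq_mul, RingHom.id_apply]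
    ring

theorem vertexMap_apply (Y : ι → ℤ) (u : ι → R) (t : ι) :
    vertexMap R Y u t = Y t * formalEval Y u - Y t * u t := rfl

theorem vertexForm_eq_sum (Y : ι → ℤ) (u w : ι → R) :
    vertexForm Y u w = ∑ t, vertexMap R Y u t * w t := by
  simp only [vertexMap_apply, sub_mul, Finset.sum_sub_distrib, vertexForm]
  congr 1
  · rw [mul_comm]
    conv_lhs => rw [formalEval, Finset.sum_mul]
    exact Finset.sum_congr rfl fun t _ => by ring
  · exact Finset.sum_congr rfl fun t _ => by ring

/-- The equation of an edge says that two differences are orthogonal: Y - e_h and e_k - e_h for a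
black edge, Y - e_h and Y - e_k for a red one. This factorization into linear forms drives the
contradictions below. -/
theorem IsFormalEdge.exists_mul_eq (R : Type*) [CommRing R] {J : Type*} [Fintype J]
    [DecidableEq J] {h k : J} {Y Y' : Option J → ℤ} (H : IsFormalEdge h k Y Y') :
    ∃ (w : Option J → ℤ) (ε : ℤ),
      (w = Pi.single (some k) 1 - Pi.single (some h) 1 ∨ w = Y - Pi.single (some k) 1) ∧
      ∀ u : Option J → R, 2 * (formalEval (Y - Pi.single (some h) 1) u * formalEval w u)
        = vertexForm Y' u u + ε * vertexForm Y u u := by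
  have key : ∀ (Y : Option J → ℤ) (u : Option J → R), vertexForm Y u u
      = formalEval Y u ^ 2 - formalEval Y fun t => u t * u t := fun Y u => by
    simp [vertexForm, formalEval, sq]
  rcases H.2 with H | H
  · refine ⟨_, -1, Or.inl rfl, fun u => ?_⟩
    obtain rfl : Y' = Y + Pi.single (some k) 1 - Pi.single (some h) 1 := by
      rw [add_sub_assoc, ← H]; simp
    simp only [key, formalEval_add_left, formalEval_sub_left, formalEval_single]
    push_cast
    ring
  · refine ⟨_, 1, Or.inr rfl, fun u => ?_⟩
    obtain rfl : Y' = Pi.single (some h) 1 + Pi.single (some k) 1 - Y := by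
      rw [← H]; simp
    simp only [key, formalEval_add_left, formalEval_sub_left, formalEval_single]
    push_cast
    ring

theorem derivation_formalEval {k : Type*} [CommRing k] [Algebra k R] (D : Derivation k R R)
    (Y : ι → ℤ) (u : ι → R) : D (formalEval Y u) = formalEval Y fun t => D (u t) := by
  simp [formalEval]

theorem derivation_vertexForm {k : Type*} [CommRing k] [Algebra k R] (D : Derivation k R R)
    (Y : ι → ℤ) (u w : ι → R) : D (vertexForm Y u w)
      = vertexForm Y (fun t => D (u t)) w + vertexForm Y u fun t => D (w t) := by
  have : ∀ a b : R, D (a * b) = a * D b + b * D a := fun a b => by simp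
  simp only [vertexForm, map_sub, map_sum, this, derivation_formalEval, Derivation.map_intCast,
    mul_zero, add_zero, mul_add, Finset.sum_add_distrib]
  simp only [mul_comm (w _)]
  ring

end forms

/-! ### The Lagrangian of a degenerate configuration. -/

/-- A connected set of distinct formal points `Y i = σ i • x + ∑ a i j • v j`, of mass `1`. -/
structure IsFormalConfig {I J : Type*} [Fintype J] [DecidableEq J] (Y : I → Option J → ℤ) :
    Prop where
  sign : ∀ i, Y i none = 1 ∨ Y i none = -1
  mass : ∀ i, ∑ t, Y i t = 1
  inj : Function.Injective Y
  conn : ∃ G : SimpleGraph I, G.Connected ∧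
    ∀ i l, G.Adj i l → ∃ h k, IsFormalEdge h k (Y i) (Y l)

/-- The values `V` of the symbols satisfy the equations of the formal points `Y i`, none of which
is one of the `v j`, and the only affine dependency of the points involves the point `o`. -/
structure IsDegenerate {K I J : Type*} [CommRing K] [Fintype I] [Fintype J] {n : ℕ}
    (Y : I → Option J → ℤ) (o : I) (V : Option J → Fin n → K) : Prop where
  quad : ∀ i, ∑ a, vertexForm (Y i) (fun t => V t a) (fun t => V t a) = 0
  not_special : ∀ i j, ∃ a, formalEval (Y i) (fun t => V t a) ≠ V (some j) a
  indep : ∀ c : I → K, ∑ i, c i = 0 → (∀ a, ∑ i, c i * formalEval (Y i) (fun t => V t a) = 0) →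
    c o = 0 → c = 0
  dep : ∃ c : I → K, ∑ i, c i = 0 ∧ (∀ a, ∑ i, c i * formalEval (Y i) (fun t => V t a) = 0) ∧
    c o = 1

/-- Derivations dual to the coordinates of the vectors `v j`. -/
def IsDualFamily {k K J : Type*} [CommRing k] [Field K] [Algebra k K] [DecidableEq J] {n : ℕ}
    (D : J → Fin n → Derivation k K K) (V : Option J → Fin n → K) : Prop :=
  ∀ l b j a, D l b (V (some j) a) = if j = l ∧ a = b then 1 else 0

section core

variable {k K I J : Type*} [CommRing k] [Field K] [Algebra k K] [CharZero K]
  [Fintype I] [Fintype J] [DecidableEq J] {n : ℕ} {Y : I → Option J → ℤ} {o : I}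
  {V : Option J → Fin n → K} {D : J → Fin n → Derivation k K K} {c : I → K}

/-- The Lagrangian of a dependency `c` among the equations of the points `Y i`. -/
def lagrangian {K I J : Type*} [Field K] [Fintype I] [Fintype J] (Y : I → Option J → ℤ)
    (c : I → K) : (Option J → K) →ₗ[K] (Option J → K) :=
  ∑ i, ((Y i none : K) * c i) • vertexMap K (Y i)

omit [CharZero K] [DecidableEq J] in
theorem lagrangian_apply (u : Option J → K) (t : Option J) :
    lagrangian Y c u t = ∑ i, (Y i none : K) * c i * vertexMap K (Y i) u t := by
  simp [lagrangian]

omit [CharZero K] [Fintype I] in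
theorem IsFormalConfig.sign_mul_self (hY : IsFormalConfig Y) (i : I) :
    (Y i none : K) * Y i none = 1 := by
  rcases hY.sign i with h | h <;> simp [h]

omit [CharZero K] in
theorem IsFormalConfig.lagrangian_none (hY : IsFormalConfig Y) (u : Option J → K) :
    lagrangian Y c u none = ∑ i, c i * formalEval (Y i) u - (∑ i, c i) * u none := by
  rw [lagrangian_apply, Finset.sum_mul, ← Finset.sum_sub_distrib]
  refine Finset.sum_congr rfl fun i _ => ?_
  rw [vertexMap_apply]
  linear_combination (c i * formalEval (Y i) u - c i * u none) * hY.sign_mul_self (K := K) i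

/-- The row of x vanishes because c is an affine relation of the points. Hence the unknown
derivative of x drops out of the combination of the differentiated vertex equations with weights σ_i
c_i, and the dual derivations isolate the other rows. -/
theorem lagrangian_eq_zero (hY : IsFormalConfig Y) (hV : IsDegenerate Y o V)
    (hD : IsDualFamily D V) (hc : ∑ i, c i = 0)
    (hc' : ∀ a, ∑ i, c i * formalEval (Y i) (fun t => V t a) = 0) (b : Fin n) :
    lagrangian Y c (fun t => V t b) = 0 := by
  have hnone : ∀ b, lagrangian Y c (fun t => V t b) none = 0 := fun b => by
    rw [hY.lagrangian_none, hc, hc' b, zero_mul, sub_zero]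
  ext t
  cases t with
  | none => exact hnone b
  | some l =>
    have h1 : ∀ i, ∑ a, ∑ t, vertexMap K (Y i) (fun t => V t a) t * D l b (V t a) = 0 := by
      intro i
      have h := congrArg (D l b) (hV.quad i)
      rw [map_sum, map_zero] at h
      simp only [derivation_vertexForm] at h
      have h2 : ∀ a, vertexForm (Y i) (fun t => D l b (V t a)) (fun t => V t a)
          + vertexForm (Y i) (fun t => V t a) (fun t => D l b (V t a))
          = 2 * ∑ t, vertexMap K (Y i) (fun t => V t a) t * D l b (V t a) := by
        intro a
        rw [vertexForm_comm, ← vertexForm_eq_sum]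
        ring
      simp only [h2, ← Finset.mul_sum] at h
      simpa using h
    have h2 : ∑ a, ∑ t, lagrangian Y c (fun t => V t a) t * D l b (V t a) = 0 := by
      have : ∑ i, (Y i none : K) * c i *
          ∑ a, ∑ t, vertexMap K (Y i) (fun t => V t a) t * D l b (V t a) = 0 :=
        Finset.sum_eq_zero fun i _ => by rw [h1 i, mul_zero]
      rw [← this]
      simp only [Finset.mul_sum, lagrangian_apply, Finset.sum_mul]
      symm
      rw [Finset.sum_comm]
      refine Finset.sum_congr rfl fun a _ => ?_
      rw [Finset.sum_comm]
      exact Finset.sum_congr rfl fun t _ => Finset.sum_congr rfl fun i _ => by ring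
    simp only [Fintype.sum_option, hnone, zero_mul, zero_add, hD l b] at h2
    rw [Finset.sum_eq_single b (fun a _ ha => by simp [ha]) (by simp),
      Finset.sum_eq_single l (fun a _ ha => by simp [ha]) (by simp)] at h2
    simpa using h2

omit [CharZero K] [Fintype J] in
theorem ne_of_isDualFamily (hn : 1 ≤ n) (hD : IsDualFamily D V) {h k : J} (hhk : h ≠ k) :
    ∃ a, V (some k) a ≠ V (some h) a := by
  by_contra! hh
  have := congrArg (D h ⟨0, hn⟩) (hh ⟨0, hn⟩)
  rw [hD, hD] at this
  simp [hhk.symm] at this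

/-- The Lagrangian cannot vanish identically. -/
theorem lagrangian_ne_zero (hY : IsFormalConfig Y) (hV : IsDegenerate Y o V)
    (hsq : ∀ x : Fin n → K, ∑ a, x a * x a = 0 → x = 0)
    (hc : ∑ i, c i = 0)
    (hc' : ∀ a, ∑ i, c i * formalEval (Y i) (fun t => V t a) = 0) (ho : c o = 1) :
    lagrangian Y c ≠ 0 := by
  classical
  intro hL
  obtain ⟨G, hG, hGe⟩ := hY.conn
  have hentry : ∀ t t', ∑ i, (Y i none : K) * c i * (Y i t * Y i t')
      = if t = t' then ∑ i, (Y i none : K) * c i * Y i t else 0 := by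
    intro t t'
    have h := congrFun (congrArg (fun f => f (Pi.single t' 1)) hL) t
    simp only [lagrangian_apply, vertexMap_apply, LinearMap.zero_apply, Pi.zero_apply] at h
    have h1 : ∀ i, formalEval (Y i) (Pi.single t' 1 : Option J → K) = Y i t' := by
      intro i
      rw [formalEval, Finset.sum_eq_single t'] <;> simp +contextual
    simp only [h1, mul_sub, Finset.sum_sub_distrib, sub_eq_zero] at h
    rw [h]
    by_cases htt : t = t'
    · subst htt; simp
    · simp [htt]
  have hsg := fun i => hY.sign_mul_self (K := K) i
  -- Multiplying by the sign σ_i of x puts all formal points over +x, so that black and red edges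
  -- both become roots ± e_h ± e_k.
  have H : IsResonance (K := K) (fun i j => Y i none * Y i (some j)) (fun i => Y i none)
      (fun i => (Y i none : K) * c i) :=
    { sign := hY.sign
      mass := fun i => by
        have h := hY.mass i
        rw [Fintype.sum_option] at h
        rw [← Finset.mul_sum]
        rcases hY.sign i with h1 | h1 <;> rw [h1] at h ⊢ <;> linarith
      ne_zero := fun h => by
        have := congrFun h o
        simp only [ho, mul_one, Pi.zero_apply] at this
        have h2 := hsg o
        simp [this] at h2
      sum := by
        have h := hentry none none
        simp only [if_true, hsg, mul_one] at h
        rw [h]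
        simp only [mul_right_comm _ (c _), hsg, one_mul, hc]
      sum_sign := by
        simp only [mul_right_comm _ (c _), hsg, one_mul, hc]
      sum_mul := fun j => by
        have h := hentry none (some j)
        simpa using h
      diag := fun j l => by
        have h := hentry (some j) (some l)
        simp only [Option.some_inj] at h
        push_cast
        have e : ∀ i, (Y i none : K) * c i * (Y i none * Y i (some j)) * (Y i none * Y i (some l))
            = (Y i none : K) * c i * (Y i (some j) * Y i (some l)) := fun i => by
          linear_combination ((Y i none : K) * c i * (Y i (some j) * Y i (some l))) * hsg i
        have e' : ∀ i, (Y i none : K) * c i * Y i none * (Y i none * Y i (some j))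
            = (Y i none : K) * c i * Y i (some j) := fun i => by
          linear_combination ((Y i none : K) * c i * (Y i (some j))) * hsg i
        simp only [e, e', h]
      -- After the sign change, d annihilates every coefficient of the formal points, hence also
      -- their values. Masses equal to 1 make it affine, so it is a multiple of c.
      unique := fun d hd hd' => by
        let d' : I → K := fun i => Y i none * d i
        have hYd : ∀ t, ∑ i, d' i * Y i t = 0 := by
          intro t
          cases t with
          | none => simpa [d', mul_right_comm _ (d _), hsg] using hd
          | some j =>
            rw [← hd' j]
            exact Finset.sum_congr rfl fun i _ => by simp only [d']; push_cast; ring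
        have hd0 : ∑ i, d' i = 0 := by
          have h := Finset.sum_eq_zero (s := Finset.univ) fun t (_ : t ∈ Finset.univ) => hYd t
          rw [Finset.sum_comm] at h
          rw [← h]
          refine Finset.sum_congr rfl fun i _ => ?_
          rw [← Finset.mul_sum]
          have := hY.mass i
          have h1 : (∑ t, (Y i t : K)) = 1 := by exact_mod_cast this
          rw [h1, mul_one]
        have hev : ∀ a, ∑ i, d' i * formalEval (Y i) (fun t => V t a) = 0 := by
          intro a
          simp only [formalEval, Finset.mul_sum]
          rw [Finset.sum_comm]
          refine Finset.sum_eq_zero fun t _ => ?_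
          simp only [← mul_assoc, ← Finset.sum_mul, hYd t, zero_mul]
        have h0 := hV.indep (fun i => d' i - d' o * c i)
          (by rw [Finset.sum_sub_distrib, ← Finset.mul_sum, hd0, hc]; simp)
          (fun a => by
            simp only [sub_mul, mul_assoc, Finset.sum_sub_distrib, ← Finset.mul_sum, hev a, hc' a]
            simp)
          (by simp [ho])
        refine ⟨d' o, fun i => ?_⟩
        have h1 := congrFun h0 i
        simp only [Pi.zero_apply] at h1
        have h2 : (Y i none : K) * d' i = d i := by
          simp only [d']
          linear_combination d i * hsg i
        rw [← h2]
        linear_combination (Y i none : K) * h1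
      inj := fun i l h => by
        have hσ : Y i none = Y l none := by
          have h1 := hY.mass i
          have h2 := hY.mass l
          rw [Fintype.sum_option] at h1 h2
          have h3 : Y i none * ∑ j, Y i (some j) = Y l none * ∑ j, Y l (some j) := by
            rw [Finset.mul_sum, Finset.mul_sum]
            exact Finset.sum_congr rfl fun j _ => congrFun h j
          rcases hY.sign i with h4 | h4 <;> rcases hY.sign l with h5 | h5 <;>
            rw [h4] at h1 h3 ⊢ <;> rw [h5] at h2 h3 ⊢ <;> linarith
        refine hY.inj (funext fun t => ?_)
        cases t with
        | none => exact hσ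
        | some j =>
          have h1 := congrFun h j
          simp only [hσ] at h1
          rcases hY.sign l with h5 | h5 <;> rw [h5] at h1 <;> linarith }
  obtain ⟨i, l, j, hil⟩ := H.exists_sub_eq_single_two hG (fun i l hadj => by
    obtain ⟨h, k, hhk, he⟩ := hGe i l hadj
    have hss : (some h : Option J) ≠ some k := fun hh => hhk (Option.some_inj.1 hh)
    rcases he with he | he
    · have e : ∀ t, Y l t = Y i t + (Pi.single (some k) 1 : Option J → ℤ) t
          - (Pi.single (some h) 1 : Option J → ℤ) t := by
        intro t
        have := congrFun he t
        simp only [Pi.sub_apply] at this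
        linarith
      have e0 : Y l none = Y i none := by simpa using e none
      refine ⟨h, k, hhk, ?_, ?_, fun j hjh hjk => ?_⟩
      · have := e (some h)
        simp only [Pi.sub_apply, e0, this, Pi.single_eq_same, Pi.single_eq_of_ne hss]
        rcases hY.sign i with h1 | h1 <;> rw [h1] <;> omega
      · have := e (some k)
        simp only [Pi.sub_apply, e0, this, Pi.single_eq_same, Pi.single_eq_of_ne hss.symm]
        rcases hY.sign i with h1 | h1 <;> rw [h1] <;> omega
      · have := e (some j)
        rw [Pi.single_eq_of_ne (by simpa using hjk),
          Pi.single_eq_of_ne (by simpa using hjh)] at this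
        simp [e0, this]
    · have e : ∀ t, Y l t = (Pi.single (some h) 1 : Option J → ℤ) t
          + (Pi.single (some k) 1 : Option J → ℤ) t - Y i t := by
        intro t
        have := congrFun he t
        simp only [Pi.add_apply] at this
        linarith
      have e0 : Y l none = - Y i none := by simpa using e none
      refine ⟨h, k, hhk, ?_, ?_, fun j hjh hjk => ?_⟩
      · have := e (some h)
        simp only [Pi.sub_apply, e0, this, Pi.single_eq_same, Pi.single_eq_of_ne hss]
        rcases hY.sign i with h1 | h1 <;> rw [h1] <;> omega
      · have := e (some k)
        simp only [Pi.sub_apply, e0, this, Pi.single_eq_same, Pi.single_eq_of_ne hss.symm]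
        rcases hY.sign i with h1 | h1 <;> rw [h1] <;> omega
      · have := e (some j)
        rw [Pi.single_eq_of_ne (by simpa using hjh),
          Pi.single_eq_of_ne (by simpa using hjk)] at this
        simp [e0, this])
  have hsum := H.mass i
  have hsum' := H.mass l
  -- The masses of z i and z l differ by 2, which determines both signs and gives Y l = 2 e_j - Y i.
  have hdiff : (Y i none - 1) - (Y l none - 1) = 2 := by
    rw [← hsum, ← hsum', ← Finset.sum_sub_distrib]
    have := fun x => congrFun hil x
    simp only [Pi.sub_apply] at this
    simp [this]
  have hi1 : Y i none = 1 := by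
    rcases hY.sign i with h | h <;> rcases hY.sign l with h' | h' <;> omega
  have hl1 : Y l none = -1 := by omega
  have hYl : Y l = Pi.single (some j) 2 - Y i := by
    ext t
    cases t with
    | none => simp [hi1, hl1]
    | some x =>
      have := congrFun hil x
      simp only [Pi.sub_apply, hi1, hl1] at this
      have e : (Pi.single (some j) 2 : Option J → ℤ) (some x) = (Pi.single j 2 : J → ℤ) x := by
        simp [Pi.single_apply]
      rw [Pi.sub_apply, e]
      linarith
  have hq : ∑ a, (formalEval (Y i) (fun t => V t a) - V (some j) a)
      * (formalEval (Y i) (fun t => V t a) - V (some j) a) = 0 := by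
    have h1 := hV.quad i
    have h2 := hV.quad l
    have h3 : ∀ a, 2 * ((formalEval (Y i) (fun t => V t a) - V (some j) a)
        * (formalEval (Y i) (fun t => V t a) - V (some j) a))
        = vertexForm (Y i) (fun t => V t a) (fun t => V t a)
          + vertexForm (Y l) (fun t => V t a) (fun t => V t a) := by
      intro a
      have key : ∀ Y : Option J → ℤ, vertexForm Y (fun t => V t a) (fun t => V t a)
          = formalEval Y (fun t => V t a) ^ 2 - formalEval Y fun t => V t a * V t a := fun Y => by
        simp [vertexForm, formalEval, sq]
      rw [key, key, hYl, formalEval_sub_left, formalEval_sub_left, formalEval_single,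
        formalEval_single]
      push_cast
      ring
    have h4 : 2 * ∑ a, (formalEval (Y i) (fun t => V t a) - V (some j) a)
      * (formalEval (Y i) (fun t => V t a) - V (some j) a) = 0 := by
      rw [Finset.mul_sum, Finset.sum_congr rfl fun a _ => h3 a, Finset.sum_add_distrib, h1, h2,
        add_zero]
    simpa using h4
  obtain ⟨a, ha⟩ := hV.not_special i j
  exact ha (sub_eq_zero.1 (congrFun (hsq _ hq) a))

end core

theorem forall_eq_zero_or_forall_eq_zero {K M : Type*} [Field K] [AddCommGroup M] [Module K M]
    {P : Submodule K M} {f g : M →+ K} (h : ∀ x ∈ P, f x * g x = 0) :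
    (∀ x ∈ P, f x = 0) ∨ ∀ x ∈ P, g x = 0 := by
  by_contra! hh
  obtain ⟨⟨x, hx, hfx⟩, y, hy, hgy⟩ := hh
  have hgx : g x = 0 := (mul_eq_zero.1 (h x hx)).resolve_left hfx
  have hfy : f y = 0 := (mul_eq_zero.1 (h y hy)).resolve_right hgy
  have := h (x + y) (P.add_mem hx hy)
  rw [map_add, map_add, hgx, hfy, add_zero, zero_add] at this
  exact mul_ne_zero hfx hgy this

/-- The evaluation of a formal point as an additive map. -/
def formalEvalHom {R ι : Type*} [CommRing R] [Fintype ι] (Y : ι → ℤ) : (ι → R) →+ R where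
  toFun u := formalEval Y u
  map_zero' := by simp [formalEval]
  map_add' := formalEval_add Y

section core

variable {k K J : Type*} [CommRing k] [Field K] [Algebra k K] [CharZero K]
  [Fintype J] [DecidableEq J] {n m : ℕ} {Y : Fin (m + 2) → Option J → ℤ}
  {V : Option J → Fin n → K} {D : J → Fin n → Derivation k K K} {c : Fin (m + 2) → K}

omit [CharZero K] in
/-- If the Lagrangian has rank at least two, then the vectors `v j` can be moved so that the
symbols move along any given vectors of the kernel, while the dependency is fixed. -/
theorem exists_derivation_of_two_le_finrank_range (hmn : m ≤ n)
    (hD : IsDualFamily D V) (hc : ∑ i, c i = 0) (ho : c (Fin.last _) = 1)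
    (hL : ∀ b, lagrangian Y c (fun t => V t b) = 0)
    (hr : 2 ≤ Module.finrank K (LinearMap.range (lagrangian Y c)))
    (x : Fin n → Option J → K) (hx : ∀ a, lagrangian Y c (x a) = 0) :
    ∃ E : Derivation k K K, (∀ i, E (c i) = 0) ∧ ∀ t a, E (V t a) = x a t := by
  let 𝒟 : (J → Fin n → K) → Derivation k K K := fun u => ∑ l, ∑ b, u l b • D l b
  have h𝒟 : ∀ u y, 𝒟 u y = ∑ l, ∑ b, u l b * D l b y := by
    intro u y
    let ε : Derivation k K K →+ K :=
      { toFun := fun E => E y, map_zero' := rfl, map_add' := fun _ _ => rfl }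
    change ε (∑ l, ∑ b, u l b • D l b) = _
    simp only [map_sum]
    rfl
  have h𝒟V : ∀ u j a, 𝒟 u (V (some j) a) = u j a := by
    intro u j a
    rw [h𝒟, Finset.sum_eq_single j (fun l _ hl => Finset.sum_eq_zero fun b _ => by
      rw [hD]; simp [hl.symm]) (by simp),
      Finset.sum_eq_single a (fun b _ hb => by rw [hD]; simp [hb.symm]) (by simp), hD]
    simp
  let ev : K → (J → Fin n → K) →ₗ[K] K := fun y =>
    { toFun := fun u => 𝒟 u y
      map_add' := fun u w => by
        simp only [h𝒟, Pi.add_apply, add_mul, Finset.sum_add_distrib]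
      map_smul' := fun r u => by
        simp only [h𝒟, Pi.smul_apply, smul_eq_mul, mul_assoc, Finset.mul_sum, RingHom.id_apply] }
  -- Of the m + 2 coefficients one is 1 and the sum is 0, so m conditions suffice to kill the
  -- derivatives of all of c.
  let ψ : (J → Fin n → K) →ₗ[K] (Fin m → K) := LinearMap.pi fun i => ev (c i.succ.castSucc)
  have hker : ∀ u ∈ LinearMap.ker ψ, ∀ i, 𝒟 u (c i) = 0 := by
    intro u hu
    have h1 : ∀ i : Fin m, 𝒟 u (c i.succ.castSucc) = 0 := fun i => congrFun hu i
    have h2 : 𝒟 u (c (Fin.last _)) = 0 := by rw [ho]; exact Derivation.map_one_eq_zero _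
    have h3 := congrArg (𝒟 u) hc
    rw [map_sum, map_zero, Fin.sum_univ_castSucc, Fin.sum_univ_succ, h2,
      Finset.sum_eq_zero fun i _ => h1 i, add_zero, add_zero] at h3
    intro i
    refine Fin.lastCases h2 (fun i => ?_) i
    exact Fin.cases h3 h1 i
  have hmem : ∀ u ∈ LinearMap.ker ψ, ∀ a, lagrangian Y c (fun t => 𝒟 u (V t a)) = 0 := by
    intro u hu a
    ext t
    have h := congrArg (𝒟 u) (congrFun (hL a) t)
    simp only [lagrangian_apply, vertexMap_apply, Pi.zero_apply, map_zero, map_sum] at h ⊢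
    rw [← h]
    refine Finset.sum_congr rfl fun i _ => ?_
    simp only [Derivation.leibniz, map_sub, Derivation.map_intCast, hker u hu i,
      derivation_formalEval, smul_eq_mul]
    ring
  let Φ : LinearMap.ker ψ →ₗ[K] (Fin n → LinearMap.ker (lagrangian Y c)) :=
    { toFun := fun u a => ⟨fun t => 𝒟 u (V t a), hmem u u.2 a⟩
      map_add' := fun u w => by
        ext a t
        exact (ev (V t a)).map_add u w
      map_smul' := fun r u => by
        ext a t
        exact (ev (V t a)).map_smul r u }
  have hΦ : Function.Injective Φ := by
    intro u w huw
    ext j a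
    have := congrFun (congrArg Subtype.val (congrFun huw a)) (some j)
    simpa [Φ, h𝒟V] using this
  have hrank := LinearMap.finrank_range_add_finrank_ker ψ
  have hrank2 := LinearMap.finrank_range_add_finrank_ker (lagrangian Y c)
  have hle : Module.finrank K (LinearMap.range ψ) ≤ m := by
    simpa using Submodule.finrank_le (LinearMap.range ψ)
  have hle2 := LinearMap.finrank_le_finrank_of_injective hΦ
  have hdim : Module.finrank K (J → Fin n → K) = Fintype.card J * n := by
    simp [Module.finrank_pi_fintype]
  have hdim2 : Module.finrank K (Option J → K) = Fintype.card J + 1 := by simp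
  rw [hdim] at hrank
  rw [hdim2] at hrank2
  rw [Module.finrank_pi_fintype] at hle2
  simp only [Finset.sum_const, Finset.card_univ, Fintype.card_fin, smul_eq_mul] at hle2
  -- Since m ≤ n, ker ψ has dimension at least (|J| - 1) n. Rank at least 2 bounds the dimension of
  -- the target by the same number, so the injection `Φ` is onto.
  have heq : Module.finrank K (LinearMap.ker ψ)
      = Module.finrank K (Fin n → LinearMap.ker (lagrangian Y c)) := by
    rw [Module.finrank_pi_fintype]
    simp only [Finset.sum_const, Finset.card_univ, Fintype.card_fin, smul_eq_mul]
    have h1 : Module.finrank K (LinearMap.ker (lagrangian Y c)) + 1 ≤ Fintype.card J := by omega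
    have h2 := Nat.mul_le_mul_left n h1
    rw [mul_add, mul_one, mul_comm n (Fintype.card J)] at h2
    omega
  obtain ⟨u, hu⟩ := (LinearMap.injective_iff_surjective_of_finrank_eq_finrank heq).1 hΦ
    fun a => ⟨x a, hx a⟩
  exact ⟨𝒟 u, hker u u.2, fun t a => congrFun (congrArg Subtype.val (congrFun hu a)) t⟩

/-- If the rank were at least 2, differentiating each vertex equation twice along kernel vectors
would make every vertex form vanish on ker H. On an edge a product of two linear forms then vanishes
there, hence one factor does; evaluating it on V gives a point equal to some v_j, or v_h = v_k. -/
theorem finrank_range_lagrangian_le_one (hY : IsFormalConfig Y) (hn : 1 ≤ n) (hmn : m ≤ n)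
    (hV : IsDegenerate Y (Fin.last _) V) (hD : IsDualFamily D V) (hc : ∑ i, c i = 0)
    (hc' : ∀ a, ∑ i, c i * formalEval (Y i) (fun t => V t a) = 0) (ho : c (Fin.last _) = 1) :
    Module.finrank K (LinearMap.range (lagrangian Y c)) ≤ 1 := by
  by_contra! hr
  have hL := lagrangian_eq_zero hY hV hD hc hc'
  have hE := exists_derivation_of_two_le_finrank_range hmn hD hc ho hL hr
  have h1 : ∀ i a x, lagrangian Y c x = 0 →
      vertexForm (Y i) (fun t => V t a) x = 0 := by
    intro i a x hx
    obtain ⟨E, -, hEV⟩ := hE (Pi.single a x) (fun b => by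
      by_cases hb : b = a
      · subst hb; simpa using hx
      · simp [hb])
    have h := congrArg E (hV.quad i)
    rw [map_sum, map_zero] at h
    simp only [derivation_vertexForm, hEV] at h
    rw [Finset.sum_eq_single a (fun b _ hb => by
      rw [vertexForm_comm]
      simp only [Pi.single_eq_of_ne hb]
      have : (fun t => (0 : Option J → K) t) = 0 := rfl
      rw [this, vertexForm_zero_right, add_zero]) (by simp)] at h
    simp only [Pi.single_eq_same] at h
    rw [vertexForm_comm] at h
    have h2 : 2 * vertexForm (Y i) (fun t => V t a) x = 0 := by linear_combination h
    simpa using h2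
  have h2 : ∀ i x, lagrangian Y c x = 0 → vertexForm (Y i) x x = 0 := by
    intro i x hx
    let a : Fin n := ⟨0, hn⟩
    obtain ⟨E, hEc, hEV⟩ := hE (Pi.single a x) (fun b => by
      by_cases hb : b = a
      · subst hb; simpa using hx
      · simp [hb])
    have h := congrArg E (h1 i a x hx)
    rw [derivation_vertexForm, map_zero] at h
    simp only [hEV, Pi.single_eq_same] at h
    -- As E kills c, it maps the kernel vector x to a kernel vector, so this term vanishes by `h1`.
    rw [h1 i a (fun t => E (x t)) ?_, add_zero] at h
    · exact h
    ext t
    have h' := congrArg E (congrFun hx t)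
    simp only [lagrangian_apply, vertexMap_apply, Pi.zero_apply, map_zero, map_sum] at h' ⊢
    rw [← h']
    refine Finset.sum_congr rfl fun i _ => ?_
    simp only [Derivation.leibniz, map_sub, Derivation.map_intCast, hEc i,
      derivation_formalEval, smul_eq_mul]
    ring
  obtain ⟨G, hG, hGe⟩ := hY.conn
  obtain ⟨l, hadj⟩ := hG.preconnected.exists_adj_of_nontrivial (Fin.last (m + 1))
  obtain ⟨h, k, hhk⟩ := hGe _ _ hadj
  obtain ⟨w, ε, hw, hmul⟩ := hhk.exists_mul_eq K
  have h3 : ∀ x ∈ LinearMap.ker (lagrangian Y c),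
      formalEvalHom (Y (Fin.last _) - Pi.single (some h) 1) x * formalEvalHom w x = 0 := by
    intro x hx
    have := hmul x
    rw [h2 l x hx, h2 _ x hx, mul_zero, add_zero] at this
    exact (mul_eq_zero.1 this).resolve_left two_ne_zero
  have hspec : ∀ j, ¬ ∀ x ∈ LinearMap.ker (lagrangian Y c),
      formalEvalHom (Y (Fin.last _) - Pi.single (some j) 1) x = 0 := by
    intro j hj
    obtain ⟨a, ha⟩ := hV.not_special (Fin.last _) j
    have := hj (fun t => V t a) (hL a)
    rw [show formalEvalHom (R := K) (Y (Fin.last _) - Pi.single (some j) 1) (fun t => V t a)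
      = formalEval (Y (Fin.last _) - Pi.single (some j) 1) (fun t => V t a) from rfl,
      formalEval_sub_left, formalEval_single] at this
    push_cast at this
    rw [one_mul, sub_eq_zero] at this
    exact ha this
  rcases forall_eq_zero_or_forall_eq_zero h3 with h4 | h4
  · exact hspec h h4
  · rcases hw with rfl | rfl
    · obtain ⟨a, ha⟩ := ne_of_isDualFamily hn hD hhk.1
      have := h4 (fun t => V t a) (hL a)
      rw [show ∀ w, formalEvalHom (R := K) w (fun t => V t a)
        = formalEval w (fun t => V t a) from fun _ => rfl,
        formalEval_sub_left, formalEval_single, formalEval_single] at this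
      push_cast at this
      rw [one_mul, one_mul, sub_eq_zero] at this
      exact ha this
    · exact hspec k h4

end core

/-! ### Standard parts and Lagrangians of rank one. -/

section ordered

open ArchimedeanClass

variable {K ι : Type*} [Field K] [LinearOrder K] [IsStrictOrderedRing K]

theorem stdPart_sum {s : Finset ι} {f : ι → K} (hf : ∀ i ∈ s, 0 ≤ mk (f i)) :
    0 ≤ mk (∑ i ∈ s, f i) ∧ stdPart (∑ i ∈ s, f i) = ∑ i ∈ s, stdPart (f i) := by
  classical
  induction s using Finset.induction_on with
  | empty => simp
  | insert a s ha ih =>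
    obtain ⟨h1, h2⟩ := ih fun i hi => hf i (Finset.mem_insert_of_mem hi)
    have h3 := hf a (Finset.mem_insert_self _ _)
    rw [Finset.sum_insert ha, Finset.sum_insert ha, ← h2]
    exact ⟨(le_min h3 h1).trans (min_le_mk_add _ _), stdPart_add h3 h1⟩

theorem mk_nonneg_of_abs_le_one {x : K} (hx : |x| ≤ 1) : 0 ≤ mk x := by
  rw [← mk_one (R := K), mk_le_mk]
  exact ⟨1, by simpa using hx⟩

variable [Algebra ℝ K]

/-- The real numbers in an ordered field, as an ordered ring homomorphism. -/
def realOrderHom (K : Type*) [Field K] [LinearOrder K] [IsStrictOrderedRing K] [Algebra ℝ K] :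
    ℝ →+*o K :=
  { algebraMap ℝ K with
    monotone' := by
      intro a b hab
      change algebraMap ℝ K a ≤ algebraMap ℝ K b
      rw [← sub_nonneg, ← map_sub, ← Real.mul_self_sqrt (sub_nonneg.2 hab), map_mul]
      exact mul_self_nonneg _ }

/-- The standard part of a combination of integer vectors is a real combination of them. -/
theorem exists_stdPart_eq_sum {κ : Type*} [Fintype κ] [Fintype ι] {x : ι → K} {M : κ → ι → ℤ}
    {s : κ → K} (hx : ∀ e, 0 ≤ mk (x e)) (h : ∀ e, x e = ∑ i, s i * M i e) :
    ∃ r : κ → ℝ, ∀ e, stdPart (x e) = ∑ i, r i * M i e := by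
  classical
  let W : Submodule ℝ (ι → ℝ) := Submodule.span ℝ (Set.range fun i e => (M i e : ℝ))
  by_cases hW : (fun e => stdPart (x e)) ∈ W
  · obtain ⟨r, hr⟩ := (Submodule.mem_span_range_iff_exists_fun ℝ).1 hW
    refine ⟨r, fun e => ?_⟩
    rw [← congrFun hr e]
    simp
  · exfalso
    -- A real functional that kills the integer vectors kills their K-combination x, hence its
    -- standard part.
    obtain ⟨φ, hφ, hφW⟩ := W.exists_dual_map_eq_bot_of_notMem hW inferInstance
    have hφs : ∀ y : ι → ℝ, φ y = ∑ e, φ (Pi.single e 1) * y e := by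
      intro y
      conv_lhs => rw [← Finset.univ_sum_single y]
      rw [map_sum]
      refine Finset.sum_congr rfl fun e _ => ?_
      rw [mul_comm, ← smul_eq_mul, ← map_smul, ← Pi.single_smul]
      simp
    have hφM : ∀ i, ∑ e, φ (Pi.single e 1) * M i e = 0 := by
      intro i
      rw [← hφs fun e => (M i e : ℝ)]
      have : φ (fun e => (M i e : ℝ)) ∈ W.map φ :=
        Submodule.mem_map_of_mem (Submodule.subset_span ⟨i, rfl⟩)
      rw [hφW] at this
      simpa using this
    have hr : ∀ r, 0 ≤ mk (algebraMap ℝ K r) := mk_map_nonneg_of_archimedean (realOrderHom K)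
    have h1 : ∑ e, algebraMap ℝ K (φ (Pi.single e 1)) * x e = 0 := by
      simp only [h, Finset.mul_sum]
      rw [Finset.sum_comm]
      refine Finset.sum_eq_zero fun i _ => ?_
      have := congrArg (algebraMap ℝ K) (hφM i)
      simp only [map_sum, map_mul, map_intCast, map_zero] at this
      rw [← mul_zero (s i), ← this, Finset.mul_sum]
      exact Finset.sum_congr rfl fun e _ => by ring
    have h2 : ∀ e, 0 ≤ mk (algebraMap ℝ K (φ (Pi.single e 1)) * x e) := fun e => by
      rw [mk_mul]; exact add_nonneg (hr _) (hx e)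
    have h3 := (stdPart_sum (s := Finset.univ) fun e _ => h2 e).2
    rw [h1, stdPart_zero] at h3
    apply hφ
    rw [hφs, h3]
    refine Finset.sum_congr rfl fun e _ => ?_
    rw [stdPart_mul (hr _) (hx e)]
    congr 1
    exact (stdPart_map_real (realOrderHom K) _).symm

end ordered

section core

variable {K I J : Type*} [Field K] [LinearOrder K] [IsStrictOrderedRing K] [Algebra ℝ K]
  [Fintype I] [Fintype J] [DecidableEq J] {n : ℕ} {Y : I → Option J → ℤ} {o : I}
  {V : Option J → Fin n → K} {D : J → Fin n → Derivation ℝ K K} {c : I → K}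

omit [LinearOrder K] [IsStrictOrderedRing K] [DecidableEq J] [Algebra ℝ K] in
theorem lagrangian_single [DecidableEq J] (t t' : Option J) :
    lagrangian Y c (Pi.single t' 1) t = ∑ i, (Y i none : K) * c i *
      ((Y i t * Y i t' - if t = t' then Y i t else 0 : ℤ) : K) := by
  rw [lagrangian_apply]
  refine Finset.sum_congr rfl fun i _ => ?_
  have h1 : formalEval (Y i) (Pi.single t' 1 : Option J → K) = Y i t' := by
    rw [formalEval, Finset.sum_eq_single t'] <;> simp +contextual
  rw [vertexMap_apply, h1]
  by_cases htt : t = t'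
  · subst htt; simp
  · simp [htt]

open ArchimedeanClass in
/-- If the Lagrangian has rank one then the values of the symbols have a real linear relation. -/
theorem exists_real_relation (hV : IsDegenerate Y o V)
    (hr : Module.finrank K (LinearMap.range (lagrangian Y c)) ≤ 1) (h0 : lagrangian Y c ≠ 0) :
    ∃ x : Option J → ℝ, x ≠ 0 ∧ ∀ a, ∑ t, algebraMap ℝ K (x t) * V t a = 0 := by
  set H := lagrangian Y c with hH
  obtain ⟨⟨w, hw⟩, hw'⟩ := finrank_le_one_iff.1 hr
  have hc : ∀ u, ∃ f : K, H u = f • w := fun u => by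
    obtain ⟨f, hf⟩ := hw' ⟨H u, u, rfl⟩
    exact ⟨f, (congrArg Subtype.val hf).symm⟩
  choose f hf using fun t' => hc (Pi.single t' 1)
  have hsymm : ∀ t t', f t' * w t = f t * w t' := by
    intro t t'
    have h1 : ∀ t t', H (Pi.single t' 1) t = f t' * w t := fun t t' => by
      rw [hf]; rfl
    rw [← h1, ← h1, hH, lagrangian_single, lagrangian_single]
    refine Finset.sum_congr rfl fun i _ => ?_
    by_cases htt : t = t'
    · subst htt; rfl
    · simp [htt, Ne.symm htt, mul_comm (Y i t : K)]
  -- Dividing by the largest entry of w makes all entries finite and one of them 1, so the standard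
  -- part exists and is nonzero.
  obtain ⟨t₀, ht₀⟩ := Finite.exists_max fun t => |w t|
  have hw0 : w t₀ ≠ 0 := by
    intro h
    apply h0
    have hw0 : w = 0 := by
      ext t
      have := ht₀ t
      rw [h, abs_zero] at this
      exact abs_eq_zero.1 (le_antisymm this (abs_nonneg _))
    refine LinearMap.ext fun u => ?_
    obtain ⟨g, hg⟩ := hc u
    rw [hg, hw0]
    simp
  have hft : ∀ t, f t = f t₀ / w t₀ * w t := fun t => by
    field_simp
    exact hsymm t₀ t
  have hf0 : f t₀ ≠ 0 := by
    intro h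
    apply h0
    ext t' t
    simp only [LinearMap.comp_apply, LinearMap.single_apply, LinearMap.zero_apply, Pi.zero_apply]
    rw [hf, hft, h]
    simp
  let ξ : Option J → K := fun t => w t / w t₀
  have hξ : ∀ t, 0 ≤ mk (ξ t) := fun t => by
    apply mk_nonneg_of_abs_le_one
    rw [abs_div]
    exact div_le_one_of_le₀ (ht₀ t) (abs_nonneg _)
  have hξ2 : ∀ e : Option J × Option J, ξ e.1 * ξ e.2
      = ∑ i, ((Y i none : K) * c i / (f t₀ * w t₀)) *
        ((Y i e.1 * Y i e.2 - if e.1 = e.2 then Y i e.1 else 0 : ℤ) : K) := by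
    intro e
    have h1 : H (Pi.single e.2 1) e.1 = f e.2 * w e.1 := by rw [hf]; rfl
    rw [hH, lagrangian_single, hft] at h1
    simp only [div_mul_eq_mul_div, ← Finset.sum_div, h1, ξ]
    field_simp
  obtain ⟨r, hr⟩ := exists_stdPart_eq_sum (ι := Option J × Option J)
    (M := fun i e => Y i e.1 * Y i e.2 - if e.1 = e.2 then Y i e.1 else 0)
    (fun e => by rw [mk_mul]; exact add_nonneg (hξ e.1) (hξ e.2)) hξ2
  refine ⟨fun t => stdPart (ξ t), fun h => ?_, ?_⟩
  · have := congrFun h t₀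
    simp [ξ, hw0] at this
  have hr' : ∀ t t', stdPart (ξ t) * stdPart (ξ t')
      = ∑ i, r i * ((Y i t * Y i t' - if t = t' then Y i t else 0 : ℤ) : ℝ) := fun t t' => by
    rw [← hr (t, t'), stdPart_mul (hξ _) (hξ _)]
  -- The real matrix x xᵀ is a real combination of the vertex forms, each of which vanishes on V
  -- after summing over a. A vanishing sum of squares in an ordered field gives the relation.
  have hsum : ∑ a, (∑ t, algebraMap ℝ K (stdPart (ξ t)) * V t a)
      * (∑ t, algebraMap ℝ K (stdPart (ξ t)) * V t a) = 0 := by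
    have h1 : ∀ a, (∑ t, algebraMap ℝ K (stdPart (ξ t)) * V t a)
        * (∑ t, algebraMap ℝ K (stdPart (ξ t)) * V t a)
        = ∑ i, algebraMap ℝ K (r i) * vertexForm (Y i) (fun t => V t a) (fun t => V t a) := by
      intro a
      rw [Finset.sum_mul_sum]
      have h2 : ∀ t t', algebraMap ℝ K (stdPart (ξ t)) * V t a *
          (algebraMap ℝ K (stdPart (ξ t')) * V t' a)
          = ∑ i, algebraMap ℝ K (r i) * (((Y i t : K) * Y i t' - if t = t' then (Y i t : K) else 0)
            * V t a * V t' a) := by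
        intro t t'
        have := congrArg (algebraMap ℝ K) (hr' t t')
        rw [map_mul, map_sum] at this
        rw [mul_mul_mul_comm, this, Finset.sum_mul]
        refine Finset.sum_congr rfl fun i _ => ?_
        rw [map_mul, map_intCast]
        split_ifs <;> push_cast <;> ring
      simp only [h2]
      simp only [fun t : Option J => Finset.sum_comm (s := (Finset.univ : Finset (Option J)))
        (t := (Finset.univ : Finset I)) (f := fun t' i => algebraMap ℝ K (r i) *
          (((Y i t : K) * Y i t' - if t = t' then (Y i t : K) else 0) * V t a * V t' a))]
      rw [Finset.sum_comm]
      refine Finset.sum_congr rfl fun i _ => ?_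
      simp only [← Finset.mul_sum]
      congr 1
      simp only [sub_mul, Finset.sum_sub_distrib, ite_mul, zero_mul, Finset.sum_ite_eq,
        Finset.mem_univ, if_true]
      rw [vertexForm, formalEval, Finset.sum_mul_sum]
      congr 1
      · exact Finset.sum_congr rfl fun t _ => Finset.sum_congr rfl fun t' _ => by ring
      · exact Finset.sum_congr rfl fun t _ => by ring
    simp only [h1]
    rw [Finset.sum_comm]
    refine Finset.sum_eq_zero fun i _ => ?_
    rw [← Finset.mul_sum, hV.quad i, mul_zero]
  intro a
  have := (Finset.sum_eq_zero_iff_of_nonneg fun a _ => mul_self_nonneg _).1 hsum a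
    (Finset.mem_univ _)
  exact mul_self_eq_zero.1 this

/-- A real linear relation contradicts the independence of the coordinates of the `v j`. -/
theorem false_of_real_relation [Nontrivial I] (hn : 1 ≤ n) (hY : IsFormalConfig Y)
    (hV : IsDegenerate Y o V) (hD : IsDualFamily D V) {x : Option J → ℝ} (hx0 : x ≠ 0)
    (hx : ∀ a, ∑ t, algebraMap ℝ K (x t) * V t a = 0) : False := by
  -- Without x the relation would concern the v_j alone, and the derivations, which kill ℝ, read off
  -- its coefficients.
  have hnone : x none ≠ 0 := by
    intro h
    apply hx0
    ext t
    cases t with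
    | none => exact h
    | some l =>
      have h1 := congrArg (D l ⟨0, hn⟩) (hx ⟨0, hn⟩)
      rw [Fintype.sum_option, h] at h1
      simp only [map_zero, zero_mul, zero_add, map_sum, Derivation.leibniz,
        Derivation.map_algebraMap, smul_zero, add_zero, hD l ⟨0, hn⟩] at h1
      simpa using h1
  have hnone' : algebraMap ℝ K (x none) ≠ 0 := by simpa using hnone
  have hVn : ∀ a, V none a = ∑ j, algebraMap ℝ K (-x (some j) / x none) * V (some j) a := by
    intro a
    have h1 := hx a
    rw [Fintype.sum_option] at h1
    have h2 : ∑ j, algebraMap ℝ K (-x (some j) / x none) * V (some j) a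
        = - (∑ j, algebraMap ℝ K (x (some j)) * V (some j) a) / algebraMap ℝ K (x none) := by
      rw [← Finset.sum_neg_distrib, Finset.sum_div]
      refine Finset.sum_congr rfl fun j _ => ?_
      rw [map_div₀, map_neg]
      ring
    rw [h2]
    field_simp
    linear_combination h1
  have hDV : ∀ (U : Option J → ℤ) (l : J) (b a : Fin n), D l b (formalEval U fun t => V t a)
      = if a = b then algebraMap ℝ K (U none * (-x (some l) / x none) + U (some l)) else 0 := by
    intro U l b a
    rw [derivation_formalEval, formalEval, Fintype.sum_option, hVn]
    simp only [map_sum, Derivation.leibniz, Derivation.map_algebraMap, smul_zero, add_zero,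
      hD l b]
    by_cases hab : a = b <;> simp [hab]
  have hzero : ∀ (U : Option J → ℤ),
      (∀ l, (U none * (-x (some l) / x none) + U (some l) : ℝ) = 0) →
      ∀ a, formalEval U (fun t => V t a) = 0 := by
    intro U hU a
    rw [formalEval, Fintype.sum_option, hVn, Finset.mul_sum, ← Finset.sum_add_distrib]
    refine Finset.sum_eq_zero fun j _ => ?_
    have := congrArg (algebraMap ℝ K) (hU j)
    rw [map_add, map_mul, map_intCast, map_intCast, map_zero] at this
    rw [← mul_assoc, ← add_mul, this, zero_mul]
  obtain ⟨G, hG, hGe⟩ := hY.conn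
  obtain ⟨i, l, hil⟩ : ∃ i l, G.Adj i l := ⟨o, hG.preconnected.exists_adj_of_nontrivial o⟩
  obtain ⟨h, k, hhk⟩ := hGe i l hil
  obtain ⟨w, ε, hw, hmul⟩ := hhk.exists_mul_eq K
  have hsp : ∀ j, ¬ ∀ a, formalEval (Y i - Pi.single (some j) 1) (fun t => V t a) = 0 := by
    intro j hj
    obtain ⟨a, ha⟩ := hV.not_special i j
    have := hj a
    rw [formalEval_sub_left, formalEval_single] at this
    push_cast at this
    rw [one_mul, sub_eq_zero] at this
    exact ha this
  have hspw : ¬ ∀ a, formalEval w (fun t => V t a) = 0 := by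
    rcases hw with rfl | rfl
    · intro hj
      obtain ⟨a, ha⟩ := ne_of_isDualFamily hn hD hhk.1
      have := hj a
      rw [formalEval_sub_left, formalEval_single, formalEval_single] at this
      push_cast at this
      rw [one_mul, one_mul, sub_eq_zero] at this
      exact ha this
    · exact hsp k
  set u := Y i - Pi.single (some h) 1
  have huw : ∑ a, formalEval u (fun t => V t a) * formalEval w (fun t => V t a) = 0 := by
    have h1 : 2 * ∑ a, formalEval u (fun t => V t a) * formalEval w (fun t => V t a) = 0 := by
      rw [Finset.mul_sum, Finset.sum_congr rfl fun a _ => hmul _, Finset.sum_add_distrib,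
        ← Finset.mul_sum, hV.quad, hV.quad, mul_zero, add_zero]
    simpa using h1
  have hu : ∃ l, (u none * (-x (some l) / x none) + u (some l) : ℝ) ≠ 0 := by
    by_contra! hh
    exact hsp h (hzero _ hh)
  obtain ⟨l', hl'⟩ := hu
  set α : ℝ := u none * (-x (some l') / x none) + u (some l')
  set β : ℝ := w none * (-x (some l') / x none) + w (some l')
  -- All points are now real combinations of the v_j. Moving coordinate b of v_{l'} changes u by α
  -- and w by β, and the orthogonality of u and w must persist. So u and w are proportional as well
  -- as orthogonal, and one of them is 0.
  have hlin : ∀ b, algebraMap ℝ K β * formalEval u (fun t => V t b)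
      + algebraMap ℝ K α * formalEval w (fun t => V t b) = 0 := by
    intro b
    have h1 := congrArg (D l' b) huw
    simp only [map_sum, map_zero, Derivation.leibniz, hDV, smul_eq_mul, mul_ite, mul_zero,
      Finset.sum_add_distrib, Finset.sum_ite_eq', Finset.mem_univ, if_true] at h1
    linear_combination h1
  have hα : algebraMap ℝ K α ≠ 0 := by simpa using hl'
  by_cases hβ : algebraMap ℝ K β = 0
  · apply hspw
    intro a
    have := hlin a
    rw [hβ, zero_mul, zero_add] at this
    exact (mul_eq_zero.1 this).resolve_left hα
  · have hs : ∑ a, formalEval u (fun t => V t a) * formalEval u (fun t => V t a) = 0 := by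
      have : algebraMap ℝ K β * ∑ a, formalEval u (fun t => V t a) * formalEval u (fun t => V t a)
          = 0 := by
        rw [Finset.mul_sum]
        have h2 : ∀ a, algebraMap ℝ K β *
            (formalEval u (fun t => V t a) * formalEval u (fun t => V t a))
            = -algebraMap ℝ K α * (formalEval u (fun t => V t a) * formalEval w (fun t => V t a)) :=
          fun a => by linear_combination formalEval u (fun t => V t a) * hlin a
        rw [Finset.sum_congr rfl fun a _ => h2 a, ← Finset.mul_sum, huw, mul_zero]
      exact (mul_eq_zero.1 this).resolve_left hβ
    apply hsp h
    intro a
    have := (Finset.sum_eq_zero_iff_of_nonneg fun a _ => mul_self_nonneg _).1 hs a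
      (Finset.mem_univ _)
    exact mul_self_eq_zero.1 this

end core

/-- Vectors with algebraically independent coordinates have no degenerate configuration. -/
theorem not_isDegenerate_of_algebraicIndependent {K J : Type} [Field K] [LinearOrder K]
    [IsStrictOrderedRing K] [Algebra ℝ K] [Fintype J] [DecidableEq J] {n m : ℕ} (hn : 1 ≤ n)
    (hmn : m ≤ n) {Y : Fin (m + 2) → Option J → ℤ} {V : Option J → Fin n → K}
    (hY : IsFormalConfig Y) (hV : AlgebraicIndependent ℝ fun q : J × Fin n => V (some q.1) q.2) :
    ¬ IsDegenerate Y (Fin.last _) V := by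
  intro hdeg
  choose D hD using fun (l : J) (b : Fin n) =>
    exists_derivation_of_algebraicIndependent hV fun q => if q.1 = l ∧ q.2 = b then 1 else 0
  have hD' : IsDualFamily D V := fun l b j a => hD l b (j, a)
  obtain ⟨c, hc, hc', ho⟩ := hdeg.dep
  obtain ⟨x, hx0, hx⟩ := exists_real_relation hdeg
    (finrank_range_lagrangian_le_one hY hn hmn hdeg hD' hc hc' ho)
    (lagrangian_ne_zero hY hdeg (fun x hx => by
      ext a
      have := (Finset.sum_eq_zero_iff_of_nonneg fun a _ => mul_self_nonneg _).1 hx a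
        (Finset.mem_univ _)
      exact mul_self_eq_zero.1 this) hc hc' ho)
  exact false_of_real_relation hn hY hdeg hD' hx0 hx

/-! ### Transfer to generic integral vectors by an ultrapower. -/

open Filter in
-- All clauses hold pointwise along the filter. The form `c o = 0 → c = 0` of uniqueness is what
-- transfers directly, with no division.
theorem IsDegenerate.of_eventually {I J K : Type*} [Fintype I] [Fintype J] [CommRing K] {n : ℕ}
    {l : Filter ℕ} [l.NeBot] {π : (ℕ → ℝ) →+* K} (hsurj : Function.Surjective π)
    (hπ : ∀ f, π f = 0 ↔ ∀ᶠ N in l, f N = 0) {Y : I → Option J → ℤ} {o : I}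
    {V : ℕ → Option J → Fin n → ℝ} (h : ∀ N, IsDegenerate Y o (V N)) :
    IsDegenerate Y o fun t a => π fun N => V N t a := by
  have hfe : ∀ i a, formalEval (Y i) (fun t => π fun N => V N t a)
      = π fun N => formalEval (Y i) fun t => V N t a := fun i a => by
    rw [formalEval_map π]
    congr 1
    ext N
    exact (formalEval_map (Pi.evalRingHom (fun _ : ℕ => ℝ) N) (Y i) fun t N => V N t a).symm
  have hsum : ∀ (c : I → ℕ → ℝ) a,
      ∑ i, π (c i) * formalEval (Y i) (fun t => π fun N => V N t a)
        = π fun N => ∑ i, c i N * formalEval (Y i) fun t => V N t a := fun c a => by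
    simp only [hfe, ← map_mul, ← map_sum]
    congr 1
    ext N
    simp
  have hsum' : ∀ c : I → ℕ → ℝ, ∑ i, π (c i) = π fun N => ∑ i, c i N := fun c => by
    rw [← map_sum]
    congr 1
    ext N
    simp
  constructor
  · intro i
    have h1 : ∀ a, vertexForm (Y i) (fun t => π fun N => V N t a) (fun t => π fun N => V N t a)
        = π fun N => vertexForm (Y i) (fun t => V N t a) (fun t => V N t a) := fun a => by
      rw [vertexForm_map π]
      congr 1
      ext N
      exact (vertexForm_map (Pi.evalRingHom (fun _ : ℕ => ℝ) N) (Y i) (fun t N => V N t a)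
        (fun t N => V N t a)).symm
    simp only [h1, ← map_sum]
    rw [hπ]
    exact Eventually.of_forall fun N => by simpa using (h N).quad i
  · intro i j
    by_contra! hh
    have h1 : ∀ a, ∀ᶠ N in l, formalEval (Y i) (fun t => V N t a) - V N (some j) a = 0 :=
        fun a => by
      rw [← hπ fun N => formalEval (Y i) (fun t => V N t a) - V N (some j) a]
      have := hh a
      rw [hfe, ← sub_eq_zero, ← map_sub] at this
      exact this
    obtain ⟨N, hN⟩ := (eventually_all.2 h1).exists
    obtain ⟨a, ha⟩ := (h N).not_special i j
    exact ha (sub_eq_zero.1 (hN a))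
  · intro c hc hc' ho
    choose d hd using fun i => hsurj (c i)
    obtain rfl : c = fun i => π (d i) := funext fun i => (hd i).symm
    rw [hsum', hπ] at hc
    simp only [hsum, hπ] at hc'
    rw [hπ] at ho
    ext i
    refine (hπ _).2 ?_
    filter_upwards [hc, eventually_all.2 hc', ho] with N h1 h2 h3
    exact congrFun ((h N).indep (fun i => d i N) h1 h2 h3) i
  · choose c hc using fun N => (h N).dep
    refine ⟨fun i => π fun N => c N i, ?_, fun a => ?_, ?_⟩
    · rw [hsum', hπ]
      exact Eventually.of_forall fun N => (hc N).1
    · rw [hsum, hπ]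
      exact Eventually.of_forall fun N => (hc N).2.1 a
    · rw [← map_one π]
      exact congrArg π (funext fun N => (hc N).2.2)

/-- The integral zeros of a nonzero real polynomial are zeros of a nonzero integral polynomial. -/
theorem exists_int_mvPolynomial {σ : Type*} {P : MvPolynomial σ ℝ} (hP : P ≠ 0) :
    ∃ Q : MvPolynomial σ ℤ, Q ≠ 0 ∧ ∀ v : σ → ℤ,
      MvPolynomial.eval (fun q => (v q : ℝ)) P = 0 → MvPolynomial.eval v Q = 0 := by
  obtain ⟨s, hs⟩ := MvPolynomial.ne_zero_iff.1 hP
  -- A ℚ-linear functional applied to the coefficients commutes with evaluation at integral points;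
  -- denominators are cleared afterwards.
  obtain ⟨φ, hφ⟩ : ∃ φ : Module.Dual ℚ ℝ, φ (P.coeff s) ≠ 0 := by
    by_contra! hh
    exact hs ((Module.forall_dual_apply_eq_zero_iff ℚ _).1 hh)
  classical
  obtain ⟨b, hb⟩ := IsLocalization.exist_integer_multiples_of_finset (nonZeroDivisors ℤ)
    (P.support.image fun t => φ (P.coeff t))
  have hb' : ∀ t, ∃ g : ℤ, t ∈ P.support → (g : ℚ) = b * φ (P.coeff t) := by
    intro t
    by_cases ht : t ∈ P.support
    · obtain ⟨g, hg⟩ := hb _ (Finset.mem_image_of_mem _ ht)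
      exact ⟨g, fun _ => by simpa using hg⟩
    · exact ⟨0, fun h => absurd h ht⟩
  choose g hg using hb'
  refine ⟨∑ t ∈ P.support, MvPolynomial.monomial t (g t), fun h => ?_, fun v hv => ?_⟩
  · have h1 := congrArg (MvPolynomial.coeff s) h
    have hsupp : s ∈ P.support := MvPolynomial.mem_support_iff.2 hs
    simp only [MvPolynomial.coeff_sum, MvPolynomial.coeff_monomial, Finset.sum_ite_eq', hsupp,
      if_true, MvPolynomial.coeff_zero] at h1
    have h2 := hg s hsupp
    rw [h1] at h2
    have hb0 : ((b : ℤ) : ℚ) ≠ 0 := by exact_mod_cast nonZeroDivisors.coe_ne_zero b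
    exact mul_ne_zero hb0 hφ (by rw [← h2]; simp)
  · have h1 : ((MvPolynomial.eval v (∑ t ∈ P.support, MvPolynomial.monomial t (g t)) : ℤ) : ℚ)
        = b * φ (MvPolynomial.eval (fun q => (v q : ℝ)) P) := by
      rw [MvPolynomial.eval_eq (fun q => (v q : ℝ)), map_sum, map_sum, Finset.mul_sum]
      push_cast
      refine Finset.sum_congr rfl fun t ht => ?_
      rw [MvPolynomial.eval_monomial]
      push_cast
      rw [hg t ht, mul_assoc]
      congr 1
      have h2 : P.coeff t * ∏ i ∈ t.support, (v i : ℝ) ^ t i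
          = ((∏ i ∈ t.support, v i ^ t i : ℤ) : ℚ) • P.coeff t := by
        rw [Rat.smul_def]
        push_cast
        ring
      rw [h2, map_smul, smul_eq_mul, mul_comm]
      congr 1
      rw [Finsupp.prod]
      push_cast
      rfl
    rw [hv, map_zero, mul_zero] at h1
    exact_mod_cast h1

open Filter in
/-- For generic vectors `v j` there is no degenerate configuration with given formal points. -/
theorem exists_resonance {n m p : ℕ} (hn : 1 ≤ n) (hmn : m ≤ n)
    {Y : Fin (m + 2) → Option (Fin p) → ℤ} (hY : IsFormalConfig Y) :
    ∃ R : MvPolynomial (Fin p × Fin n) ℤ, R ≠ 0 ∧ ∀ v : Fin p → Fin n → ℤ,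
      MvPolynomial.eval (fun q => v q.1 q.2) R ≠ 0 →
      ∀ V : Option (Fin p) → Fin n → ℝ, (∀ j a, V (some j) a = v j a) →
        ¬ IsDegenerate Y (Fin.last _) V := by
  by_contra! hh
  have hcount : Countable (MvPolynomial (Fin p × Fin n) ℤ) := by
    rw [← Cardinal.mk_le_aleph0_iff]
    refine MvPolynomial.cardinalMk_le_max.trans ?_
    exact max_le (max_le Cardinal.mk_le_aleph0 Cardinal.mk_le_aleph0) le_rfl
  obtain ⟨e, he⟩ := exists_surjective_nat (MvPolynomial (Fin p × Fin n) ℤ)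
  classical
  choose! v hv V hVv hdeg using hh
  -- A point where `R N` does not vanish is a zero of none of the nonzero polynomials among the
  -- first N + 1. So the v_j of the ultrapower avoid every nonzero integral polynomial.
  let R : ℕ → MvPolynomial (Fin p × Fin n) ℤ := fun N =>
    ∏ i ∈ Finset.range (N + 1), if e i = 0 then 1 else e i
  have hR : ∀ N, R N ≠ 0 := fun N => Finset.prod_ne_zero_iff.2 fun i _ => by
    split_ifs with h
    · exact one_ne_zero
    · exact h
  let l : Filter ℕ := (hyperfilter ℕ : Filter ℕ)
  let π : (ℕ → ℝ) →+* Germ l ℝ := Germ.coeRingHom l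
  have hπ : ∀ f, π f = 0 ↔ ∀ᶠ N in l, f N = 0 := fun f => Germ.coe_eq
  let W : Option (Fin p) → Fin n → Germ l ℝ := fun t a => π fun N => V (R N) t a
  let : Algebra ℝ (Germ l ℝ) := (π.comp (Pi.constRingHom ℕ ℝ)).toAlgebra
  have hW : IsDegenerate Y (Fin.last _) W :=
    IsDegenerate.of_eventually (l := l) (π := π) Quot.exists_rep hπ fun N => hdeg (R N) (hR N)
  refine not_isDegenerate_of_algebraicIndependent hn hmn hY (V := W) ?_ hW
  rw [algebraicIndependent_iff]
  intro P hP
  by_contra hP0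
  obtain ⟨Q, hQ0, hQ⟩ := exists_int_mvPolynomial hP0
  obtain ⟨i, hi⟩ := he Q
  have h1 : ∀ᶠ N in l, MvPolynomial.eval (fun q => (v (R N) q.1 q.2 : ℝ)) P = 0 := by
    rw [← hπ, ← hP, MvPolynomial.aeval_def, MvPolynomial.eval₂_eq]
    have : (fun N => MvPolynomial.eval (fun q : Fin p × Fin n => (v (R N) q.1 q.2 : ℝ)) P)
        = ∑ d ∈ P.support, Pi.constRingHom ℕ ℝ (P.coeff d) *
          ∏ i ∈ d.support, (fun N => V (R N) (some i.1) i.2) ^ d i := by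
      ext N
      rw [MvPolynomial.eval_eq]
      simp [hVv _ (hR N)]
    rw [this, map_sum]
    refine Finset.sum_congr rfl fun d _ => ?_
    rw [map_mul, map_prod]
    simp only [map_pow]
    rfl
  have h2 : ∀ᶠ N in l, i ≤ N := Nat.hyperfilter_le_atTop (eventually_ge_atTop i)
  obtain ⟨N, hN1, hN2⟩ := (h1.and h2).exists
  apply hv (R N) (hR N)
  rw [map_prod]
  refine Finset.prod_eq_zero (Finset.mem_range.2 (Nat.lt_succ_of_le hN2)) ?_
  rw [if_neg (by rw [hi]; exact hQ0), hi]
  exact hQ (fun q => v (R N) q.1 q.2) hN1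

/-! ### The finite list of resonances and the reduction to few indices. -/

open MvPolynomial in
/-- The resonances that exclude all degenerate configurations. -/
theorem exists_config_resonances (n : ℕ) (hn : 1 ≤ n) :
    ∃ res : Finset (Σ p : ℕ, MvPolynomial (Fin p × Fin n) ℤ),
      (∀ P ∈ res, P.1 ≤ 2 * (n + 1) ∧ P.2 ≠ 0) ∧
      ∀ p m : ℕ, p ≤ 2 * (n + 1) → m ≤ n → ∀ Y : Fin (m + 2) → Option (Fin p) → ℤ,
        IsFormalConfig Y → (∀ i t, |Y i t| ≤ n + 2) → ∃ R, ⟨p, R⟩ ∈ res ∧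
          ∀ v : Fin p → Fin n → ℤ, eval (fun q => v q.1 q.2) R ≠ 0 →
          ∀ V : Option (Fin p) → Fin n → ℝ, (∀ j a, V (some j) a = v j a) →
            ¬ IsDegenerate Y (Fin.last _) V := by
  classical
  have h : ∀ (p m : ℕ) (Y : Fin (m + 2) → Option (Fin p) → ℤ),
      ∃ R : MvPolynomial (Fin p × Fin n) ℤ, m ≤ n → IsFormalConfig Y → R ≠ 0 ∧
        ∀ v : Fin p → Fin n → ℤ, eval (fun q => v q.1 q.2) R ≠ 0 →
        ∀ V : Option (Fin p) → Fin n → ℝ, (∀ j a, V (some j) a = v j a) →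
          ¬ IsDegenerate Y (Fin.last _) V := by
    intro p m Y
    by_cases hY : m ≤ n ∧ IsFormalConfig Y
    · obtain ⟨R, hR⟩ := exists_resonance hn hY.1 hY.2
      exact ⟨R, fun _ _ => hR⟩
    -- This value never enters the list: only formal configurations with m ≤ n are used.
    · exact ⟨0, fun h1 h2 => absurd ⟨h1, h2⟩ hY⟩
  choose R hR using h
  let B : ∀ p m : ℕ, Finset (Fin (m + 2) → Option (Fin p) → ℤ) := fun p m =>
    (Fintype.piFinset fun _ => Fintype.piFinset fun _ => Finset.Icc (-(n + 2 : ℤ)) (n + 2)).filter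
      fun Y => IsFormalConfig Y
  refine ⟨(Finset.range (2 * (n + 1) + 1)).biUnion fun p => (Finset.range (n + 1)).biUnion fun m =>
    (B p m).image fun Y => ⟨p, R p m Y⟩, ?_, ?_⟩
  · intro P hP
    simp only [Finset.mem_biUnion, Finset.mem_range, Finset.mem_image] at hP
    obtain ⟨p, hp, m, hm, Y, hY, rfl⟩ := hP
    exact ⟨by dsimp only; omega, (hR p m Y (by omega) (Finset.mem_filter.1 hY).2).1⟩
  · intro p m hp hm Y hY hb
    refine ⟨R p m Y, ?_, (hR p m Y hm hY).2⟩
    simp only [Finset.mem_biUnion, Finset.mem_range, Finset.mem_image]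
    refine ⟨p, by omega, m, by omega, Y, Finset.mem_filter.2 ⟨?_, hY⟩, rfl⟩
    simp only [Fintype.mem_piFinset, Finset.mem_Icc]
    exact fun i t => abs_le.1 (hb i t)

open MvPolynomial in
/-- The resonances that exclude short linear relations between first coordinates. -/
theorem exists_linear_resonances (n : ℕ) (hn : 1 ≤ n) :
    ∃ res : Finset (Σ p : ℕ, MvPolynomial (Fin p × Fin n) ℤ),
      (∀ P ∈ res, P.1 ≤ 2 * (n + 1) ∧ P.2 ≠ 0) ∧
      ∀ p ≤ 4, ∀ c : Fin p → ℤ, c ≠ 0 → (∀ i, |c i| ≤ 2) → ∃ R, ⟨p, R⟩ ∈ res ∧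
          ∀ v : Fin p → Fin n → ℤ, eval (fun q => v q.1 q.2) R = ∑ i, c i * v i ⟨0, hn⟩ := by
  classical
  let R : ∀ p : ℕ, (Fin p → ℤ) → MvPolynomial (Fin p × Fin n) ℤ := fun p c =>
    ∑ i, C (c i) * X (i, ⟨0, hn⟩)
  have hR : ∀ p c (v : Fin p → Fin n → ℤ), eval (fun q => v q.1 q.2) (R p c)
      = ∑ i, c i * v i ⟨0, hn⟩ := fun p c v => by simp [R]
  let B : ∀ p : ℕ, Finset (Fin p → ℤ) := fun p =>
    (Fintype.piFinset fun _ => Finset.Icc (-2 : ℤ) 2).filter fun c => c ≠ 0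
  refine ⟨(Finset.range 5).biUnion fun p => (B p).image fun c => ⟨p, R p c⟩, ?_, ?_⟩
  · intro P hP
    simp only [Finset.mem_biUnion, Finset.mem_range, Finset.mem_image] at hP
    obtain ⟨p, hp, c, hc, rfl⟩ := hP
    refine ⟨by dsimp only; omega, fun h => (Finset.mem_filter.1 hc).2 ?_⟩
    ext i
    have := hR p c fun j _ => if j = i then 1 else 0
    dsimp only at h
    rw [h] at this
    simpa using this.symm
  · intro p hp c hc hb
    refine ⟨R p c, ?_, hR p c⟩
    simp only [Finset.mem_biUnion, Finset.mem_range, Finset.mem_image]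
    refine ⟨p, by omega, c, Finset.mem_filter.2 ⟨?_, hc⟩, rfl⟩
    simp only [Fintype.mem_piFinset, Finset.mem_Icc]
    exact fun i => abs_le.1 (hb i)

open MvPolynomial in
/-- The resonance that excludes right angles. -/
theorem exists_angle_resonance (n : ℕ) (hn : 1 ≤ n) :
    ∃ R : MvPolynomial (Fin 3 × Fin n) ℤ, R ≠ 0 ∧ ∀ v : Fin 3 → Fin n → ℤ,
      eval (fun q => v q.1 q.2) R = dotProduct (v 0 - v 1) (v 0 - v 2) := by
  have hR : ∀ v : Fin 3 → Fin n → ℤ, eval (fun q => v q.1 q.2)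
      (∑ a, (X (0, a) - X (1, a)) * (X (0, a) - X (2, a)) : MvPolynomial (Fin 3 × Fin n) ℤ)
      = dotProduct (v 0 - v 1) (v 0 - v 2) := fun v => by simp [dotProduct]
  refine ⟨_, fun h => ?_, hR⟩
  -- At v_0 = (1, …, 1) and v_1 = v_2 = 0 the value is n ≥ 1.
  have := hR fun i _ => if i = 0 then 1 else 0
  rw [h] at this
  simp [dotProduct] at this
  omega

/-- A finite set of indices is the range of an embedding of some `Fin p`. -/
theorem exists_embedding_of_support {m : ℕ} (S : Finset (Fin m)) :
    ∃ s : Fin S.card ↪ Fin m, ∀ j ∈ S, ∃ i, s i = j :=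
  ⟨S.equivFin.symm.toEmbedding.trans (Function.Embedding.subtype _), fun j hj =>
    ⟨S.equivFin ⟨j, hj⟩, by simp⟩⟩

theorem sum_comp_embedding {M : Type*} [AddCommMonoid M] {p m : ℕ} (s : Fin p ↪ Fin m)
    (f : Fin m → M) (hf : ∀ j, (∀ i, s i ≠ j) → f j = 0) : ∑ i, f (s i) = ∑ j, f j := by
  rw [← Finset.sum_map Finset.univ s f]
  refine Finset.sum_subset (Finset.subset_univ _) fun j _ hj => hf j fun i hi => hj ?_
  rw [Finset.mem_map]
  exact ⟨i, Finset.mem_univ _, hi⟩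

section reindex

variable {m p : ℕ} (s : Fin p ↪ Fin m) {Y : Option (Fin m) → ℤ}

theorem sum_option_map {M : Type*} [AddCommMonoid M] (f : Option (Fin m) → M)
    (hf : ∀ j, (∀ i, s i ≠ j) → f (some j) = 0) : ∑ t, f (Option.map s t) = ∑ t, f t := by
  rw [Fintype.sum_option, Fintype.sum_option]
  simp only [Option.map_none, Option.map_some]
  rw [sum_comp_embedding s (fun j => f (some j)) hf]

theorem formalEval_reindex {R : Type*} [CommRing R] (hY : ∀ j, (∀ i, s i ≠ j) → Y (some j) = 0)
    (u : Option (Fin m) → R) :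
    formalEval (fun t => Y (Option.map s t)) (fun t => u (Option.map s t)) = formalEval Y u :=
  sum_option_map s (fun t => (Y t : R) * u t) fun j hj => by simp [hY j hj]

theorem vertexForm_reindex {R : Type*} [CommRing R] (hY : ∀ j, (∀ i, s i ≠ j) → Y (some j) = 0)
    (u w : Option (Fin m) → R) :
    vertexForm (fun t => Y (Option.map s t)) (fun t => u (Option.map s t))
      (fun t => w (Option.map s t)) = vertexForm Y u w := by
  rw [vertexForm, vertexForm, formalEval_reindex s hY, formalEval_reindex s hY]
  congr 1
  exact sum_option_map s (fun t => (Y t : R) * (u t * w t)) fun j hj => by simp [hY j hj]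

theorem IsFormalEdge.reindex {Y' : Option (Fin m) → ℤ}
    (hY : ∀ j, (∀ i, s i ≠ j) → Y (some j) = 0) (hY' : ∀ j, (∀ i, s i ≠ j) → Y' (some j) = 0)
    {h k : Fin m} (H : IsFormalEdge h k Y Y') :
    ∃ h' k', IsFormalEdge h' k' (fun t => Y (Option.map s t)) fun t => Y' (Option.map s t) := by
  have hsingle : ∀ i, (fun t => (Pi.single (some (s i)) 1 : Option (Fin m) → ℤ) (Option.map s t))
      = Pi.single (some i) 1 := fun i => by
    ext t
    cases t with
    | none => simp
    | some j => simp [Pi.single_apply]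
  have hk : ∃ k', s k' = k := by
    by_contra! hh
    rcases H.2 with H2 | H2
    · have := congrFun H2 (some k)
      simp [hY k hh, hY' k hh, H.1.symm] at this
    · have := congrFun H2 (some k)
      simp [hY k hh, hY' k hh, H.1.symm] at this
  have hh : ∃ h', s h' = h := by
    by_contra! hh
    rcases H.2 with H2 | H2
    · have := congrFun H2 (some h)
      simp [hY h hh, hY' h hh, H.1] at this
    · have := congrFun H2 (some h)
      simp [hY h hh, hY' h hh, H.1] at this
  obtain ⟨k', rfl⟩ := hk
  obtain ⟨h', rfl⟩ := hh
  refine ⟨h', k', fun h => H.1 (congrArg s h), ?_⟩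
  rw [← hsingle, ← hsingle]
  rcases H.2 with H2 | H2
  · left
    ext t
    exact congrFun H2 (Option.map s t)
  · right
    ext t
    exact congrFun H2 (Option.map s t)

theorem IsFormalConfig.reindex {I : Type*} {Y : I → Option (Fin m) → ℤ} (H : IsFormalConfig Y)
    (hY : ∀ i j, (∀ l, s l ≠ j) → Y i (some j) = 0) :
    IsFormalConfig fun i t => Y i (Option.map s t) where
  sign := H.sign
  mass i := by
    rw [sum_option_map s (Y i) (hY i)]
    exact H.mass i
  inj i l hil := H.inj <| by
    ext t
    cases t with
    | none => exact congrFun hil none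
    | some j =>
      by_cases hj : ∃ l, s l = j
      · obtain ⟨j, rfl⟩ := hj
        exact congrFun hil (some j)
      · push Not at hj
        rw [hY i j hj, hY l j hj]
  conn := by
    obtain ⟨G, hG, hGe⟩ := H.conn
    refine ⟨G, hG, fun i l hil => ?_⟩
    obtain ⟨h, k, hhk⟩ := hGe i l hil
    exact hhk.reindex s (hY i) (hY l)

theorem IsDegenerate.reindex {I K : Type*} [Fintype I] [CommRing K] {n : ℕ}
    {Y : I → Option (Fin m) → ℤ} {o : I} {V : Option (Fin m) → Fin n → K}
    (H : IsDegenerate Y o V) (hY : ∀ i j, (∀ l, s l ≠ j) → Y i (some j) = 0) :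
    IsDegenerate (fun i t => Y i (Option.map s t)) o fun t => V (Option.map s t) := by
  have h1 : ∀ i a, formalEval (fun t => Y i (Option.map s t)) (fun t => V (Option.map s t) a)
      = formalEval (Y i) fun t => V t a := fun i a =>
    formalEval_reindex s (hY i) fun t => V t a
  have h2 : ∀ i a, vertexForm (fun t => Y i (Option.map s t)) (fun t => V (Option.map s t) a)
      (fun t => V (Option.map s t) a) = vertexForm (Y i) (fun t => V t a) fun t => V t a :=
    fun i a => vertexForm_reindex s (hY i) (fun t => V t a) fun t => V t a
  constructor
  · simpa only [h2] using H.quad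
  · intro i j
    simpa only [h1] using! H.not_special i (s j)
  · simpa only [h1] using H.indep
  · simpa only [h1] using H.dep

end reindex

/-! ### Growing a connected set of points in a component. -/

/-- The point given by a formal point when the symbols take the values `V`. -/
def formalPoint {R ι : Type*} [CommRing R] [Fintype ι] {n : ℕ} (Y : ι → ℤ) (V : ι → Fin n → R) :
    Fin n → R :=
  fun a => formalEval Y fun t => V t a

section formalPoint

variable {R ι : Type*} [CommRing R] [Fintype ι] {n : ℕ}

theorem formalPoint_add (Y Y' : ι → ℤ) (V : ι → Fin n → R) :
    formalPoint (Y + Y') V = formalPoint Y V + formalPoint Y' V :=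
  funext fun _ => formalEval_add_left _ _ _

theorem formalPoint_sub (Y Y' : ι → ℤ) (V : ι → Fin n → R) :
    formalPoint (Y - Y') V = formalPoint Y V - formalPoint Y' V :=
  funext fun _ => formalEval_sub_left _ _ _

theorem formalPoint_single [DecidableEq ι] (t : ι) (V : ι → Fin n → R) :
    formalPoint (Pi.single t 1) V = V t :=
  funext fun a => by rw [formalPoint, formalEval_single]; simp

theorem sum_vertexForm_eq (Y : ι → ℤ) (V : ι → Fin n → R) :
    ∑ a, vertexForm Y (fun t => V t a) (fun t => V t a)
      = dotProduct (formalPoint Y V) (formalPoint Y V)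
        - formalEval Y fun t => dotProduct (V t) (V t) := by
  simp only [vertexForm, Finset.sum_sub_distrib, dotProduct, formalPoint, formalEval,
    Finset.mul_sum]
  congr 1
  exact Finset.sum_comm

end formalPoint

theorem IsFormalEdge.symm {J : Type*} [DecidableEq J] {h k : J} {Y Y' : Option J → ℤ}
    (H : IsFormalEdge h k Y Y') : IsFormalEdge k h Y' Y := by
  refine ⟨H.1.symm, H.2.imp (fun h => ?_) fun h => ?_⟩
  · rw [← neg_sub, h, neg_sub]
  · rw [add_comm, h, add_comm]

/-- The graph of the formal edges between formal points. -/
def formalGraph {I J : Type*} [DecidableEq J] (Y : I → Option J → ℤ) : SimpleGraph I where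
  Adj i l := i ≠ l ∧ ∃ h k, IsFormalEdge h k (Y i) (Y l)
  symm := ⟨fun _ _ H => ⟨H.1.symm, let ⟨h, k, hk⟩ := H.2; ⟨k, h, hk.symm⟩⟩⟩
  loopless := ⟨fun _ H => H.1 rfl⟩

/-- Adding a formal point that is joined to one of the given ones. -/
theorem IsFormalConfig.snoc {J : Type*} [Fintype J] [DecidableEq J] {k : ℕ}
    {Y : Fin (k + 1) → Option J → ℤ} (H : IsFormalConfig Y) {Y' : Option J → ℤ}
    (hY' : ∀ i, Y i ≠ Y') {i : Fin (k + 1)} {h l : J} (he : IsFormalEdge h l (Y i) Y') :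
    IsFormalConfig (Fin.snoc (α := fun _ => Option J → ℤ) Y Y') where
  sign a := by
    refine Fin.lastCases ?_ (fun a => ?_) a
    · rw [Fin.snoc_last]
      rcases he.2 with h2 | h2
      · have := congrFun h2 none
        simp only [Pi.sub_apply, reduceCtorEq, ne_eq, not_false_eq_true, Pi.single_eq_of_ne,
          sub_zero] at this
        rw [sub_eq_zero.1 this]
        exact H.sign i
      · have := congrFun h2 none
        simp only [Pi.add_apply, reduceCtorEq, ne_eq, not_false_eq_true, Pi.single_eq_of_ne,
          add_zero] at this
        rcases H.sign i with h3 | h3 <;> omega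
    · rw [Fin.snoc_castSucc]
      exact H.sign a
  mass a := by
    refine Fin.lastCases ?_ (fun a => ?_) a
    · rw [Fin.snoc_last]
      have hm := H.mass i
      rcases he.2 with h2 | h2
      · have := congrArg (fun f : Option J → ℤ => ∑ t, f t) h2
        simp only [Pi.sub_apply, Finset.sum_sub_distrib, Finset.sum_pi_single', Finset.mem_univ,
          if_true] at this
        omega
      · have := congrArg (fun f : Option J → ℤ => ∑ t, f t) h2
        simp only [Pi.add_apply, Finset.sum_add_distrib, Finset.sum_pi_single', Finset.mem_univ,
          if_true] at this
        omega
    · rw [Fin.snoc_castSucc]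
      exact H.mass a
  inj := Fin.snoc_injective_iff.2 ⟨H.inj, fun ⟨a, ha⟩ => hY' a ha⟩
  conn := by
    refine ⟨formalGraph (Fin.snoc (α := fun _ => Option J → ℤ) Y Y'), ?_, fun _ _ H => H.2⟩
    obtain ⟨G, hG, hGe⟩ := H.conn
    let f : G →g formalGraph (Fin.snoc (α := fun _ => Option J → ℤ) Y Y') :=
      { toFun := Fin.castSucc
        map_rel' := fun {a b} hab => by
          refine ⟨fun h => hab.ne (Fin.castSucc_injective _ h), ?_⟩
          rw [Fin.snoc_castSucc, Fin.snoc_castSucc]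
          exact hGe a b hab }
    rw [SimpleGraph.connected_iff_exists_forall_reachable]
    refine ⟨i.castSucc, fun a => Fin.lastCases ?_ (fun a => ?_) a⟩
    · refine SimpleGraph.Adj.reachable ⟨(Fin.castSucc_lt_last i).ne, h, l, ?_⟩
      rwa [Fin.snoc_castSucc, Fin.snoc_last]
    · exact (hG.preconnected i a).map f

/-- The values of the symbols: the unknown point `x` and the vectors `v j`. -/
def symbolValue {R : Type*} {n m : ℕ} (x : Fin n → R) (v : Fin m → Fin n → R)
    (t : Option (Fin m)) : Fin n → R :=
  t.elim x v

/-- The formal points `Y i` describe a connected set of `k + 1` points of the component `C`. -/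
structure IsGrowth {R : Type*} [CommRing R] {n m : ℕ} (v : Fin m → Fin n → R)
    (C : (geomGraph v).ConnectedComponent) (x : Fin n → R) {k : ℕ}
    (Y : Fin (k + 1) → Option (Fin m) → ℤ) : Prop where
  isConfig : IsFormalConfig Y
  bound : ∀ i t, |Y i t| ≤ k + 1
  supp : ∃ S : Finset (Fin m), S.card ≤ 2 * k ∧ ∀ i, ∀ j ∉ S, Y i (some j) = 0
  quad : ∀ i, ∑ a, vertexForm (Y i) (fun t => symbolValue x v t a)
    (fun t => symbolValue x v t a) = 0
  mem : ∀ i, formalPoint (Y i) (symbolValue x v) ∈ C.supp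

section growth

variable {R : Type*} [CommRing R] {n m : ℕ} {v : Fin m → Fin n → R}
  {C : (geomGraph v).ConnectedComponent} {x : Fin n → R}

theorem isGrowth_zero (hx : x ∈ C.supp) :
    IsGrowth v C x fun _ : Fin (0 + 1) => Pi.single none 1 where
  isConfig :=
    { sign := fun _ => Or.inl (by simp)
      mass := fun _ => by simp
      inj := fun a b _ => Fin.ext (by omega)
      conn := ⟨⊥, SimpleGraph.connected_iff_exists_forall_reachable _ |>.2
        ⟨0, fun a => by rw [show a = 0 from Fin.ext (by omega)]⟩, fun _ _ h => absurd h (by simp)⟩ }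
  bound _ t := by
    by_cases ht : t = none
    · subst ht; simp
    · simp [ht]
  supp := ⟨∅, by simp, fun _ j _ => by simp⟩
  quad _ := by
    rw [sum_vertexForm_eq, formalPoint_single, formalEval_single]
    simp
  mem _ := by
    rw [formalPoint_single]
    exact hx

/-- An edge involves two new indices at most and changes the absolute value of each coefficient by
at most 1; this keeps the number of formal configurations finite. -/
theorem IsGrowth.snoc {k : ℕ} {Y : Fin (k + 1) → Option (Fin m) → ℤ} (H : IsGrowth v C x Y)
    {i : Fin (k + 1)} {b : Fin n → R}
    (hb : (geomGraph v).Adj (formalPoint (Y i) (symbolValue x v)) b)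
    (hb' : ∀ i, formalPoint (Y i) (symbolValue x v) ≠ b) :
    ∃ Y' : Option (Fin m) → ℤ, formalPoint Y' (symbolValue x v) = b ∧
      IsGrowth v C x (k := k + 1) (Fin.snoc (α := fun _ => Option (Fin m) → ℤ) Y Y') := by
  classical
  obtain ⟨-, h, l, hhl, he⟩ := id hb
  have hkey : ∃ Y' : Option (Fin m) → ℤ, formalPoint Y' (symbolValue x v) = b ∧
      IsFormalEdge h l (Y i) Y' ∧
      ∑ a, vertexForm Y' (fun t => symbolValue x v t a) (fun t => symbolValue x v t a) = 0 := by
    have hq := H.quad i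
    rw [sum_vertexForm_eq] at hq
    rcases he with he | he
    · refine ⟨Y i + (Pi.single (some l) 1 - Pi.single (some h) 1), ?_, ⟨hhl, Or.inl (by simp)⟩, ?_⟩
      · rw [formalPoint_add, formalPoint_sub, formalPoint_single, formalPoint_single]
        change _ + (v l - v h) = b
        rw [← he.1]
        simp
      · rw [sum_vertexForm_eq, formalPoint_add, formalPoint_sub, formalPoint_single,
          formalPoint_single, formalEval_add_left, formalEval_sub_left, formalEval_single,
          formalEval_single]
        change dotProduct (_ + (v l - v h)) (_ + (v l - v h)) -
          (_ + ((1 : ℤ) * dotProduct (v l) (v l) - (1 : ℤ) * dotProduct (v h) (v h))) = 0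
        rw [← he.1, add_sub_cancel]
        have := he.2
        push_cast
        linear_combination hq + this
    · refine ⟨(Pi.single (some h) 1 + Pi.single (some l) 1) - Y i, ?_, ⟨hhl, Or.inr (by simp)⟩, ?_⟩
      · rw [formalPoint_sub, formalPoint_add, formalPoint_single, formalPoint_single]
        change (v h + v l) - _ = b
        rw [← he.1]
        simp
      · rw [sum_vertexForm_eq, formalPoint_sub, formalPoint_add, formalPoint_single,
          formalPoint_single, formalEval_sub_left, formalEval_add_left, formalEval_single,
          formalEval_single]
        change dotProduct ((v h + v l) - _) ((v h + v l) - _) - (((1 : ℤ) * dotProduct (v h) (v h)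
          + (1 : ℤ) * dotProduct (v l) (v l)) - _) = 0
        rw [← he.1, add_sub_cancel_left]
        have := he.2
        push_cast
        linear_combination this - hq
  obtain ⟨Y', hY'b, hedge, hquad⟩ := hkey
  have hent : ∀ t, |Y' t| ≤ |Y i t| + 1 := by
    have h1 : ∀ t, |(Pi.single (some l) 1 - Pi.single (some h) 1 : Option (Fin m) → ℤ) t| ≤ 1 ∧
        |(Pi.single (some h) 1 + Pi.single (some l) 1 : Option (Fin m) → ℤ) t| ≤ 1 := fun t => by
      have : (some h : Option (Fin m)) ≠ some l := fun h' => hhl (Option.some_injective _ h')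
      simp only [Pi.sub_apply, Pi.add_apply, Pi.single_apply]
      by_cases h1 : t = some h
      · subst h1; simp [this]
      · by_cases h2 : t = some l
        · simp [h2, this.symm]
        · simp [h1, h2]
    intro t
    rcases hedge.2 with h2 | h2
    · have := congrFun h2 t
      have h3 := (h1 t).1
      rw [← this, Pi.sub_apply] at h3
      have := abs_sub_abs_le_abs_sub (Y' t) (Y i t)
      omega
    · have := congrFun h2 t
      have h3 := (h1 t).2
      rw [← this, Pi.add_apply] at h3
      have := abs_sub_abs_le_abs_sub (Y' t) (-Y i t)
      rw [abs_neg, sub_neg_eq_add, add_comm (Y' t)] at this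
      omega
  refine ⟨Y', hY'b, ?_⟩
  constructor
  · exact H.isConfig.snoc (fun i hi => hb' i (by rw [hi, hY'b])) hedge
  · intro a t
    push_cast
    refine Fin.lastCases ?_ (fun a => ?_) a
    · rw [Fin.snoc_last]
      have h1 := hent t
      have h2 := H.bound i t
      omega
    · rw [Fin.snoc_castSucc]
      have h2 := H.bound a t
      omega
  · obtain ⟨S, hS, hSY⟩ := H.supp
    refine ⟨insert h (insert l S), ?_, fun a j hj => ?_⟩
    · have h1 := Finset.card_insert_le h (insert l S)
      have h2 := Finset.card_insert_le l S
      omega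
    · simp only [Finset.mem_insert, not_or] at hj
      refine Fin.lastCases ?_ (fun a => ?_) a
      · rw [Fin.snoc_last]
        rcases hedge.2 with h2 | h2
        · have := congrFun h2 (some j)
          simpa [hj.1, hj.2.1, hSY i j hj.2.2] using this
        · have := congrFun h2 (some j)
          simpa [hj.1, hj.2.1, hSY i j hj.2.2] using this
      · rw [Fin.snoc_castSucc]
        exact hSY a j hj.2.2
  · intro a
    refine Fin.lastCases ?_ (fun a => ?_) a
    · rw [Fin.snoc_last]
      exact hquad
    · rw [Fin.snoc_castSucc]
      exact H.quad a
  · intro a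
    refine Fin.lastCases ?_ (fun a => ?_) a
    · rw [Fin.snoc_last, hY'b]
      exact C.mem_supp_of_adj_mem_supp (H.mem i) hb
    · rw [Fin.snoc_castSucc]
      exact H.mem a

end growth

theorem affineIndependent_iff_fintype {k V ι : Type*} [Ring k] [AddCommGroup V] [Module k V]
    [Fintype ι] {p : ι → V} : AffineIndependent k p ↔
      ∀ c : ι → k, ∑ i, c i = 0 → ∑ i, c i • p i = 0 → c = 0 := by
  classical
  rw [affineIndependent_iff]
  refine ⟨fun h c h1 h2 => funext fun i => h Finset.univ c h1 h2 i (Finset.mem_univ i),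
    fun h s w h1 h2 e he => ?_⟩
  have := congrFun (h (fun i => if i ∈ s then w i else 0) (by simpa using h1)
    (by simpa [ite_smul] using h2)) e
  simpa [he] using this

/-- A component that has no more points than a connected set `S` of its points contains a
neighbour of a point of `S`. -/
theorem SimpleGraph.ConnectedComponent.exists_adj_of_ne {V : Type*} {G : SimpleGraph V}
    (C : G.ConnectedComponent) {S : Set V} (hS : S ⊆ C.supp) (hne : S.Nonempty) (h : S ≠ C.supp) :
    ∃ a ∈ S, ∃ b ∉ S, G.Adj a b := by
  obtain ⟨t, htC, htS⟩ := Set.exists_of_ssubset (hS.ssubset_of_ne h)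
  obtain ⟨x, hx⟩ := hne
  obtain ⟨a, ha, b, hb, hab⟩ := C.connected_toSimpleGraph.exists_adj_mem_notMem
    (S := {z : C.supp | z.1 ∈ S}) (x := ⟨x, hS hx⟩) (t := ⟨t, htC⟩) hx htS
  exact ⟨a, ha, b, hb, hab⟩

/-- The vectors `v j` satisfy no algebraic relation that a degenerate configuration gives. -/
def IsConfigGeneric {n m : ℕ} (v : Fin m → Fin n → ℤ) : Prop :=
  ∀ (p k : ℕ) (s : Fin p ↪ Fin m), p ≤ 2 * (n + 1) → k ≤ n →
    ∀ Y : Fin (k + 2) → Option (Fin p) → ℤ, IsFormalConfig Y → (∀ i t, |Y i t| ≤ n + 2) →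
      ∀ V : Option (Fin p) → Fin n → ℝ, (∀ j a, V (some j) a = v (s j) a) →
        ¬ IsDegenerate Y (Fin.last _) V

/-- The old points are independent, so any relation involves the new point and can be normalized to
have coefficient 1 there. -/
theorem isDegenerate_snoc {n m k : ℕ} {v : Fin m → Fin n → ℝ}
    {C : (geomGraph v).ConnectedComponent} (hC : ∀ j, v j ∉ C.supp) {x : Fin n → ℝ}
    {Y : Fin (k + 1) → Option (Fin m) → ℤ} {Y' : Option (Fin m) → ℤ}
    (hY : AffineIndependent ℝ fun i => formalPoint (Y i) (symbolValue x v))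
    (H : IsGrowth v C x (k := k + 1) (Fin.snoc (α := fun _ => Option (Fin m) → ℤ) Y Y'))
    (hdep : ¬ AffineIndependent ℝ fun i => formalPoint
      (Fin.snoc (α := fun _ => Option (Fin m) → ℤ) Y Y' i) (symbolValue x v)) :
    IsDegenerate (Fin.snoc (α := fun _ => Option (Fin m) → ℤ) Y Y') (Fin.last _)
      (symbolValue x v) := by
  have hsum : ∀ (c : Fin (k + 1 + 1) → ℝ) a, ∑ i, c i *
      formalEval (Fin.snoc (α := fun _ => Option (Fin m) → ℤ) Y Y' i)
        (fun t => symbolValue x v t a)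
      = (∑ i, c i • formalPoint (Fin.snoc (α := fun _ => Option (Fin m) → ℤ) Y Y' i)
        (symbolValue x v)) a := fun c a => by
    rw [Finset.sum_apply]
    rfl
  have hind : ∀ c : Fin (k + 1 + 1) → ℝ, ∑ i, c i = 0 →
      ∑ i, c i • formalPoint (Fin.snoc (α := fun _ => Option (Fin m) → ℤ) Y Y' i)
        (symbolValue x v) = 0 → c (Fin.last _) = 0 → c = 0 := by
    intro c h1 h2 h3
    rw [Fin.sum_univ_castSucc] at h1 h2
    simp only [Fin.snoc_castSucc, h3, zero_smul, add_zero] at h1 h2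
    have := affineIndependent_iff_fintype.1 hY (fun i => c i.castSucc) h1 h2
    ext i
    exact Fin.lastCases h3 (fun i => congrFun this i) i
  constructor
  · exact H.quad
  · intro i j
    by_contra! hh
    exact hC j ((funext hh : formalPoint _ _ = v j) ▸ H.mem i)
  · intro c h1 h2 h3
    exact hind c h1 (funext fun a => by rw [← hsum, h2 a]; rfl) h3
  · rw [affineIndependent_iff_fintype] at hdep
    push Not at hdep
    obtain ⟨c, h1, h2, h3⟩ := hdep
    have h4 : c (Fin.last _) ≠ 0 := fun h => h3 (hind c h1 h2 h)
    refine ⟨fun i => (c (Fin.last _))⁻¹ * c i, ?_, fun a => ?_, inv_mul_cancel₀ h4⟩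
    · rw [← Finset.mul_sum, h1, mul_zero]
    · simp only [mul_assoc, ← Finset.mul_sum]
      rw [hsum, h2]
      simp

/-- The points of a component that contains no `v j` are affinely independent. -/
theorem affineIndependent_supp {n m : ℕ} {v : Fin m → Fin n → ℤ} (hv : IsConfigGeneric v)
    {w : Fin m → Fin n → ℝ} (hw : ∀ i a, w i a = v i a)
    (C : (geomGraph w).ConnectedComponent) (hC : ∀ j, w j ∉ C.supp) :
    AffineIndependent ℝ (fun x : C.supp => (x : Fin n → ℝ)) ∧ C.supp.encard ≤ n + 1 := by
  classical
  obtain ⟨x, hx⟩ := C.nonempty_supp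
  let P : ℕ → Prop := fun k => ∃ Y : Fin (k + 1) → Option (Fin m) → ℤ, IsGrowth w C x Y ∧
    AffineIndependent ℝ fun i => formalPoint (Y i) (symbolValue x w)
  have hP0 : P 0 := ⟨_, isGrowth_zero hx, by
    have : Subsingleton (Fin (0 + 1)) := ⟨fun a b => Fin.ext (by omega)⟩
    exact affineIndependent_of_subsingleton ℝ _⟩
  have hPn : ∀ k, P k → k ≤ n := by
    rintro k ⟨Y, -, hY⟩
    have h1 := hY.card_le_finrank_succ
    have h2 := Submodule.finrank_le
      (vectorSpan ℝ (Set.range fun i => formalPoint (Y i) (symbolValue x w)))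
    rw [Module.finrank_fin_fun] at h2
    rw [Fintype.card_fin] at h1
    omega
  -- Take a connected affinely independent set of maximal size. A neighbour outside it would make
  -- the configuration degenerate.
  have hk := Nat.findGreatest_spec (P := P) (Nat.zero_le n) hP0
  have hk1 := hPn _ hk
  have hk2 : ¬ P (Nat.findGreatest P n + 1) := fun h =>
    (Nat.findGreatest_is_greatest (Nat.lt_succ_self _) (hPn _ h)) h
  generalize Nat.findGreatest P n = k at hk hk1 hk2
  obtain ⟨Y, hY, hind⟩ := hk
  by_cases hS : Set.range (fun i => formalPoint (Y i) (symbolValue x w)) = C.supp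
  · rw [← hS]
    refine ⟨hind.range, ?_⟩
    rw [← Set.image_univ]
    refine (Set.encard_image_le _ _).trans ?_
    rw [Set.encard_univ, ENat.card_eq_coe_fintype_card, Fintype.card_fin]
    exact_mod_cast Nat.succ_le_succ hk1
  · exfalso
    obtain ⟨a, ⟨i, rfl⟩, b, hb, hab⟩ := C.exists_adj_of_ne
      (by rintro _ ⟨i, rfl⟩; exact hY.mem i) (Set.range_nonempty _) hS
    obtain ⟨Y', -, hg⟩ := hY.snoc hab fun i hi => hb ⟨i, hi⟩
    have hdeg := isDegenerate_snoc hC hind hg fun h => hk2 ⟨_, hg, h⟩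
    obtain ⟨S, hS, hSY⟩ := hg.supp
    obtain ⟨s, hs⟩ := exists_embedding_of_support S
    have hSY' : ∀ i j, (∀ l, s l ≠ j) →
        Fin.snoc (α := fun _ => Option (Fin m) → ℤ) Y Y' i (some j) = 0 := fun i j hj =>
      hSY i j fun hjS => let ⟨l, hl⟩ := hs j hjS; hj l hl
    -- The k + 1 edges of the growth use at most 2(k + 1) ≤ 2(n + 1) indices, and the coefficients
    -- are at most k + 2 ≤ n + 2.
    refine hv S.card k s (by omega) hk1 _ (hg.isConfig.reindex s hSY') (fun i t => ?_) _ ?_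
      (hdeg.reindex s hSY')
    · refine (hg.bound _ _).trans ?_
      push_cast
      omega
    · exact fun j a => hw (s j) a

/-! ### Nonresonant lists and the special component. -/

/-- The list `v` avoids all resonances. -/
structure IsNonresonant {n m : ℕ} (v : Fin m → Fin n → ℤ) : Prop where
  isConfig : IsConfigGeneric v
  angle : ∀ i j k, i ≠ j → i ≠ k → j ≠ k → dotProduct (v i - v j) (v i - v k) ≠ 0
  diff : ∀ h k h' k', h ≠ k → v k - v h = v k' - v h' → h = h' ∧ k = k'

theorem exists_resonances (n : ℕ) (hn : 1 ≤ n) :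
    ∃ res : Finset (Σ p : ℕ, MvPolynomial (Fin p × Fin n) ℤ),
      (∀ P ∈ res, P.1 ≤ 2 * (n + 1) ∧ P.2 ≠ 0) ∧
      ∀ (m : ℕ) (v : Fin m → Fin n → ℤ), IsGeneric res v → IsNonresonant v := by
  classical
  obtain ⟨res₁, h₁, h₁'⟩ := exists_config_resonances n hn
  obtain ⟨res₂, h₂, h₂'⟩ := exists_linear_resonances n hn
  obtain ⟨R, hR, hR'⟩ := exists_angle_resonance n hn
  refine ⟨res₁ ∪ res₂ ∪ {⟨3, R⟩}, ?_, fun m v hv => ⟨?_, ?_, ?_⟩⟩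
  · intro P hP
    simp only [Finset.mem_union, Finset.mem_singleton] at hP
    rcases hP with (hP | hP) | rfl
    · exact h₁ P hP
    · exact h₂ P hP
    · exact ⟨by dsimp only; omega, hR⟩
  · intro p k s hp hk Y hY hb V hV
    obtain ⟨R, hR, hR'⟩ := h₁' p k hp hk Y hY hb
    exact hR' (fun j => v (s j)) (hv ⟨p, R⟩ (by simp [hR]) s) V hV
  · intro i j k hij hik hjk
    have hs : Function.Injective ![i, j, k] := by
      intro a b
      fin_cases a <;> fin_cases b <;> simp [hij, hik, hjk, hij.symm, hik.symm, hjk.symm]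
    have := hv ⟨3, R⟩ (by simp) ⟨![i, j, k], hs⟩
    dsimp only at this
    rw [hR' fun a => v ((⟨![i, j, k], hs⟩ : Fin 3 ↪ Fin m) a)] at this
    exact this
  · intro h k h' k' hhk heq
    -- The formal difference of the two sides. It involves at most 4 indices with coefficients at
    -- most 2 in absolute value, so if nonzero it would be an excluded linear relation.
    let c : Fin m → ℤ := Pi.single k 1 - Pi.single h 1 - Pi.single k' 1 + Pi.single h' 1
    have hc : ∑ j, c j * v j ⟨0, hn⟩ = 0 := by
      have := congrFun heq ⟨0, hn⟩
      simp only [Pi.sub_apply] at this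
      simp only [c, Pi.add_apply, Pi.sub_apply, add_mul, sub_mul, Finset.sum_add_distrib,
        Finset.sum_sub_distrib, Pi.single_apply, ite_mul, one_mul, zero_mul, Finset.sum_ite_eq',
        Finset.mem_univ, if_true]
      omega
    have hb : ∀ j, |c j| ≤ 2 := by
      intro j
      simp only [c, Pi.add_apply, Pi.sub_apply, Pi.single_apply]
      rw [abs_le]
      constructor <;> split_ifs <;> omega
    have hc0 : c = 0 := by
      by_contra hc0
      let S : Finset (Fin m) := {k, h, k', h'}
      have hS : ∀ j ∉ S, c j = 0 := by
        intro j hj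
        simp only [S, Finset.mem_insert, Finset.mem_singleton, not_or] at hj
        simp [c, hj]
      have hcard : S.card ≤ 4 := Finset.card_le_four
      obtain ⟨s, hs⟩ := exists_embedding_of_support S
      have hS' : ∀ j, (∀ l, s l ≠ j) → c j = 0 := fun j hj =>
        hS j fun hjS => let ⟨l, hl⟩ := hs j hjS; hj l hl
      obtain ⟨R, hR, hR'⟩ := h₂' S.card hcard (fun i => c (s i)) (fun h => hc0 (by
        ext j
        by_cases hj : ∃ l, s l = j
        · obtain ⟨l, rfl⟩ := hj
          exact congrFun h l
        · push Not at hj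
          exact hS' j hj)) fun i => hb _
      apply hv ⟨_, R⟩ (by simp [hR]) s
      dsimp only
      rw [hR' fun j => v (s j), ← hc]
      exact sum_comp_embedding s (fun j => c j * v j ⟨0, hn⟩) fun j hj => by rw [hS' j hj, zero_mul]
    have hk : k = k' := by
      by_contra hkk
      have := congrFun hc0 k
      simp only [c, Pi.add_apply, Pi.sub_apply, Pi.single_eq_same, Pi.single_eq_of_ne hhk.symm,
        Pi.single_eq_of_ne hkk, Pi.zero_apply, Pi.single_apply] at this
      split_ifs at this <;> omega
    subst hk
    refine ⟨?_, rfl⟩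
    by_contra hhh
    have := congrFun hc0 h
    simp [c, hhh] at this

section special

variable {R : Type*} [CommRing R] {n m : ℕ} {v : Fin m → Fin n → R}

/-- Any two distinct v_j, v_i are joined by the tautological red edge with marking (j, i). -/
theorem range_subset_supp {C : (geomGraph v).ConnectedComponent} {j : Fin m}
    (hj : v j ∈ C.supp) : Set.range v ⊆ C.supp := by
  rintro _ ⟨i, rfl⟩
  by_cases h : v j = v i
  · rwa [← h]
  · exact C.mem_supp_of_adj_mem_supp hj
      ⟨h, j, i, fun h' => h (by rw [h']), Or.inr ⟨rfl, rfl⟩⟩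

/-- The equation of an edge from v_j is a right angle between differences of v_j, v_h, v_k.
Genericity forces two indices to coincide, and then the other end is one of the v_i. -/
theorem mem_range_of_adj [NoZeroDivisors R] [CharZero R]
    (hv : ∀ i j k, i ≠ j → i ≠ k → j ≠ k → dotProduct (v i - v j) (v i - v k) ≠ 0) {j : Fin m}
    (hpos : ∀ x : Fin n → R, dotProduct x x = 0 → x = 0)
    {b : Fin n → R} (h : (geomGraph v).Adj (v j) b) : b ∈ Set.range v := by
  obtain ⟨-, h, k, hhk, H | H⟩ := h
  · have hb : b = v j + (v k - v h) := by rw [← H.1]; simp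
    by_cases hjh : j = h
    · subst hjh
      exact ⟨k, by rw [hb]; simp⟩
    have h2 : 2 * dotProduct (v h - v j) (v h - v k) = 0 := by
      have := H.2
      rw [hb] at this
      simp only [dotProduct_add, add_dotProduct, dotProduct_sub, sub_dotProduct] at this ⊢
      rw [dotProduct_comm (v h) (v j), dotProduct_comm (v k) (v j),
        dotProduct_comm (v k) (v h)] at *
      linear_combination this
    have h3 := (mul_eq_zero.1 h2).resolve_left two_ne_zero
    by_cases hjk : j = k
    · subst hjk
      have := hpos _ h3
      exact ⟨j, by rw [hb, ← neg_sub, this]; simp⟩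
    · exact absurd h3 (hv h j k (Ne.symm hjh) hhk hjk)
  · have hb : b = v h + v k - v j := by rw [← H.1]; simp
    by_cases hjh : j = h
    · subst hjh
      exact ⟨k, by rw [hb]; simp⟩
    by_cases hjk : j = k
    · subst hjk
      exact ⟨h, by rw [hb]; simp⟩
    have h2 : 2 * dotProduct (v j - v h) (v j - v k) = 0 := by
      have := H.2
      rw [hb] at this
      simp only [dotProduct_add, add_dotProduct, dotProduct_sub, sub_dotProduct] at this ⊢
      rw [dotProduct_comm (v h) (v j), dotProduct_comm (v k) (v j),
        dotProduct_comm (v k) (v h)] at *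
      linear_combination this
    exact absurd ((mul_eq_zero.1 h2).resolve_left two_ne_zero) (hv j h k hjh hjk hhk)

end special

section intReal

variable {n m : ℕ} {v : Fin m → Fin n → ℤ}

theorem dotProduct_intCast (x y : Fin n → ℤ) :
    dotProduct (fun a => (x a : ℝ)) (fun a => (y a : ℝ)) = (dotProduct x y : ℤ) := by
  simp [dotProduct]

/-- The inclusion of the integral geometric graph in the real one. -/
def geomGraphHom (v : Fin m → Fin n → ℤ) :
    geomGraph v →g geomGraph fun i a => (v i a : ℝ) where
  toFun x a := x a
  map_rel' {x y} hxy := by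
    obtain ⟨hne, h, k, hhk, H⟩ := hxy
    refine ⟨fun h => hne (funext fun a => Int.cast_injective (congrFun h a)), h, k, hhk, ?_⟩
    rcases H with H | H
    · refine Or.inl ⟨?_, ?_⟩
      · ext a
        have := congrFun H.1 a
        simp only [Pi.sub_apply] at this ⊢
        exact_mod_cast this
      · simp only [dotProduct_intCast]
        exact_mod_cast H.2
    · refine Or.inr ⟨?_, ?_⟩
      · ext a
        have := congrFun H.1 a
        simp only [Pi.add_apply] at this ⊢
        exact_mod_cast this
      · simp only [dotProduct_intCast]
        exact_mod_cast H.2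

theorem IsNonresonant.affineIndependent_real (hv : IsNonresonant v)
    (C : (geomGraph fun i a => (v i a : ℝ)).ConnectedComponent)
    (hC : C.supp ≠ Set.range fun i a => (v i a : ℝ)) :
    AffineIndependent ℝ (fun x : C.supp => (x : Fin n → ℝ)) ∧ C.supp.encard ≤ n + 1 := by
  refine affineIndependent_supp hv.isConfig (fun _ _ => rfl) C fun j hj => hC ?_
  have hr := range_subset_supp hj
  by_contra hne
  obtain ⟨a, ⟨i, rfl⟩, b, hb, hab⟩ := C.exists_adj_of_ne hr ⟨_, ⟨j, rfl⟩⟩ (Ne.symm hne)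
  refine hb (mem_range_of_adj (fun i j k hij hik hjk => ?_)
    (fun x => dotProduct_self_eq_zero.1) hab)
  have : ∀ i j : Fin m, ((fun a => (v i a : ℝ)) - fun a => (v j a : ℝ))
      = fun a => (((v i - v j) a : ℤ) : ℝ) := fun i j => by ext; simp
  rw [this, this, dotProduct_intCast]
  exact_mod_cast hv.angle i j k hij hik hjk

/-- An integral component lies in a real one. If that one is special, the integral component
consists of v_j's and is special too. -/
theorem IsNonresonant.affineIndependent_int (hv : IsNonresonant v)
    (C : (geomGraph v).ConnectedComponent) (hC : C.supp ≠ Set.range v) :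
    AffineIndependent ℝ (fun (x : C.supp) (a : Fin n) => ((x : Fin n → ℤ) a : ℝ)) ∧
      C.supp.encard ≤ n + 1 := by
  let C' := C.map (geomGraphHom v)
  have hmem : ∀ x ∈ C.supp, (fun a => (x a : ℝ)) ∈ C'.supp := by
    intro x hx
    rw [SimpleGraph.ConnectedComponent.mem_supp_iff] at hx ⊢
    simp only [C', ← hx]
    rfl
  have hinj : Function.Injective fun (x : Fin n → ℤ) (a : Fin n) => (x a : ℝ) := fun x y h =>
    funext fun a => Int.cast_injective (congrFun h a)
  obtain ⟨h1, h2⟩ := hv.affineIndependent_real C' fun h => hC <| by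
    have hsub : C.supp ⊆ Set.range v := fun x hx => by
      have := hmem x hx
      rw [h] at this
      obtain ⟨j, hj⟩ := this
      exact ⟨j, hinj hj⟩
    obtain ⟨x, hx⟩ := C.nonempty_supp
    obtain ⟨j, rfl⟩ := hsub hx
    exact hsub.antisymm (range_subset_supp hx)
  let f : C.supp ↪ C'.supp := ⟨fun x => ⟨_, hmem x x.2⟩, fun x y h =>
    Subtype.ext (hinj (congrArg Subtype.val h))⟩
  have h3 := h1.comp_embedding f
  refine ⟨h3, le_trans ?_ h2⟩
  rw [← hinj.encard_image]
  exact Set.encard_le_encard (Set.image_subset_iff.2 hmem)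

/-- The points of a component without red edges are affinely independent. -/
theorem IsNonresonant.affineIndependent_of_not_hasRedEdge (hv : IsNonresonant v)
    (C : (geomGraph v).ConnectedComponent) (hC : ¬ HasRedEdge v C) :
    AffineIndependent ℝ (fun (x : C.supp) (a : Fin n) => ((x : Fin n → ℤ) a : ℝ)) ∧
      C.supp.encard ≤ n + 1 := by
  by_cases h : C.supp = Set.range v
  -- The special component has red edges as soon as it has two points.
  · have hs : C.supp.Subsingleton := by
      intro a ha b hb
      by_contra hab
      rw [h] at ha hb
      obtain ⟨i, rfl⟩ := ha
      obtain ⟨j, rfl⟩ := hb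
      exact hC ⟨v i, by rw [h]; exact ⟨i, rfl⟩, v j, by rw [h]; exact ⟨j, rfl⟩, hab, i, j,
        fun h => hab (by rw [h]), rfl, rfl⟩
    have : Subsingleton C.supp := hs.coe_sort
    exact ⟨affineIndependent_of_subsingleton ℝ _,
      (Set.encard_le_one_iff_subsingleton.2 hs).trans (by simp)⟩
  · exact hv.affineIndependent_int C h

end intReal

/-! ### Finiteness of the components with red edges. -/

section red

variable {n m : ℕ}

theorem dotProduct_self_nonneg_int (x : Fin n → ℤ) : 0 ≤ dotProduct x x :=
  Finset.sum_nonneg fun _ _ => mul_self_nonneg _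

theorem finite_setOf_dotProduct_self_le (N : ℤ) : {x : Fin n → ℤ | dotProduct x x ≤ N}.Finite := by
  refine (Set.finite_Icc (fun _ => -N) (fun _ => N)).subset fun x hx => ?_
  have h : ∀ a, |x a| ≤ N := fun a => by
    have h1 : x a * x a ≤ dotProduct x x :=
      Finset.single_le_sum (f := fun a => x a * x a) (fun a _ => mul_self_nonneg _)
        (Finset.mem_univ a)
    have h2 : dotProduct x x ≤ N := hx
    rw [← abs_mul_abs_self] at h1
    nlinarith [abs_nonneg (x a)]
  exact ⟨fun a => (abs_le.1 (h a)).1, fun a => (abs_le.1 (h a)).2⟩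

/-- Only finitely many points are on a red edge. -/
theorem finite_red_points (v : Fin m → Fin n → ℤ) :
    {a : Fin n → ℤ | ∃ b h k, h ≠ k ∧ IsRedEdge v h k a b}.Finite := by
  refine (Set.finite_iUnion fun q : Fin m × Fin m => finite_setOf_dotProduct_self_le (n := n)
    (dotProduct (v q.1) (v q.1) + dotProduct (v q.2) (v q.2))).subset ?_
  rintro a ⟨b, h, k, -, H⟩
  refine Set.mem_iUnion.2 ⟨(h, k), ?_⟩
  have := dotProduct_self_nonneg_int b
  have h2 := H.2
  change dotProduct a a ≤ dotProduct (v h) (v h) + dotProduct (v k) (v k)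
  omega

theorem finite_hasRedEdge (v : Fin m → Fin n → ℤ) :
    {C : (geomGraph v).ConnectedComponent | HasRedEdge v C}.Finite := by
  refine ((finite_red_points v).image (geomGraph v).connectedComponentMk).subset ?_
  rintro C ⟨a, ha, b, -, -, h, k, hhk, H⟩
  exact ⟨a, ⟨b, h, k, hhk, H⟩, ha⟩

end red

/-! ### Families of components without red edges. -/

section families

variable {n m : ℕ} {v : Fin m → Fin n → ℤ}

instance MGraph.instFinite (m : ℕ) (V : Type*) [Finite V] : Finite (MGraph m V) := by
  have : Finite EdgeColor := Finite.of_injective (β := Bool)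
    (fun c => match c with | .black => true | .red => false) (by rintro ⟨⟩ ⟨⟩ <;> simp)
  have hD : ∀ G : SimpleGraph V, Finite G.Dart := fun G =>
    Finite.of_injective (fun d : G.Dart => d.toProd) fun d d' h => SimpleGraph.Dart.ext d d' h
  refine Finite.of_injective (β := Σ G : SimpleGraph V, (G.Dart → EdgeColor) ×
    (G.Dart → Fin m × Fin m)) (fun G => ⟨G.graph, G.color, G.mark⟩) ?_
  rintro ⟨G, h1, c, h2, μ, h3, h4⟩ ⟨G', h1', c', h2', μ', h3', h4'⟩ h
  simp only [Sigma.mk.injEq] at h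
  obtain ⟨rfl, h⟩ := h
  obtain ⟨rfl, rfl⟩ := Prod.mk.inj (eq_of_heq h)
  rfl

/-- The marking of a black edge is determined by its end points, so a black component determines its
marked graph up to isomorphism. -/
theorem IsNonresonant.black_marking_unique (hv : IsNonresonant v) {h k h' k' : Fin m}
    {a b : Fin n → ℤ} (hhk : h ≠ k) (H : IsBlackEdge v h k a b) (H' : IsBlackEdge v h' k' a b) :
    (h, k) = (h', k') := by
  obtain ⟨h1, h2⟩ := hv.diff h k h' k' hhk (H.1.symm.trans H'.1)
  rw [h1, h2]

/-- A component without red edges is realized by a marked graph. -/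
theorem IsNonresonant.exists_isRealization (hv : IsNonresonant v)
    (C : (geomGraph v).ConnectedComponent) (hC : ¬ HasRedEdge v C) :
    ∃ F : Σ k : ℕ, MGraph m (Fin (k + 1)), F.1 ≤ n ∧ F.2.IsBlack ∧
      ∃ x : Fin (F.1 + 1) → Fin n → ℤ, F.2.IsRealization v C x := by
  classical
  have hcard := (hv.affineIndependent_of_not_hasRedEdge C hC).2
  have hfin : C.supp.Finite := Set.finite_of_encard_le_coe (k := n + 1) (by exact_mod_cast hcard)
  have hne := C.nonempty_supp
  obtain ⟨k, hk⟩ : ∃ k, C.supp.ncard = k + 1 :=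
    ⟨C.supp.ncard - 1, by have := (Set.ncard_pos hfin).2 hne; omega⟩
  have hkn : k ≤ n := by
    rw [← hfin.cast_ncard_eq, hk] at hcard
    have : k + 1 ≤ n + 1 := by exact_mod_cast hcard
    omega
  have : Finite C.supp := hfin
  obtain ⟨e⟩ : Nonempty (Fin (k + 1) ≃ C.supp) := ⟨(Finite.equivFinOfCardEq hk).symm⟩
  let G : SimpleGraph (Fin (k + 1)) := (geomGraph v).comap fun i => (e i : Fin n → ℤ)
  have hG : G.Connected := by
    have : C.toSimpleGraph.comap e = G := rfl
    rw [← this]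
    exact (SimpleGraph.Iso.connected_iff (SimpleGraph.Iso.comap e C.toSimpleGraph)).2
      C.connected_toSimpleGraph
  have hex : ∀ d : G.Dart, ∃ q : Fin m × Fin m, q.1 ≠ q.2 ∧
      IsBlackEdge v q.1 q.2 (e d.fst) (e d.snd) := by
    intro d
    obtain ⟨hne, h, k, hhk, H⟩ := d.adj
    rcases H with H | H
    · exact ⟨(h, k), hhk, H⟩
    · exact absurd ⟨_, (e d.fst).2, _, (e d.snd).2, hne, h, k, hhk, H⟩ hC
  choose μ hμ hμ' using hex
  refine ⟨⟨k, G, hG, fun _ => EdgeColor.black, fun _ => rfl, μ, hμ, fun d => ?_⟩, hkn,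
    fun _ => rfl, fun i => e i, ?_, ?_, ?_, ?_⟩
  · exact hv.black_marking_unique (hμ _) (hμ' d.symm) (hμ' d).symm
  · exact Subtype.val_injective.comp e.injective
  · rw [Set.range_comp' Subtype.val, e.surjective.range_eq, Set.image_univ]
    exact Subtype.range_val
  · exact fun _ _ => Iff.rfl
  · exact fun d => ⟨fun _ => hμ' d, fun h => by cases h⟩

/-- Two black marked graphs that are realized on the same component have the same realizations. -/
theorem IsNonresonant.exists_isRealization_of (hv : IsNonresonant v) {V V' : Type*}
    {F : MGraph m V} {F' : MGraph m V'} (hF : F.IsBlack) (hF' : F'.IsBlack)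
    {C D : (geomGraph v).ConnectedComponent} {x : V → Fin n → ℤ} {x' : V' → Fin n → ℤ}
    (hx : F.IsRealization v C x) (hx' : F'.IsRealization v C x') {y : V → Fin n → ℤ}
    (hy : F.IsRealization v D y) : ∃ y' : V' → Fin n → ℤ, F'.IsRealization v D y' := by
  have hs : ∀ a, ∃ b, x b = x' a := fun a => by
    have : x' a ∈ Set.range x := by rw [hx.2.1, ← hx'.2.1]; exact ⟨a, rfl⟩
    exact this
  choose s hs using hs
  have hinj : Function.Injective s := fun a b h => hx'.1 (by rw [← hs, ← hs, h])
  have hsurj : Function.Surjective s := fun b => by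
    have : x b ∈ Set.range x' := by rw [hx'.2.1, ← hx.2.1]; exact ⟨b, rfl⟩
    obtain ⟨a, ha⟩ := this
    exact ⟨a, hx.1 (by rw [hs, ha])⟩
  have hadj : ∀ a b, F'.graph.Adj a b ↔ F.graph.Adj (s a) (s b) := fun a b => by
    rw [hx'.2.2.1, hx.2.2.1, hs, hs]
  refine ⟨y ∘ s, hy.1.comp hinj, by rw [hsurj.range_comp, hy.2.1], fun a b => ?_, fun d => ?_⟩
  · rw [hadj, hy.2.2.1]
    rfl
  · refine ⟨fun _ => ?_, fun h => by rw [hF'] at h; cases h⟩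
    let d' : F.graph.Dart := ⟨(s d.fst, s d.snd), (hadj _ _).1 d.adj⟩
    have h1 := (hx'.2.2.2 d).1 (hF' d)
    have h2 := (hx.2.2.2 d').1 (hF d')
    have h3 := (hy.2.2.2 d').1 (hF d')
    rw [show x d'.fst = x' d.fst from hs _, show x d'.snd = x' d.snd from hs _] at h2
    have h4 : F'.mark d = F.mark d' := hv.black_marking_unique (F'.mark_ne d) h1 h2
    rw [h4]
    exact h3

/-- There are finitely many marked graphs such that each component without red edges is realized by
exactly one of them. -/
theorem IsNonresonant.exists_families (hv : IsNonresonant v) :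
    ∃ fam : Set (Σ k : ℕ, MGraph m (Fin (k + 1))), fam.Finite ∧
      (∀ F ∈ fam, F.1 ≤ n ∧ F.2.IsBlack ∧ ∃ C : (geomGraph v).ConnectedComponent,
        ¬ HasRedEdge v C ∧ ∃ x : Fin (F.1 + 1) → Fin n → ℤ, F.2.IsRealization v C x) ∧
      ∀ C : (geomGraph v).ConnectedComponent, ¬ HasRedEdge v C →
        ∃! F : Σ k : ℕ, MGraph m (Fin (k + 1)),
          F ∈ fam ∧ ∃ x : Fin (F.1 + 1) → Fin n → ℤ, F.2.IsRealization v C x := by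
  classical
  let R : (Σ k : ℕ, MGraph m (Fin (k + 1))) → Set (geomGraph v).ConnectedComponent := fun F =>
    {C | ∃ x : Fin (F.1 + 1) → Fin n → ℤ, F.2.IsRealization v C x}
  let T : Set (Σ k : ℕ, MGraph m (Fin (k + 1))) :=
    {F | F.1 ≤ n ∧ F.2.IsBlack ∧ ∃ C ∈ R F, ¬ HasRedEdge v C}
  have hT : T.Finite := by
    refine (Set.finite_range fun F : Σ k : Fin (n + 1), MGraph m (Fin (k + 1)) =>
      (⟨F.1, F.2⟩ : Σ k : ℕ, MGraph m (Fin (k + 1)))).subset ?_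
    rintro ⟨k, G⟩ ⟨hk, -⟩
    exact ⟨⟨⟨k, Nat.lt_succ_of_le hk⟩, G⟩, rfl⟩
  -- Two graphs have the same realized components or none in common, so one representative of each
  -- class gives uniqueness.
  have hR : ∀ F ∈ T, ∀ F' ∈ T, ∀ C, C ∈ R F → C ∈ R F' → R F = R F' := by
    intro F hF F' hF' C hC hC'
    obtain ⟨x, hx⟩ := hC
    obtain ⟨x', hx'⟩ := hC'
    ext D
    exact ⟨fun ⟨y, hy⟩ => hv.exists_isRealization_of hF.2.1 hF'.2.1 hx hx' hy,
      fun ⟨y, hy⟩ => hv.exists_isRealization_of hF'.2.1 hF.2.1 hx' hx hy⟩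
  rcases T.eq_empty_or_nonempty with hT0 | ⟨F₀, hF₀⟩
  · refine ⟨∅, Set.finite_empty, by simp, fun C hC => ?_⟩
    obtain ⟨F, h1, h2, h3⟩ := hv.exists_isRealization C hC
    have : F ∈ T := ⟨h1, h2, C, h3, hC⟩
    rw [hT0] at this
    exact absurd this (Set.notMem_empty _)
  have : Nonempty (Σ k : ℕ, MGraph m (Fin (k + 1))) := ⟨F₀⟩
  let g := Function.invFunOn R T
  have hg : ∀ F ∈ T, g (R F) ∈ T ∧ R (g (R F)) = R F := fun F hF =>
    ⟨Function.invFunOn_mem ⟨F, hF, rfl⟩, Function.invFunOn_eq ⟨F, hF, rfl⟩⟩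
  refine ⟨(fun F => g (R F)) '' T, hT.image _, ?_, fun C hC => ?_⟩
  · rintro _ ⟨F, hF, rfl⟩
    obtain ⟨h1, h2, C, h3, h4⟩ := (hg F hF).1
    exact ⟨h1, h2, C, h4, h3⟩
  · obtain ⟨F, h1, h2, h3⟩ := hv.exists_isRealization C hC
    have hF : F ∈ T := ⟨h1, h2, C, h3, hC⟩
    refine ⟨g (R F), ⟨⟨F, hF, rfl⟩, ?_⟩, ?_⟩
    · have : C ∈ R (g (R F)) := by rw [(hg F hF).2]; exact h3
      exact this
    · rintro _ ⟨⟨F', hF', rfl⟩, h4⟩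
      have h5 : C ∈ R F' := by rw [← (hg F' hF').2]; exact h4
      dsimp only
      rw [hR F' hF' F hF C h5 h3]

end families

/-! ### Lattices of solutions and exceptional translates. -/

theorem finrank_range_add_finrank_ker_int {M N : Type*} [AddCommGroup M] [Module.Finite ℤ M]
    [AddCommGroup N] (f : M →ₗ[ℤ] N) :
    Module.finrank ℤ (LinearMap.range f) + Module.finrank ℤ (LinearMap.ker f)
      = Module.finrank ℤ M := by
  rw [← (LinearMap.quotKerEquivRange f).finrank_eq]
  exact Submodule.finrank_quotient_add_finrank _

/-- The matrix A has rank k because A Aᵀ is injective: A Aᵀ c = 0 gives |Aᵀ c|² = 0, and the rows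
are independent. -/
theorem finrank_ker_mulVecLin {k n : ℕ} {r : Fin k → Fin n → ℤ} (hr : LinearIndependent ℤ r) :
    Module.finrank ℤ (LinearMap.ker (Matrix.of r).mulVecLin) + k = n := by
  set A := Matrix.of r
  have h1 := finrank_range_add_finrank_ker_int A.mulVecLin
  rw [Module.finrank_fin_fun] at h1
  have h2 : Module.finrank ℤ (LinearMap.range A.mulVecLin) ≤ k := by
    simpa using Submodule.finrank_le (LinearMap.range A.mulVecLin)
  let f : (Fin k → ℤ) →ₗ[ℤ] LinearMap.range A.mulVecLin :=
    A.mulVecLin.rangeRestrict ∘ₗ A.transpose.mulVecLin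
  have hf : Function.Injective f := by
    rw [injective_iff_map_eq_zero]
    intro c hc
    have h3 : A.mulVec (A.transpose.mulVec c) = 0 := congrArg Subtype.val hc
    have h4 : dotProduct (A.transpose.mulVec c) (A.transpose.mulVec c) = 0 := by
      conv_lhs => rw [Matrix.mulVec_transpose, ← Matrix.dotProduct_mulVec,
        ← Matrix.mulVec_transpose, h3]
      simp
    have h5 : A.transpose.mulVec c = 0 := dotProduct_self_eq_zero.1 h4
    rw [Fintype.linearIndependent_iff] at hr
    ext i
    refine hr c ?_ i
    rw [← h5]
    ext a
    simp [A, Matrix.mulVec, dotProduct, mul_comm]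
  have h3 := LinearMap.finrank_le_finrank_of_injective hf
  rw [Module.finrank_fin_fun] at h3
  omega

/-- The kernel in `L` of a linear functional that does not vanish on `L` has smaller rank. -/
theorem finrank_inf_ker_lt {M : Type*} [AddCommGroup M] [Module.Finite ℤ M] [Module.Free ℤ M]
    (L : Submodule ℤ M) (f : M →ₗ[ℤ] ℤ) {z : M} (hz : z ∈ L) (hfz : f z ≠ 0) :
    Module.finrank ℤ (L ⊓ LinearMap.ker f : Submodule ℤ M) < Module.finrank ℤ L := by
  have h1 := finrank_range_add_finrank_ker_int (f ∘ₗ L.subtype)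
  have h2 : 0 < Module.finrank ℤ (LinearMap.range (f ∘ₗ L.subtype)) := by
    rw [Module.finrank_pos_iff]
    refine ⟨⟨0, ⟨f z, ⟨z, hz⟩, rfl⟩, fun h => hfz ?_⟩⟩
    exact (congrArg Subtype.val h).symm
  have h3 : Module.finrank ℤ (L ⊓ LinearMap.ker f : Submodule ℤ M)
      = Module.finrank ℤ (LinearMap.ker (f ∘ₗ L.subtype)) := by
    rw [LinearMap.ker_comp, ← Submodule.map_comap_subtype,
      LinearEquiv.finrank_eq (Submodule.equivMapOfInjective L.subtype L.subtype_injective _).symm]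
  omega

/-- The translations of the solutions of a black marked graph. -/
def solutionLattice {k n : ℕ} (x₀ : Fin (k + 1) → Fin n → ℤ) : Submodule ℤ (Fin n → ℤ) :=
  LinearMap.ker (Matrix.of fun i : Fin k => x₀ i.succ - x₀ 0).mulVecLin

section solutions

variable {k n m : ℕ} {v : Fin m → Fin n → ℤ} {G : MGraph m (Fin (k + 1))}
  {x₀ : Fin (k + 1) → Fin n → ℤ}

theorem mem_solutionLattice {y : Fin n → ℤ} :
    y ∈ solutionLattice x₀ ↔ ∀ a, dotProduct (x₀ a) y = dotProduct (x₀ 0) y := by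
  rw [solutionLattice, LinearMap.mem_ker, funext_iff]
  have : ∀ i : Fin k, ((Matrix.of fun i : Fin k => x₀ i.succ - x₀ 0).mulVecLin y) i
      = dotProduct (x₀ i.succ) y - dotProduct (x₀ 0) y := fun i =>
    sub_dotProduct (x₀ i.succ) (x₀ 0) y
  simp only [this, Pi.zero_apply, sub_eq_zero]
  exact ⟨fun h a => Fin.cases rfl h a, fun h i => h _⟩

theorem finrank_solutionLattice
    (h : AffineIndependent ℝ fun (i : Fin (k + 1)) (a : Fin n) => (x₀ i a : ℝ)) :
    Module.finrank ℤ (solutionLattice x₀) + k = n := by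
  refine finrank_ker_mulVecLin (Fintype.linearIndependent_iff.2 fun c hc i => ?_)
  have h1 := affineIndependent_iff_fintype.1 h (Fin.cons (-∑ i, (c i : ℝ)) fun i => (c i : ℝ))
    (by rw [Fin.sum_univ_succ]; simp) (by
      rw [Fin.sum_univ_succ]
      ext a
      have := congrArg (fun z : ℤ => (z : ℝ)) (congrFun hc a)
      simp only [Finset.sum_apply, Pi.smul_apply, Pi.sub_apply, smul_eq_mul, Pi.zero_apply,
        mul_sub, Finset.sum_sub_distrib, ← Finset.sum_mul] at this
      push_cast at this
      simp only [Fin.cons_zero, Fin.cons_succ, Pi.add_apply, Pi.smul_apply, smul_eq_mul,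
        Finset.sum_apply, Pi.zero_apply]
      linear_combination this)
  have := congrFun h1 i.succ
  simpa using this

/-- Translation by y adds only the linear term 2(b - a, y) to the quadratic equation. -/
theorem isBlackEdge_add_iff {h l : Fin m} {a b y : Fin n → ℤ} :
    IsBlackEdge v h l (a + y) (b + y) ↔ b - a = v l - v h ∧ dotProduct b b - dotProduct a a
      + 2 * dotProduct (b - a) y = dotProduct (v l) (v l) - dotProduct (v h) (v h) := by
  refine and_congr (by rw [add_sub_add_right_eq_sub]) ?_
  rw [← sub_eq_zero, ← sub_eq_zero (a := _ + 2 * _)]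
  have : dotProduct (b + y) (b + y) - dotProduct (a + y) (a + y)
      = dotProduct b b - dotProduct a a + 2 * dotProduct (b - a) y := by
    simp only [dotProduct_add, add_dotProduct, sub_dotProduct]
    rw [dotProduct_comm y b, dotProduct_comm y a]
    ring
  rw [this]

/-- The markings fix all differences along edges, so by connectedness solutions are translates. The
quadratic equations then say that y is orthogonal to every edge. -/
theorem MGraph.isSolution_iff (hG : G.IsBlack) (hx₀ : G.IsSolution v x₀)
    (x : Fin (k + 1) → Fin n → ℤ) :
    G.IsSolution v x ↔ ∃ y ∈ solutionLattice x₀, x = fun a => x₀ a + y := by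
  have hconst : ∀ {M : Type} (f : Fin (k + 1) → M), (∀ a b, G.graph.Adj a b → f a = f b) →
      ∀ a, f a = f 0 := by
    intro M f hf a
    obtain ⟨w⟩ := G.connected.preconnected a 0
    generalize (0 : Fin (k + 1)) = o at w
    induction w with
    | nil => rfl
    | cons h _ ih => exact (hf _ _ h).trans ih
  constructor
  · intro hx
    have h1 : ∀ a, x a - x₀ a = x 0 - x₀ 0 := hconst (fun a => x a - x₀ a) fun a b hab => by
      have h2 := ((hx ⟨(a, b), hab⟩).1 (hG _)).1
      have h3 := ((hx₀ ⟨(a, b), hab⟩).1 (hG _)).1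
      have h4 : x b - x a = x₀ b - x₀ a := h2.trans h3.symm
      rw [sub_eq_iff_eq_add] at h4 ⊢
      rw [h4]
      abel
    have h2 : ∀ a, x a = x₀ a + (x 0 - x₀ 0) := fun a => by rw [← h1 a]; simp
    refine ⟨x 0 - x₀ 0, mem_solutionLattice.2 ?_, funext h2⟩
    refine hconst (fun a => dotProduct (x₀ a) (x 0 - x₀ 0)) fun a b hab => ?_
    have h3 := (hx ⟨(a, b), hab⟩).1 (hG _)
    have h4 := ((hx₀ ⟨(a, b), hab⟩).1 (hG _)).2
    change IsBlackEdge v _ _ (x a) (x b) at h3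
    change dotProduct (x₀ b) (x₀ b) - dotProduct (x₀ a) (x₀ a) = _ at h4
    rw [h2 a, h2 b, isBlackEdge_add_iff, ← h4, sub_dotProduct] at h3
    have := h3.2
    omega
  · rintro ⟨y, hy, rfl⟩ d
    refine ⟨fun _ => ?_, fun h => by rw [hG] at h; cases h⟩
    have h := (hx₀ d).1 (hG d)
    rw [isBlackEdge_add_iff, sub_dotProduct, mem_solutionLattice.1 hy d.fst,
      mem_solutionLattice.1 hy d.snd, sub_self, mul_zero, add_zero]
    exact h

/-- The sum of the points of C determines (k + 1) y. A symmetry of G therefore cannot produce a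
second translate. -/
theorem MGraph.IsRealization.translation_unique {C : (geomGraph v).ConnectedComponent}
    {y y' : Fin n → ℤ} (h : G.IsRealization v C fun a => x₀ a + y)
    (h' : G.IsRealization v C fun a => x₀ a + y') : y = y' := by
  have hs : ∀ {y : Fin n → ℤ}, (G.IsRealization v C fun a => x₀ a + y) →
      ∑ᶠ p ∈ C.supp, p = ∑ a, x₀ a + (k + 1) • y := by
    intro y h
    rw [← h.2.1, finsum_mem_range h.1, finsum_eq_sum_of_fintype, Finset.sum_add_distrib]
    simp
  have h1 := (hs h).symm.trans (hs h')
  ext a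
  have h2 := congrFun (add_left_cancel h1) a
  simp only [Pi.smul_apply, nsmul_eq_mul] at h2
  exact mul_left_cancel₀ (by positivity) h2

/-- The translates of a realization are realizations, up to finitely many exceptional cosets. -/
theorem exists_exceptional_cosets {C₀ : (geomGraph v).ConnectedComponent} (hG : G.IsBlack)
    (hx₀ : G.IsRealization v C₀ x₀) :
    ∃ exc : Set ((Fin n → ℤ) × Submodule ℤ (Fin n → ℤ)), exc.Finite ∧
      (∀ e ∈ exc, e.2 ≤ solutionLattice x₀ ∧
        Module.finrank ℤ e.2 < Module.finrank ℤ (solutionLattice x₀)) ∧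
      ∀ y ∈ solutionLattice x₀, (∀ e ∈ exc, y - e.1 ∉ e.2) →
        ∃ C : (geomGraph v).ConnectedComponent, G.IsRealization v C (fun a => x₀ a + y) := by
  classical
  set L := solutionLattice x₀ with hL
  rcases Nat.eq_zero_or_pos (Module.finrank ℤ L) with h0 | hpos
  -- In rank 0 no coset of smaller rank exists, and none is needed: y = 0 gives back x₀.
  · refine ⟨∅, Set.finite_empty, by simp, fun y hy _ => ⟨C₀, ?_⟩⟩
    have : L = ⊥ := Submodule.finrank_eq_zero.1 h0
    rw [this, Submodule.mem_bot] at hy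
    simpa [hy] using hx₀
  -- `q e y` says that the translate by y satisfies the black edge equations at the vertex `e.1`
  -- with marking `e.2`. This is an inhomogeneous linear condition on y.
  let q : Fin (k + 1) × Fin m × Fin m → (Fin n → ℤ) → Prop := fun e y =>
    y ∈ L ∧ IsBlackEdge v e.2.1 e.2.2 (x₀ e.1 + y) (x₀ e.1 + (v e.2.2 - v e.2.1) + y)
  let f : Fin m × Fin m → (Fin n → ℤ) →ₗ[ℤ] ℤ := fun e => dotProductBilin ℤ ℤ (v e.2 - v e.1)
  -- The coset of L ⊓ ker f through one solution, if f is not zero on L. Otherwise ⊥ is a filler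
  -- that costs a single translate, of smaller rank because L has positive rank.
  let E₁ : Fin (k + 1) × Fin m × Fin m → (Fin n → ℤ) × Submodule ℤ (Fin n → ℤ) := fun e =>
    (if h : ∃ y, q e y then h.choose else 0,
      if ∀ z ∈ L, f e.2 z = 0 then ⊥ else L ⊓ LinearMap.ker (f e.2))
  let red := {a : Fin n → ℤ | ∃ b h k, h ≠ k ∧ IsRedEdge v h k a b}
  -- The finitely many translates that put a vertex on a red edge.
  let E₂ : Fin (k + 1) × (Fin n → ℤ) → (Fin n → ℤ) × Submodule ℤ (Fin n → ℤ) := fun e =>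
    (e.2 - x₀ e.1, ⊥)
  refine ⟨Set.range E₁ ∪ E₂ '' (Set.univ ×ˢ red), ?_, ?_, ?_⟩
  · exact (Set.finite_range E₁).union ((Set.finite_univ.prod (finite_red_points v)).image E₂)
  · rintro _ (⟨e, rfl⟩ | ⟨e, -, rfl⟩)
    · by_cases h : ∀ z ∈ L, f e.2 z = 0
      · have hE : (E₁ e).2 = ⊥ := if_pos h
        rw [hE]
        exact ⟨bot_le, by simpa using hpos⟩
      · have hE : (E₁ e).2 = L ⊓ LinearMap.ker (f e.2) := if_neg h
        rw [hE]
        push Not at h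
        obtain ⟨z, hz, hfz⟩ := h
        exact ⟨inf_le_left, finrank_inf_ker_lt L _ hz hfz⟩
    · exact ⟨bot_le, by simpa [E₂] using hpos⟩
  · intro y hy hexc
    have hsol := (G.isSolution_iff hG hx₀.2.2.2 _).2 ⟨y, hy, rfl⟩
    have hnbr : ∀ a b, (geomGraph v).Adj (x₀ a + y) b → ∃ c, b = x₀ c + y ∧ G.graph.Adj a c := by
      rintro a b ⟨hne, h, l, hhl, H | H⟩
      · obtain ⟨c₀, rfl⟩ : ∃ c₀, b = c₀ + y := ⟨b - y, by simp⟩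
        have hc₀ : c₀ = x₀ a + (v l - v h) := by
          rw [← H.1]
          simp
        -- Otherwise y would differ from the chosen solution of the same edge equation by an element
        -- of ker f, and lie in an exceptional coset.
        have hperp : ∀ z ∈ L, f (h, l) z = 0 := by
          by_contra hnp
          have hq : ∃ y, q (a, h, l) y := ⟨y, hy, by rw [hc₀] at H; exact H⟩
          refine hexc (E₁ (a, h, l)) (Or.inl ⟨_, rfl⟩) ?_
          simp only [E₁, dif_pos hq, if_neg hnp]
          have hq2 := hq.choose_spec
          generalize hq.choose = y₁ at hq2
          refine ⟨L.sub_mem hy hq2.1, ?_⟩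
          have h1 := (isBlackEdge_add_iff.1 hq2.2).2
          rw [hc₀] at H
          have h2 := (isBlackEdge_add_iff.1 H).2
          rw [add_sub_cancel_left] at h1 h2
          change dotProduct (v l - v h) (y - y₁) = 0
          rw [dotProduct_sub]
          dsimp only at h1
          omega
        -- The edge condition does not depend on y in L, so the edge is already present at y = 0,
        -- inside C₀.
        have hadj : (geomGraph v).Adj (x₀ a) c₀ := by
          refine ⟨fun h => hne (by rw [h]), h, l, hhl, Or.inl ?_⟩
          have h1 := isBlackEdge_add_iff.1 H
          refine ⟨h1.1, ?_⟩
          have h2 : dotProduct (c₀ - x₀ a) y = 0 := by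
            rw [h1.1]
            exact hperp y hy
          rw [← h1.2, h2]
          ring
        have hmem : c₀ ∈ Set.range x₀ := by
          rw [hx₀.2.1]
          refine C₀.mem_supp_of_adj_mem_supp ?_ hadj
          rw [← hx₀.2.1]
          exact ⟨a, rfl⟩
        obtain ⟨c, rfl⟩ := hmem
        exact ⟨c, rfl, (hx₀.2.2.1 a c).2 hadj⟩
      · refine absurd ?_ (hexc (E₂ (a, x₀ a + y))
          (Or.inr ⟨_, ⟨Set.mem_univ _, b, h, l, hhl, H⟩, rfl⟩))
        simp [E₂]
    have hadj : ∀ a b, G.graph.Adj a b → (geomGraph v).Adj (x₀ a + y) (x₀ b + y) := by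
      intro a b hab
      refine ⟨fun h => hab.ne (hx₀.1 (add_right_cancel h)), _, _, G.mark_ne ⟨(a, b), hab⟩,
        Or.inl ?_⟩
      exact (hsol ⟨(a, b), hab⟩).1 (hG _)
    have hinj : Function.Injective fun a => x₀ a + y := fun a b h => hx₀.1 (add_right_cancel h)
    refine ⟨(geomGraph v).connectedComponentMk (x₀ 0 + y), hinj, ?_, fun a b => ⟨hadj a b, ?_⟩,
      hsol⟩
    · have hsub : Set.range (fun a => x₀ a + y)
          ⊆ ((geomGraph v).connectedComponentMk (x₀ 0 + y)).supp := by
        rintro _ ⟨a, rfl⟩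
        let φ : G.graph →g geomGraph v := ⟨fun a => x₀ a + y, fun {a b} => hadj a b⟩
        exact SimpleGraph.ConnectedComponent.sound ((G.connected.preconnected a 0).map φ)
      by_contra hne
      obtain ⟨_, ⟨a, rfl⟩, b, hb, hab⟩ := SimpleGraph.ConnectedComponent.exists_adj_of_ne _ hsub
        (Set.range_nonempty _) hne
      obtain ⟨c, rfl, -⟩ := hnbr a b hab
      exact hb ⟨c, rfl⟩
    · intro hab
      obtain ⟨c, hc, hac⟩ := hnbr a _ hab
      rwa [hinj hc]

end solutions

/-! ### Assembly of the theorem. -/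

theorem mainTheorem4 (n : ℕ) (hn : 1 ≤ n) :
    ∃ res : Finset (Σ p : ℕ, MvPolynomial (Fin p × Fin n) ℤ),
      (∀ P ∈ res, P.1 ≤ 2 * (n + 1) ∧ P.2 ≠ 0) ∧
      ∀ (m : ℕ) (v : Fin m → Fin n → ℤ), IsGeneric res v →
        -- components in `ℝⁿ` other than the special one
        (∀ C : (geomGraph (fun i a => (v i a : ℝ))).ConnectedComponent,
          C.supp ≠ Set.range (fun i a => (v i a : ℝ)) →
            AffineIndependent ℝ (fun x : C.supp => (x : Fin n → ℝ)) ∧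
            C.supp.encard ≤ n + 1) ∧
        -- components in `ℤⁿ` other than the special one
        (∀ C : (geomGraph v).ConnectedComponent, C.supp ≠ Set.range v →
            AffineIndependent ℝ (fun (x : C.supp) (a : Fin n) => ((x : Fin n → ℤ) a : ℝ)) ∧
            C.supp.encard ≤ n + 1) ∧
        -- components with red edges
        {C : (geomGraph v).ConnectedComponent | HasRedEdge v C}.Finite ∧
        -- components with black edges only
        ∃ fam : Set (Σ k : ℕ, MGraph m (Fin (k + 1))),
          fam.Finite ∧
          (∀ F ∈ fam, F.1 ≤ n ∧ F.2.IsBlack) ∧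
          (∀ C : (geomGraph v).ConnectedComponent, ¬ HasRedEdge v C →
            ∃! F : Σ k : ℕ, MGraph m (Fin (k + 1)),
              F ∈ fam ∧ ∃ x : Fin (F.1 + 1) → Fin n → ℤ, F.2.IsRealization v C x) ∧
          ∀ F ∈ fam, ∃ (x₀ : Fin (F.1 + 1) → Fin n → ℤ) (L : Submodule ℤ (Fin n → ℤ)),
            Module.finrank ℤ L + F.1 = n ∧
            (∀ x : Fin (F.1 + 1) → Fin n → ℤ,
              F.2.IsSolution v x ↔ ∃ y ∈ L, x = fun a => x₀ a + y) ∧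
            (∀ C : (geomGraph v).ConnectedComponent,
              (∃ x : Fin (F.1 + 1) → Fin n → ℤ, F.2.IsRealization v C x) →
                ∃! y : Fin n → ℤ, y ∈ L ∧ F.2.IsRealization v C (fun a => x₀ a + y)) ∧
            ∃ exc : Set ((Fin n → ℤ) × Submodule ℤ (Fin n → ℤ)),
              exc.Finite ∧
              (∀ e ∈ exc, e.2 ≤ L ∧ Module.finrank ℤ e.2 < Module.finrank ℤ L) ∧
              ∀ y ∈ L, (∀ e ∈ exc, y - e.1 ∉ e.2) →
                ∃ C : (geomGraph v).ConnectedComponent,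
                  F.2.IsRealization v C (fun a => x₀ a + y) := by
  obtain ⟨res, hres, hgen⟩ := exists_resonances n hn
  refine ⟨res, hres, fun m v hv => ?_⟩
  replace hv := hgen m v hv
  obtain ⟨fam, hfin, hfam, hex⟩ := hv.exists_families
  refine ⟨hv.affineIndependent_real, hv.affineIndependent_int, finite_hasRedEdge v, fam, hfin,
    fun F hF => ⟨(hfam F hF).1, (hfam F hF).2.1⟩, hex, fun F hF => ?_⟩
  obtain ⟨-, hblack, C₀, hC₀, x₀, hx₀⟩ := hfam F hF
  let f : Fin (F.1 + 1) ↪ C₀.supp := ⟨fun a => ⟨x₀ a, by rw [← hx₀.2.1]; exact ⟨a, rfl⟩⟩,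
    fun a b h => hx₀.1 (congrArg Subtype.val h)⟩
  have hind := (hv.affineIndependent_of_not_hasRedEdge C₀ hC₀).1.comp_embedding f
  refine ⟨x₀, solutionLattice x₀, finrank_solutionLattice hind,
    F.2.isSolution_iff hblack hx₀.2.2.2, fun C hC => ?_, exists_exceptional_cosets hblack hx₀⟩
  obtain ⟨x, hx⟩ := hC
  obtain ⟨y, hy, rfl⟩ := (F.2.isSolution_iff hblack hx₀.2.2.2 x).1 hx.2.2.2
  exact ⟨y, ⟨hy, hx⟩, fun y' hy' => hy'.2.translation_unique hx⟩
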